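/- Let $n,m\ge 1$ be integers and $\alpha>0$. Let $\mu_k$ be Lebesgue measure on $\mathbb{R}^k$ (with $\mathbb{C}^n\cong\mathbb{R}^{2n}$), and put $\widetilde\mu_k=(2\pi)^{-k/2}\mu_k$. A smooth function $f\colon\mathbb{C}^n\to\mathbb{C}$ is called $m$-analytic if $\overline{D}^k f=0$ for every $k\in\mathbb{N}_0^n$ with $|k|=m$, where $\overline{D}^k=\prod_r(\partial/\partial\overline{z}_r)^{k_r}$. Let $\mathcal{F}_{\alpha,m}$ be the space of $m$-analytic functions on $\mathbb{C}^n$ with $$\|f\|^2_{\mathcal{F}_{\alpha,m}}=\frac{\alpha^n}{\pi^n}\int_{\mathbb{C}^n}|f(z)|^2e^{-\alpha|z|^2}\,d\mu_{2n}(z)<\infty .$$ For $f\in\mathcal{F}_{\alpha,m}$ put $$(Uf)(x,y)=2^{n/2}e^{-\frac12|x|^2-\frac12|y|^2-i\langle x,y\rangle}f\Bigl(\frac{x+iy}{\sqrt\alpha}\Bigr)\qquad(x,y\in\mathbb{R}^n),$$ and let $\mathcal{H}_m=\{Uf: f\in\mathcal{F}_{\alpha,m}\}$, with the inner product and norm of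 $L^2(\mathbb{R}^{2n},\widetilde\mu_{2n})$. Let $F$ be the Fourier--Plancherel transform of $L^2(\mathbb{R}^n,\widetilde\mu_n)$, $(Fg)(\xi)=(2\pi)^{-n/2}\int g(u)e^{-i\langle u,\xi\rangle}\,d\mu_n(u)$ for $g\in L^1\cap L^2$, and let $F\otimes I$ be the corresponding transform of $L^2(\mathbb{R}^{2n},\widetilde\mu_{2n})$ in the first variable $u\in\mathbb{R}^n$ of $(u,v)\in\mathbb{R}^n\times\mathbb{R}^n$. Let $\psi_k(t)=(2^kk!\sqrt\pi)^{-1/2}e^{-t^2/2}H_k(t)$ be the Hermite functions ($H_k$ the physicists' Hermite polynomials), let $J=\{k\in\mathbb{N}_0^n:|k|\le m-1\}$, $d=\#J$, let $\phi\colon\{1,\dots,d\}\to J$ be the enumeration of $J$ in the lexicographic order, and $$q_{k,\xi}(v)=2^{n/2}\pi^{n/4}\prod_{r=1}^n\psi_{k_r}\Bigl(\frac{\xi_r+2v_r}{\sqrt2}\Bigr),\qquad (NG)(\xi)_j=\int_{\mathbb{R}^n}G(\xi,v)\,q_{\phi(j),\xi}(v)\,d\widetilde\mu_n(v)\quad(1\le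 j\le d).$$ Then the following holds. 1. $R_{\mathcal{H}_m}:=N(F\otimes I)$ is a well-defined isometric isomorphism from $\mathcal{H}_m$ onto $L^2(\mathbb{R}^n,\widetilde\mu_n)^d$. If $g\in\mathcal{H}_m$ and $g\in L^1(\mathbb{R}^{2n})$, then for every $j$ and almost every $\xi\in\mathbb{R}^n$ $$(R_{\mathcal{H}_m}g)(\xi)_j=\frac{1}{2^{n/2}\pi^{3n/4}}\int_{\mathbb{R}^{2n}}g(u,v)\,e^{-i\langle u,\xi\rangle}\prod_{r=1}^n\psi_{\phi(j)_r}\Bigl(\frac{\xi_r+2v_r}{\sqrt2}\Bigr)\,d\mu_{2n}(u,v).$$ 2. $R_{\mathcal{F}_{\alpha,m}}:=R_{\mathcal{H}_m}U$ is a well-defined isometric isomorphism from $\mathcal{F}_{\alpha,m}$ onto $L^2(\mathbb{R}^n,\widetilde\mu_n)^d$. If $f\in\mathcal{F}_{\alpha,m}$ and $\int_{\mathbb{C}^n}|f(z)|e^{-\frac{\alpha}{2}|z|^2}\,d\mu_{2n}(z)<\infty$, then for every $j$ and almost every $\xi\in\mathbb{R}^n$ $$(R_{\mathcal{F}_{\alpha,m}}f)(\xi)_j=\frac{1}{\pi^{3n/4}}\int_{\mathbb{R}^{2n}}f\Bigl(\frac{u+iv}{\sqrt\alpha}\Bigr)e^{-\frac12|u|^2-\frac12|v|^2-i\langle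 u,v+\xi\rangle}\prod_{r=1}^n\psi_{\phi(j)_r}\Bigl(\frac{\xi_r+2v_r}{\sqrt2}\Bigr)\,d\mu_{2n}(u,v).$$ -/

import Mathlib

open MeasureTheory Complex
open scoped ContDiff TensorProduct

noncomputable section

namespace PolyFock

/-! ### Polyanalytic functions and the Bargmann–Segal–Fock space -/

/-- The Wirtinger operator `∂/∂z̄_r = (∂/∂x_r + i ∂/∂y_r) / 2` on functions `ℂⁿ → ℂ`. -/
def dbar {n : ℕ} (r : Fin n) (f : (Fin n → ℂ) → ℂ) : (Fin n → ℂ) → ℂ := fun z =>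
  (1 / 2) * (fderiv ℝ f z (Pi.single r 1) + I * fderiv ℝ f z (Pi.single r I))

/-- The Wirtinger operator of multi-index `k`: `∂/∂z̄_r` is applied `k r` times for every `r`. -/
def dbarPow {n : ℕ} (k : Fin n → ℕ) (f : (Fin n → ℂ) → ℂ) : (Fin n → ℂ) → ℂ :=
  (List.finRange n).foldr (fun r g => (dbar r)^[k r] g) f

/-- Homogeneously `m`-analytic functions on `ℂⁿ`. -/
def IsPolyanalytic {n : ℕ} (m : ℕ) (f : (Fin n → ℂ) → ℂ) : Prop :=
  ContDiff ℝ ∞ f ∧ ∀ k : Fin n → ℕ, ∑ r, k r = m → dbarPow k f = 0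

section Linearity

variable {n : ℕ} {f g : (Fin n → ℂ) → ℂ}

lemma contDiff_dbar (r : Fin n) (hf : ContDiff ℝ ∞ f) : ContDiff ℝ ∞ (dbar r f) := by
  have h : ContDiff ℝ ∞ (fderiv ℝ f) := hf.fderiv_right (by simp)
  unfold dbar
  fun_prop

lemma dbar_add (r : Fin n) (hf : ContDiff ℝ ∞ f) (hg : ContDiff ℝ ∞ g) :
    dbar r (f + g) = dbar r f + dbar r g := by
  funext z
  have hf' := (hf.differentiable (by simp)) z
  have hg' := (hg.differentiable (by simp)) z
  simp only [dbar, fderiv_add hf' hg', Pi.add_apply, add_apply]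
  ring

lemma dbar_smul (r : Fin n) (c : ℂ) (hf : ContDiff ℝ ∞ f) :
    dbar r (c • f) = c • dbar r f := by
  funext z
  have hf' := (hf.differentiable (by simp)) z
  simp only [dbar, fderiv_const_smul hf', Pi.smul_apply, smul_apply,
    smul_eq_mul]
  ring

lemma dbar_iterate (r : Fin n) (p : ℕ) (c : ℂ) (hf : ContDiff ℝ ∞ f) (hg : ContDiff ℝ ∞ g) :
    ContDiff ℝ ∞ ((dbar r)^[p] f) ∧
    (dbar r)^[p] (f + g) = (dbar r)^[p] f + (dbar r)^[p] g ∧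
    (dbar r)^[p] (c • f) = c • (dbar r)^[p] f := by
  induction p generalizing f g with
  | zero => exact ⟨hf, rfl, rfl⟩
  | succ p ih =>
    simp only [Function.iterate_succ, Function.comp_apply, dbar_add r hf hg, dbar_smul r c hf]
    exact ih (contDiff_dbar r hf) (contDiff_dbar r hg)

lemma dbarPow_linear (k : Fin n → ℕ) (c : ℂ) (hf : ContDiff ℝ ∞ f) (hg : ContDiff ℝ ∞ g) :
    dbarPow k (f + g) = dbarPow k f + dbarPow k g ∧ dbarPow k (c • f) = c • dbarPow k f := by
  unfold dbarPow
  have key : ∀ l : List (Fin n), ∀ f : (Fin n → ℂ) → ℂ, ContDiff ℝ ∞ f →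
      ContDiff ℝ ∞ (l.foldr (fun r g => (dbar r)^[k r] g) f) := by
    intro l f hf
    induction l with
    | nil => exact hf
    | cons r l ih => exact (dbar_iterate r (k r) c ih ih).1
  induction List.finRange n with
  | nil => exact ⟨rfl, rfl⟩
  | cons r l ih =>
    simp only [List.foldr_cons, ih.1, ih.2]
    exact (dbar_iterate r (k r) c (key l f hf) (key l g hg)).2

end Linearity

/-- The Gaussian measure `(α/π)ⁿ exp(-α |z|²) dμ_{2n}(z)` on `ℂⁿ`. -/
def gaussian (α : ℝ) (n : ℕ) : Measure (Fin n → ℂ) :=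
  volume.withDensity fun z =>
    ENNReal.ofReal ((α ^ n / Real.pi ^ n) * Real.exp (-α * ∑ r, ‖z r‖ ^ 2))

/-- The `m`-analytic Bargmann–Segal–Fock space `F_{α,m}(ℂⁿ)`. -/
def Fock (α : ℝ) (n m : ℕ) : Submodule ℂ ((Fin n → ℂ) → ℂ) where
  carrier := {f | IsPolyanalytic m f ∧ MemLp f 2 (gaussian α n)}
  zero_mem' := by
    have h0 : ContDiff ℝ ∞ (0 : (Fin n → ℂ) → ℂ) := contDiff_const
    refine ⟨⟨h0, fun k _ => ?_⟩, MemLp.zero⟩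
    simpa using (dbarPow_linear k 0 h0 h0).2
  add_mem' := by
    rintro f g ⟨⟨hf, hf'⟩, hf2⟩ ⟨⟨hg, hg'⟩, hg2⟩
    refine ⟨⟨hf.add hg, fun k hk => ?_⟩, hf2.add hg2⟩
    rw [(dbarPow_linear k 0 hf hg).1, hf' k hk, hg' k hk, add_zero]
  smul_mem' := by
    rintro c f ⟨⟨hf, hf'⟩, hf2⟩
    refine ⟨⟨contDiff_const.smul hf, fun k hk => ?_⟩, hf2.const_smul c⟩
    rw [(dbarPow_linear k c hf hf).2, hf' k hk, smul_zero]

/-- The class in `L²` of an element of the Fock space. -/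
def Fock.toLp (α : ℝ) (n m : ℕ) : Fock α n m →ₗ[ℂ] Lp ℂ 2 (gaussian α n) where
  toFun f := MemLp.toLp f.1 f.2.2
  map_add' _ _ := rfl
  map_smul' _ _ := rfl

lemma Fock.toLp_injective (α : ℝ) [hα : Fact (0 < α)] (n m : ℕ) :
    Function.Injective (Fock.toLp α n m) := by
  intro f g h
  have hα' := hα.out
  have h1 : f.1 =ᵐ[gaussian α n] g.1 := (MemLp.toLp_eq_toLp_iff f.2.2 g.2.2).1 h
  have h2 : (volume : Measure (Fin n → ℂ)) ≪ gaussian α n := by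
    apply withDensity_absolutelyContinuous'
    · apply Measurable.aemeasurable
      fun_prop
    · refine Filter.Eventually.of_forall fun z => ?_
      have : 0 < (α ^ n / Real.pi ^ n) * Real.exp (-α * ∑ r, ‖z r‖ ^ 2) := by positivity
      simpa using this
  exact Subtype.ext
    ((Continuous.ae_eq_iff_eq volume f.2.1.1.continuous g.2.1.1.continuous).1 (h2.ae_eq h1))

/-- The norm of `F_{α,m}` is the norm of `L²(ℂⁿ, (α/π)ⁿ exp(-α |z|²) dμ_{2n}(z))`. -/
instance (α : ℝ) [Fact (0 < α)] (n m : ℕ) : NormedAddCommGroup (Fock α n m) :=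
  NormedAddCommGroup.induced _ _ (Fock.toLp α n m) (Fock.toLp_injective α n m)

instance (α : ℝ) [Fact (0 < α)] (n m : ℕ) : InnerProductSpace ℂ (Fock α n m) :=
  InnerProductSpace.induced (Fock.toLp α n m)

/-! ### The flattened space -/

/-- The Euclidean space `ℝⁿ`. -/
abbrev E (n : ℕ) : Type := EuclideanSpace ℝ (Fin n)

/-- The Lebesgue measure of `ℝⁿ` multiplied by `(2π)^{-n/2}`. -/
def muTilde (n : ℕ) : Measure (E n) :=
  ENNReal.ofReal ((2 * Real.pi) ^ (-(n : ℝ) / 2)) • volume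

instance (n : ℕ) : (muTilde n).IsAddHaarMeasure :=
  Measure.IsAddHaarMeasure.smul _ (by simp; positivity) ENNReal.ofReal_ne_top

/-- The measure `(2π)^{-n} μ_{2n}` on `ℝ²ⁿ = ℝⁿ × ℝⁿ`. -/
abbrev muTilde2 (n : ℕ) : Measure (E n × E n) := (muTilde n).prod (muTilde n)

/-- The point `(x + i y) / √α` of `ℂⁿ`. -/
def cpoint (α : ℝ) {n : ℕ} (p : E n × E n) : Fin n → ℂ := fun r =>
  ((p.1 r : ℂ) + I * (p.2 r : ℂ)) / (Real.sqrt α : ℂ)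

/-- The flattening operator
`(U f)(x, y) = 2^{n/2} exp(-|x|²/2 - |y|²/2 - i⟨x,y⟩) f((x + i y)/√α)`. -/
def flatten (α : ℝ) (n : ℕ) : ((Fin n → ℂ) → ℂ) →ₗ[ℂ] (E n × E n → ℂ) where
  toFun f p := (((2 : ℝ) ^ ((n : ℝ) / 2) : ℝ) : ℂ) *
    cexp (-(‖p.1‖ ^ 2 : ℝ) / 2 - (‖p.2‖ ^ 2 : ℝ) / 2 - I * (inner ℝ p.1 p.2 : ℝ)) *
      f (cpoint α p)
  map_add' f g := by
    funext p
    simp only [Pi.add_apply]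
    ring
  map_smul' c f := by
    funext p
    simp only [Pi.smul_apply, smul_eq_mul, RingHom.id_apply]
    ring

/-- The flattened space `H_m`, the image of `F_{α,m}` under the flattening operator. -/
def FlatFock (α : ℝ) (n m : ℕ) : Submodule ℂ (E n × E n → ℂ) :=
  (Fock α n m).map (flatten α n)

/-- The flattening operator as a map `F_{α,m} → H_m`. -/
def U (α : ℝ) (n m : ℕ) : Fock α n m →ₗ[ℂ] FlatFock α n m :=
  (flatten α n).submoduleMap (Fock α n m)

section Change

/-- `(x, y) ↦ (x + i y) / √α` as a linear isomorphism. -/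
def cpointEquiv (α : ℝ) [hα : Fact (0 < α)] (n : ℕ) : (E n × E n) ≃L[ℝ] (Fin n → ℂ) :=
  LinearEquiv.toContinuousLinearEquiv
    { toFun := cpoint α
      invFun := fun z => (WithLp.toLp 2 fun r => Real.sqrt α * (z r).re,
        WithLp.toLp 2 fun r => Real.sqrt α * (z r).im)
      map_add' := fun p q => by
        funext r
        simp only [cpoint, Prod.fst_add, Prod.snd_add, PiLp.add_apply, Pi.add_apply]
        push_cast
        ring
      map_smul' := fun c p => by
        funext r
        simp only [cpoint, Prod.smul_fst, Prod.smul_snd, PiLp.smul_apply, Pi.smul_apply,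
          RingHom.id_apply, smul_eq_mul, real_smul]
        push_cast
        ring
      left_inv := fun p => by
        have h : Real.sqrt α ≠ 0 := (Real.sqrt_pos.2 hα.out).ne'
        ext r <;> simp [cpoint, div_ofReal_re, div_ofReal_im] <;> field_simp
      right_inv := fun z => by
        have h : (Real.sqrt α : ℂ) ≠ 0 := by
          exact_mod_cast (Real.sqrt_pos.2 hα.out).ne'
        funext r
        simp only [cpoint, ofReal_mul]
        rw [div_eq_iff h]
        conv_rhs => rw [← re_add_im (z r)]
        ring }

lemma continuous_cpoint (α : ℝ) [Fact (0 < α)] (n : ℕ) :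
    Continuous (cpoint α : E n × E n → Fin n → ℂ) := (cpointEquiv α n).continuous

lemma continuous_flatten (α : ℝ) [Fact (0 < α)] {n : ℕ} {f : (Fin n → ℂ) → ℂ}
    (hf : Continuous f) : Continuous (flatten α n f) := by
  have h := hf.comp (continuous_cpoint α n)
  simp only [flatten, LinearMap.coe_mk, AddHom.coe_mk]
  exact Continuous.mul (by fun_prop) h

lemma norm_cpoint (α : ℝ) [hα : Fact (0 < α)] {n : ℕ} (p : E n × E n) :
    α * ∑ r, ‖cpoint α p r‖ ^ 2 = ‖p.1‖ ^ 2 + ‖p.2‖ ^ 2 := by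
  have h := hα.out
  rw [EuclideanSpace.norm_sq_eq, EuclideanSpace.norm_sq_eq, Finset.mul_sum,
    ← Finset.sum_add_distrib]
  refine Finset.sum_congr rfl fun r _ => ?_
  have h2 : ‖(Real.sqrt α : ℂ)‖ ^ 2 = α := by
    rw [norm_real, Real.norm_eq_abs, sq_abs, Real.sq_sqrt h.le]
  rw [cpoint, norm_div, div_pow, h2, mul_div_cancel₀ _ h.ne', ← normSq_eq_norm_sq, normSq_apply]
  simp
  ring

lemma memLp_flatten (α : ℝ) [hα : Fact (0 < α)] {n m : ℕ} {f : (Fin n → ℂ) → ℂ}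
    (hf : f ∈ Fock α n m) : MemLp (flatten α n f) 2 (muTilde2 n) := by
  have hα' := hα.out
  have hc : Continuous f := hf.1.1.continuous
  rw [memLp_two_iff_integrable_sq_norm (continuous_flatten α hc).aestronglyMeasurable]
  have h1 := (memLp_two_iff_integrable_sq_norm hf.2.1).1 hf.2
  rw [gaussian, integrable_withDensity_iff_integrable_smul' (by fun_prop) (by simp)] at h1
  have h2 : Integrable (fun z => (ENNReal.ofReal
      ((α ^ n / Real.pi ^ n) * Real.exp (-α * ∑ r, ‖z r‖ ^ 2))).toReal • ‖f z‖ ^ 2)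
      ((muTilde2 n).map (cpointEquiv α n)) := by
    have : ((muTilde2 n).map (cpointEquiv α n)).IsAddHaarMeasure :=
      (cpointEquiv α n).isAddHaarMeasure_map _
    rw [Measure.isAddLeftInvariant_eq_smul ((muTilde2 n).map (cpointEquiv α n)) volume]
    exact h1.smul_measure_nnreal
  have h3 := (integrable_map_measure h2.aestronglyMeasurable
    (cpointEquiv α n).continuous.aemeasurable).1 h2
  refine (h3.const_mul (2 ^ n / (α ^ n / Real.pi ^ n))).congr
    (Filter.Eventually.of_forall fun p => ?_)
  have e1 : (cpointEquiv α n) p = cpoint α p := rfl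
  have e2 : (0 : ℝ) ≤ (α ^ n / Real.pi ^ n) * Real.exp (-(‖p.1‖ ^ 2 + ‖p.2‖ ^ 2)) := by positivity
  have e3 : ((2 : ℝ) ^ ((n : ℝ) / 2)) ^ 2 = 2 ^ n := by
    rw [← Real.rpow_natCast, ← Real.rpow_mul (by norm_num), ← Real.rpow_natCast]
    congr 1
    push_cast
    ring
  have e4 : ‖cexp (-(‖p.1‖ ^ 2 : ℝ) / 2 - (‖p.2‖ ^ 2 : ℝ) / 2 - I * (inner ℝ p.1 p.2 : ℝ))‖ ^ 2
      = Real.exp (-(‖p.1‖ ^ 2 + ‖p.2‖ ^ 2)) := by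
    rw [norm_exp, ← Real.exp_nat_mul]
    congr 1
    have : (-(‖p.1‖ ^ 2 : ℝ) / 2 - (‖p.2‖ ^ 2 : ℝ) / 2 - I * (inner ℝ p.1 p.2 : ℝ) : ℂ).re
        = -‖p.1‖ ^ 2 / 2 - ‖p.2‖ ^ 2 / 2 := by
      simp only [sub_re, mul_re, I_re, I_im, ofReal_re, ofReal_im, neg_re, div_ofNat_re]
      ring
    rw [this]
    push_cast
    ring
  have e5 : (0 : ℝ) ≤ (2 : ℝ) ^ ((n : ℝ) / 2) := by positivity
  simp only [Function.comp_apply, e1, neg_mul, norm_cpoint, ENNReal.toReal_ofReal e2, flatten,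
    LinearMap.coe_mk, AddHom.coe_mk, norm_mul, mul_pow, smul_eq_mul, norm_real,
    Real.norm_of_nonneg e5, e3]
  rw [e4]
  have : α ^ n / Real.pi ^ n ≠ 0 := by positivity
  field_simp

lemma FlatFock.continuous (α : ℝ) [Fact (0 < α)] {n m : ℕ} (g : FlatFock α n m) :
    Continuous g.1 := by
  obtain ⟨f, hf, h⟩ := g.2
  exact h ▸ continuous_flatten α hf.1.1.continuous

lemma FlatFock.memLp (α : ℝ) [Fact (0 < α)] {n m : ℕ} (g : FlatFock α n m) :
    MemLp g.1 2 (muTilde2 n) := by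
  obtain ⟨f, hf, h⟩ := g.2
  exact h ▸ memLp_flatten α hf

end Change

/-- The class in `L²(ℝ²ⁿ, (2π)^{-n} μ_{2n})` of an element of `H_m`. -/
def FlatFock.toLp (α : ℝ) [Fact (0 < α)] (n m : ℕ) :
    FlatFock α n m →ₗ[ℂ] Lp ℂ 2 (muTilde2 n) where
  toFun g := MemLp.toLp g.1 (FlatFock.memLp α g)
  map_add' _ _ := rfl
  map_smul' _ _ := rfl

lemma FlatFock.toLp_injective (α : ℝ) [Fact (0 < α)] (n m : ℕ) :
    Function.Injective (FlatFock.toLp α n m) := fun f g h =>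
  Subtype.ext ((Continuous.ae_eq_iff_eq (muTilde2 n) (FlatFock.continuous α f)
    (FlatFock.continuous α g)).1 
    ((MemLp.toLp_eq_toLp_iff (FlatFock.memLp α f) (FlatFock.memLp α g)).1 h))

/-- The norm of `H_m` is the norm of `L²(ℝ²ⁿ, (2π)^{-n} μ_{2n})`. -/
instance (α : ℝ) [Fact (0 < α)] (n m : ℕ) : NormedAddCommGroup (FlatFock α n m) :=
  NormedAddCommGroup.induced _ _ (FlatFock.toLp α n m) (FlatFock.toLp_injective α n m)

instance (α : ℝ) [Fact (0 < α)] (n m : ℕ) : InnerProductSpace ℂ (FlatFock α n m) :=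
  InnerProductSpace.induced (FlatFock.toLp α n m)

/-! ### The Fourier–Plancherel transform and its action in the first variable -/

/-- The dilation by `√(2π)` carries `μ_n` to `(2π)^{-n/2} μ_n`. -/
lemma measurePreserving_dilation (n : ℕ) :
    MeasurePreserving (fun x : E n => Real.sqrt (2 * Real.pi) • x) volume (muTilde n) := by
  have h : (0 : ℝ) < Real.sqrt (2 * Real.pi) := Real.sqrt_pos.2 (by positivity)
  refine ⟨by fun_prop, ?_⟩
  rw [Measure.map_addHaar_smul volume h.ne', muTilde]
  congr 2
  rw [finrank_euclideanSpace, Fintype.card_fin, abs_of_pos (by positivity), Real.sqrt_eq_rpow,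
    ← Real.rpow_natCast, ← Real.rpow_mul (by positivity), ← Real.rpow_neg (by positivity)]
  congr 1
  ring

lemma measurePreserving_dilation_symm (n : ℕ) :
    MeasurePreserving (fun x : E n => (Real.sqrt (2 * Real.pi))⁻¹ • x) (muTilde n) volume := by
  have h : (0 : ℝ) < Real.sqrt (2 * Real.pi) := Real.sqrt_pos.2 (by positivity)
  refine ⟨by fun_prop, ?_⟩
  rw [← (measurePreserving_dilation n).map_eq, Measure.map_map (by fun_prop) (by fun_prop)]
  convert Measure.map_id
  funext x
  simp only [Function.comp_apply, smul_smul, inv_mul_cancel₀ h.ne', one_smul, id]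

/-- The Fourier–Plancherel transform `F` on `L²(ℝⁿ, (2π)^{-n/2} μ_n)`, which on integrable
functions is `(F g)(ξ) = (2π)^{-n/2} ∫ g(u) exp(-i⟨u,ξ⟩) du`. Substituting `u = √(2π) s` and
`ξ = √(2π) w` gives `(F g)(√(2π) w) = ∫ g(√(2π) s) exp(-2πi⟨s,w⟩) ds`, so that `F` is Mathlib's
transform on `L²(ℝⁿ, μ_n)` conjugated by the dilation by `√(2π)`. -/
def fourierF (n : ℕ) : Lp ℂ 2 (muTilde n) →ₗ[ℂ] Lp ℂ 2 (muTilde n) :=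
  (Lp.compMeasurePreservingₗᵢ ℂ _ (measurePreserving_dilation_symm n)).toLinearMap ∘ₗ
    (Lp.fourierTransformₗᵢ (E n) ℂ).toLinearIsometry.toLinearMap ∘ₗ
      (Lp.compMeasurePreservingₗᵢ ℂ _ (measurePreserving_dilation n)).toLinearMap

lemma memLp_tensor {n : ℕ} {f h : E n → ℂ} (hf : MemLp f 2 (muTilde n))
    (hh : MemLp h 2 (muTilde n)) :
    MemLp (fun p : E n × E n => f p.1 * h p.2) 2 (muTilde2 n) := by
  have h1 := (memLp_two_iff_integrable_sq_norm hf.1).1 hf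
  have h2 := (memLp_two_iff_integrable_sq_norm hh.1).1 hh
  refine (memLp_two_iff_integrable_sq_norm (hf.1.comp_fst.mul hh.1.comp_snd)).2 ?_
  simpa only [Pi.mul_apply, norm_mul, mul_pow] using h1.mul_prod h2

/-- The inclusion of the algebraic tensor product `L²(ℝⁿ) ⊗ L²(ℝⁿ)` in `L²(ℝⁿ × ℝⁿ)`, which sends
`f ⊗ h` to the class of `(x, y) ↦ f(x) h(y)`. Its range is dense. -/
def tensorIncl (n : ℕ) :
    Lp ℂ 2 (muTilde n) ⊗[ℂ] Lp ℂ 2 (muTilde n) →ₗ[ℂ] Lp ℂ 2 (muTilde2 n) :=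
  TensorProduct.lift <| LinearMap.mk₂ ℂ
    (fun f h => MemLp.toLp _ (memLp_tensor (Lp.memLp f) (Lp.memLp h)))
    (fun f g h => by
      rw [← MemLp.toLp_add, MemLp.toLp_eq_toLp_iff]
      filter_upwards [Measure.quasiMeasurePreserving_fst.ae (Lp.coeFn_add f g)] with p hp
      simp only [hp, Pi.add_apply, add_mul])
    (fun c f h => by
      rw [← MemLp.toLp_const_smul, MemLp.toLp_eq_toLp_iff]
      filter_upwards [Measure.quasiMeasurePreserving_fst.ae (Lp.coeFn_smul c f)] with p hp
      simp [hp, mul_assoc])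
    (fun f g h => by
      rw [← MemLp.toLp_add, MemLp.toLp_eq_toLp_iff]
      filter_upwards [Measure.quasiMeasurePreserving_snd.ae (Lp.coeFn_add g h)] with p hp
      simp only [hp, Pi.add_apply, mul_add])
    (fun c f h => by
      rw [← MemLp.toLp_const_smul, MemLp.toLp_eq_toLp_iff]
      filter_upwards [Measure.quasiMeasurePreserving_snd.ae (Lp.coeFn_smul c h)] with p hp
      simp [hp, mul_left_comm])

/-- The horizontal Fourier transform `F ⊗ I` on `L²(ℝ²ⁿ, (2π)^{-n} μ_{2n})`: the continuous
extension of `f ⊗ h ↦ (F f) ⊗ h` from the algebraic tensor product. -/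
def fourierTensorId (n : ℕ) : Lp ℂ 2 (muTilde2 n) →L[ℂ] Lp ℂ 2 (muTilde2 n) :=
  (tensorIncl n ∘ₗ TensorProduct.map (fourierF n) LinearMap.id).extendOfNorm (tensorIncl n)

/-! ### Hermite functions and the operators `N`, `R` -/

/-- The physicists' Hermite polynomials: `H_0 = 1`, `H_{k+1} = 2 X H_k - H_k'`. -/
def hermitePoly : ℕ → Polynomial ℝ
  | 0 => 1
  | k + 1 => 2 * Polynomial.X * hermitePoly k - Polynomial.derivative (hermitePoly k)

/-- The Hermite functions `ψ_k(t) = (2^k k! √π)^{-1/2} exp(-t²/2) H_k(t)`. -/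
def hermiteFun (k : ℕ) (t : ℝ) : ℝ :=
  ((2 : ℝ) ^ k * (k.factorial : ℝ) * Real.sqrt Real.pi) ^ (-(1 / 2) : ℝ) *
    Real.exp (-(1 / 2) * t ^ 2) * (hermitePoly k).eval t

/-- The set `J_{n,m}` of multi-indices `k ∈ ℕ₀ⁿ` with `|k| ≤ m - 1`, as a set in the
lexicographically ordered type of multi-indices. -/
def J (n m : ℕ) : Finset (Lex (Fin n → ℕ)) :=
  ((Fintype.piFinset fun _ : Fin n => Finset.range m).filter fun k => ∑ r, k r < m).map
    (toLex : (Fin n → ℕ) ≃ Lex (Fin n → ℕ)).toEmbedding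

/-- The number `d` of elements of `J_{n,m}`. -/
def dim (n m : ℕ) : ℕ := (J n m).card

/-- The enumeration `φ` of `J_{n,m}` in the lexicographic order. -/
def phi (n m : ℕ) (j : Fin (dim n m)) : Fin n → ℕ := ofLex ((J n m).orderEmbOfFin rfl j)

/-- The product `∏_r ψ_{φ(j)_r}((ξ_r + 2 v_r)/√2)`. -/
def hermiteProd {n m : ℕ} (j : Fin (dim n m)) (ξ v : E n) : ℝ :=
  ∏ r, hermiteFun (phi n m j r) ((ξ r + 2 * v r) / Real.sqrt 2)

/-- The functions `q_{φ(j),ξ}(v) = 2^{n/2} π^{n/4} ∏_r ψ_{φ(j)_r}((ξ_r + 2 v_r)/√2)`. -/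
def q {n m : ℕ} (j : Fin (dim n m)) (ξ v : E n) : ℝ :=
  (2 : ℝ) ^ ((n : ℝ) / 2) * Real.pi ^ ((n : ℝ) / 4) * hermiteProd j ξ v

/-- `(N G)(ξ)_j = ⟨G(ξ,·), q_{φ(j),ξ}⟩` in `L²(ℝⁿ, (2π)^{-n/2} μ_n)`. -/
def N {n m : ℕ} (G : Lp ℂ 2 (muTilde2 n)) (ξ : E n) (j : Fin (dim n m)) : ℂ :=
  ∫ v, G (ξ, v) * (q j ξ v : ℂ) ∂(muTilde n)

/-- `R_{H_m} = N (F ⊗ I)`. -/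
def RFlat (α : ℝ) [Fact (0 < α)] {n m : ℕ} (g : FlatFock α n m) (ξ : E n)
    (j : Fin (dim n m)) : ℂ :=
  N (fourierTensorId n (FlatFock.toLp α n m g)) ξ j

/-- `R_{F_{α,m}} = R_{H_m} U`. -/
def RFock (α : ℝ) [Fact (0 < α)] {n m : ℕ} (f : Fock α n m) (ξ : E n)
    (j : Fin (dim n m)) : ℂ :=
  RFlat α (U α n m f) ξ j

/-- The Hilbert space `L²(ℝⁿ, (2π)^{-n/2} μ_n)^d`. -/
abbrev Target (n m : ℕ) : Type := PiLp 2 fun _ : Fin (dim n m) => Lp ℂ 2 (muTilde n)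

end PolyFock

end

/-!
The transform `F ⊗ I` is an isometry acting slice by slice, and for each fixed `ξ` the functions
`q_{k,ξ}`, `k ∈ ℕ₀ⁿ`, form a Hilbert basis of `L²(dv)`. Hence `L²(ℝ²ⁿ)` is the orthogonal sum of
the spaces of lifts `c(ξ) q_{k,ξ}(v)`, and the theorem says that `F ⊗ I` maps `H_m` onto the sum
of those with `|k| < m`; Parseval's identity then makes `N` an isometry there.

If `f` is `m`-analytic and `|k| ≥ m`, integrate `f` against the kernels
`(a z + s)^k exp (-a²|z|² - a ⟨s, z̄⟩)`, `a = √α`: each `∂/∂z̄_r` falling on the exponential factor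
raises the exponent `k_r` by one, so integration by parts moves `m` such derivatives onto `f` and
the integral vanishes. Up to the weight in `U`, these kernels are the inverse transforms of
`exp (-|ξ|²/4 + i⟨s, ξ⟩) q_{k,ξ}(v)`, whose first factors are total in `L²(dξ)` as `s` varies; so
the coefficients of `(F ⊗ I) U f` with `|k| ≥ m` are zero.

Conversely, for `|k| < m` the inverse transform of a lift is a Gaussian Fourier–Laplace integral,
which is `U` of a polynomial of degree `|k|` in `Im z` with entire coefficients, and such a function
is `m`-analytic.
-/

noncomputable section

namespace PolyFock

/-! ### The Fourier transform on `L¹ ∩ L²` -/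

section Fourier

open FourierTransform SchwartzMap

variable {V : Type*} [NormedAddCommGroup V] [InnerProductSpace ℝ V] [FiniteDimensional ℝ V]
  [MeasurableSpace V] [BorelSpace V]

lemma integral_schwartz_mul_fourier {f : V → ℂ} (hf : Integrable f) (φ : 𝓢(V, ℂ)) :
    ∫ x, 𝓕 φ x • f x = ∫ x, φ x • 𝓕 f x := by
  simpa using! VectorFourier.integral_fourierIntegral_smul_eq_flip (L := innerₗ V)
    Real.continuous_fourierChar continuous_inner φ.integrable hf

lemma integral_schwartz_mul_fourierInv {f : V → ℂ} (hf : Integrable f) (φ : 𝓢(V, ℂ)) :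
    ∫ x, 𝓕⁻ φ x • f x = ∫ x, φ x • 𝓕⁻ f x := by
  have fourier_flip := VectorFourier.integral_fourierIntegral_smul_eq_flip (L := -innerₗ V)
    (μ := volume) (ν := volume)
    Real.continuous_fourierChar continuous_inner.neg φ.integrable hf
  have flip_neg_innerₗ : (-innerₗ V).flip = -innerₗ V := by
    ext x y
    simp [real_inner_comm]
  rw [flip_neg_innerₗ] at fourier_flip
  rw [SchwartzMap.fourierInv_coe]
  exact fourier_flip

lemma ae_eq_of_integral_schwartz_eq {f g : V → ℂ} (hf : LocallyIntegrable f)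
    (hg : LocallyIntegrable g)
    (h : ∀ φ : 𝓢(V, ℂ), ∫ x, φ x • f x = ∫ x, φ x • g x) : f =ᵐ[volume] g := by
  refine ae_eq_of_integral_contDiff_smul_eq hf hg fun φ hφ hφc => ?_
  have hc : HasCompactSupport (fun x => (φ x : ℂ)) := hφc.comp_left (g := ((↑) : ℝ → ℂ)) (by simp)
  exact h (hc.toSchwartzMap (Complex.ofRealCLM.contDiff.comp hφ))

lemma ae_eq_zero_of_fourier_eq_zero {f : V → ℂ} (hf : Integrable f) (h : ∀ w, 𝓕 f w = 0) :
    f =ᵐ[volume] 0 := by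
  refine ae_eq_of_integral_schwartz_eq hf.locallyIntegrable
    (integrable_zero _ _ _).locallyIntegrable fun φ => ?_
  have integral_eq := integral_schwartz_mul_fourier hf (𝓕⁻ φ)
  rw [FourierTransform.fourier_fourierInv_eq] at integral_eq
  rw [integral_eq]
  simp [h]

lemma hasSum_integral_pow_mul_cexp {X : Type*} [MeasurableSpace X] {μ : Measure X} {t g : X → ℂ}
    (ht : AEStronglyMeasurable t μ) (hg : AEStronglyMeasurable g μ)
    (h : Integrable (fun x => Real.exp ‖t x‖ * ‖g x‖) μ) :
    HasSum (fun j : ℕ => ∫ x, t x ^ j / j.factorial * g x ∂μ) (∫ x, cexp (t x) * g x ∂μ) := by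
  have hexp (x : X) : HasSum (fun j : ℕ => ‖t x‖ ^ j / j.factorial * ‖g x‖)
      (Real.exp ‖t x‖ * ‖g x‖) := by
    rw [Real.exp_eq_exp_ℝ]
    exact (NormedSpace.expSeries_div_hasSum_exp ‖t x‖).mul_right _
  refine hasSum_integral_of_dominated_convergence
    (fun j x => ‖t x‖ ^ j / j.factorial * ‖g x‖) (fun j => ?_) (fun j => .of_forall fun x => ?_)
    (.of_forall fun x => (hexp x).summable) ?_ (.of_forall fun x => ?_)
  · simp only [div_eq_mul_inv]
    exact ((ht.pow j).mul_const _).mul hg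
  · rw [norm_mul, norm_div, norm_pow, Complex.norm_natCast]
  · simpa only [(hexp _).tsum_eq] using h
  · rw [Complex.exp_eq_exp_ℂ]
    exact (NormedSpace.expSeries_div_hasSum_exp (t x)).mul_right _

lemma ae_eq_zero_of_moments_eq_zero {g : V → ℂ}
    (hg : ∀ a : ℝ, Integrable fun v => (Real.exp (a * ‖v‖) : ℂ) * g v)
    (h : ∀ (w : V) (j : ℕ), ∫ v, (inner ℝ v w : ℂ) ^ j * g v = 0) : g =ᵐ[volume] 0 := by
  have hg0 : Integrable g := by simpa using hg 0
  refine ae_eq_zero_of_fourier_eq_zero hg0 fun w => ?_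
  have hdom : Integrable fun v : V =>
      Real.exp ‖((-2 * Real.pi * inner ℝ v w : ℝ) * I : ℂ)‖ * ‖g v‖ := by
    refine (hg (2 * Real.pi * ‖w‖)).norm.mono' (by fun_prop) (.of_forall fun v => ?_)
    rw [norm_mul (Real.exp _ : ℂ), norm_real, Real.norm_of_nonneg (Real.exp_pos _).le, norm_mul,
      norm_norm, Real.norm_of_nonneg (Real.exp_pos _).le, norm_mul, norm_I, mul_one, norm_real,
      norm_mul, norm_mul, norm_neg, Real.norm_of_nonneg zero_le_two,
      Real.norm_of_nonneg Real.pi_pos.le, mul_assoc (2 * Real.pi)]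
    gcongr
    exact (norm_inner_le_norm v w).trans_eq (mul_comm _ _)
  have hsum := hasSum_integral_pow_mul_cexp (by fun_prop) hg0.1 hdom
  have hterm (j : ℕ) : ∫ v, ((-2 * Real.pi * inner ℝ v w : ℝ) * I : ℂ) ^ j / j.factorial * g v
      = (-(2 * Real.pi) * I) ^ j / j.factorial * ∫ v, (inner ℝ v w : ℂ) ^ j * g v := by
    rw [← integral_const_mul]
    refine integral_congr_ae (.of_forall fun v => ?_)
    push_cast
    ring
  simp only [hterm, h, mul_zero] at hsum
  rw [Real.fourier_eq']
  exact hsum.unique hasSum_zero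

lemma fourier_toLp_ae_eq {f : V → ℂ} (hf : Integrable f) (hf2 : MemLp f 2) :
    (𝓕 (hf2.toLp f) : Lp ℂ 2 (volume : Measure V)) =ᵐ[volume] 𝓕 f := by
  refine ae_eq_of_integral_schwartz_eq ((Lp.memLp _).locallyIntegrable (by norm_num))
    (Continuous.locallyIntegrable ?_) fun φ => ?_
  · exact VectorFourier.fourierIntegral_continuous Real.continuous_fourierChar
      continuous_inner hf
  · rw [← integral_schwartz_mul_fourier hf, ← Lp.toTemperedDistribution_apply,
      ← Lp.fourier_toTemperedDistribution_eq, TemperedDistribution.fourier_apply,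
      Lp.toTemperedDistribution_apply]
    refine integral_congr_ae ?_
    filter_upwards [hf2.coeFn_toLp] with x hx
    rw [hx]

lemma fourierInv_toLp_ae_eq {f : V → ℂ} (hf : Integrable f) (hf2 : MemLp f 2) :
    (𝓕⁻ (hf2.toLp f) : Lp ℂ 2 (volume : Measure V)) =ᵐ[volume] 𝓕⁻ f := by
  refine ae_eq_of_integral_schwartz_eq ((Lp.memLp _).locallyIntegrable (by norm_num))
    (Continuous.locallyIntegrable ?_) fun φ => ?_
  · exact VectorFourier.fourierIntegral_continuous Real.continuous_fourierChar
      continuous_inner.neg hf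
  · rw [← integral_schwartz_mul_fourierInv hf, ← Lp.toTemperedDistribution_apply,
      ← Lp.fourierInv_toTemperedDistribution_eq, TemperedDistribution.fourierInv_apply,
      Lp.toTemperedDistribution_apply]
    refine integral_congr_ae ?_
    filter_upwards [hf2.coeFn_toLp] with x hx
    rw [hx]

end Fourier

/-! ### The normalized Lebesgue measure and the transform `F` -/

lemma sqrt_two_pi_pos : 0 < Real.sqrt (2 * Real.pi) := Real.sqrt_pos.2 (by positivity)

lemma ofReal_two_pi_rpow_ne_zero (s : ℝ) : ENNReal.ofReal ((2 * Real.pi) ^ s) ≠ 0 :=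
  (ENNReal.ofReal_pos.2 (by positivity)).ne'

lemma ae_muTilde_iff {n : ℕ} {p : E n → Prop} : (∀ᵐ x ∂(muTilde n), p x) ↔ ∀ᵐ x, p x := by
  rw [muTilde, Measure.ae_ennreal_smul_measure_iff (ofReal_two_pi_rpow_ne_zero _)]

lemma integral_muTilde {n : ℕ} (f : E n → ℂ) :
    ∫ x, f x ∂(muTilde n) = (((2 * Real.pi) ^ (-(n : ℝ) / 2) : ℝ) : ℂ) * ∫ x, f x := by
  rw [muTilde, integral_smul_measure, ENNReal.toReal_ofReal (by positivity), real_smul]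

lemma integrable_muTilde_iff {n : ℕ} {f : E n → ℂ} :
    Integrable f (muTilde n) ↔ Integrable f := by
  rw [muTilde, integrable_smul_measure (ofReal_two_pi_rpow_ne_zero _) ENNReal.ofReal_ne_top]

/-- Composition with a measure preserving map with measure preserving inverse, as an isometric
isomorphism of `L²` spaces. -/
def compMeasurePreservingEquiv {X Y : Type*} [MeasurableSpace X] [MeasurableSpace Y]
    {μ : Measure X} {ν : Measure Y} {f : X → Y} {g : Y → X} (hf : MeasurePreserving f μ ν)
    (hg : MeasurePreserving g ν μ) (hgf : g ∘ f = id) (hfg : f ∘ g = id) :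
    Lp ℂ 2 ν ≃ₗᵢ[ℂ] Lp ℂ 2 μ where
  toLinearEquiv := LinearEquiv.ofLinearMap
    (Lp.compMeasurePreservingₗᵢ ℂ f hf).toLinearMap (Lp.compMeasurePreservingₗᵢ ℂ g hg).toLinearMap
    (LinearMap.ext fun φ => (Lp.compMeasurePreserving_comp_apply φ hg hf).symm.trans (by
      simp only [hgf, Lp.compMeasurePreserving_id_apply, LinearMap.id_apply]))
    (LinearMap.ext fun φ => (Lp.compMeasurePreserving_comp_apply φ hf hg).symm.trans (by
      simp only [hfg, Lp.compMeasurePreserving_id_apply, LinearMap.id_apply]))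
  norm_map' φ := (Lp.compMeasurePreservingₗᵢ ℂ f hf).norm_map φ

/-- Composition with the dilation by `√(2π)`, which conjugates `F` to Mathlib's Fourier transform,
as an isometric isomorphism. -/
def dilationEquiv (n : ℕ) : Lp ℂ 2 (muTilde n) ≃ₗᵢ[ℂ] Lp ℂ 2 (volume : Measure (E n)) :=
  compMeasurePreservingEquiv (measurePreserving_dilation n) (measurePreserving_dilation_symm n)
    (funext fun x => by
      simp only [Function.comp_apply, smul_smul, inv_mul_cancel₀ sqrt_two_pi_pos.ne', one_smul, id])
    (funext fun x => by
      simp only [Function.comp_apply, smul_smul, mul_inv_cancel₀ sqrt_two_pi_pos.ne', one_smul, id])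

/-- The transform `F` as an isometric automorphism of `L²(ℝⁿ, (2π)^{-n/2} μ_n)`. -/
def fourierFEquiv (n : ℕ) : Lp ℂ 2 (muTilde n) ≃ₗᵢ[ℂ] Lp ℂ 2 (muTilde n) :=
  (dilationEquiv n).trans ((Lp.fourierTransformₗᵢ (E n) ℂ).trans (dilationEquiv n).symm)

lemma fourierFEquiv_apply {n : ℕ} (f : Lp ℂ 2 (muTilde n)) : fourierFEquiv n f = fourierF n f :=
  rfl

lemma dilationEquiv_symm_ae_eq {n : ℕ} {f : Lp ℂ 2 (volume : Measure (E n))} {g : E n → ℂ}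
    (h : f =ᵐ[volume] g) :
    (dilationEquiv n).symm f =ᵐ[muTilde n] fun ξ => g ((Real.sqrt (2 * Real.pi))⁻¹ • ξ) :=
  (Lp.coeFn_compMeasurePreserving f (measurePreserving_dilation_symm n)).trans
    ((measurePreserving_dilation_symm n).quasiMeasurePreserving.ae_eq_comp h)

lemma integral_dilation {n : ℕ} (f : E n → ℂ) :
    ∫ s : E n, f (Real.sqrt (2 * Real.pi) • s) = ∫ u, f u ∂(muTilde n) :=
  (measurePreserving_dilation n).integral_comp
    (Homeomorph.smulOfNeZero _ sqrt_two_pi_pos.ne').measurableEmbedding f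

lemma integrable_dilation {n : ℕ} {f : E n → ℂ} (hf : Integrable f (muTilde n)) :
    Integrable (fun s : E n => f (Real.sqrt (2 * Real.pi) • s)) :=
  (measurePreserving_dilation n).integrable_comp_of_integrable hf

lemma two_pi_mul_inner_dilation {n : ℕ} (s ξ : E n) :
    2 * Real.pi * inner ℝ s ((Real.sqrt (2 * Real.pi))⁻¹ • ξ) =
      inner ℝ (Real.sqrt (2 * Real.pi) • s) ξ := by
  rw [inner_smul_left, inner_smul_right, ← mul_assoc]
  congr 1
  rw [conj_trivial, ← div_eq_mul_inv, Real.div_sqrt]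

lemma fourierF_toLp_ae_eq {n : ℕ} {f : E n → ℂ} (hf : Integrable f (muTilde n))
    (hf2 : MemLp f 2 (muTilde n)) :
    fourierF n (hf2.toLp f) =ᵐ[muTilde n]
      fun ξ => ∫ u, f u * cexp (-I * (inner ℝ u ξ : ℝ)) ∂(muTilde n) := by
  have fourier_dilation := fourier_toLp_ae_eq (integrable_dilation hf)
    (hf2.comp_measurePreserving (measurePreserving_dilation n))
  refine (dilationEquiv_symm_ae_eq fourier_dilation).trans (.of_forall fun ξ => ?_)
  simp only [Real.fourier_eq', ← integral_dilation]
  refine integral_congr_ae (.of_forall fun s => ?_)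
  simp only [smul_eq_mul]
  rw [mul_comm, neg_mul, neg_mul, two_pi_mul_inner_dilation]
  push_cast
  ring_nf

lemma fourierFEquiv_symm_toLp_ae_eq {n : ℕ} {f : E n → ℂ} (hf : Integrable f (muTilde n))
    (hf2 : MemLp f 2 (muTilde n)) :
    (fourierFEquiv n).symm (hf2.toLp f) =ᵐ[muTilde n]
      fun ξ => ∫ u, f u * cexp (I * (inner ℝ u ξ : ℝ)) ∂(muTilde n) := by
  have fourierInv_dilation := fourierInv_toLp_ae_eq (integrable_dilation hf)
    (hf2.comp_measurePreserving (measurePreserving_dilation n))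
  refine (dilationEquiv_symm_ae_eq fourierInv_dilation).trans (.of_forall fun ξ => ?_)
  simp only [Real.fourierInv_eq', ← integral_dilation]
  refine integral_congr_ae (.of_forall fun s => ?_)
  simp only [smul_eq_mul]
  rw [mul_comm, two_pi_mul_inner_dilation]
  ring_nf

lemma ae_eq_zero_of_integral_exp_eq_zero {n : ℕ} {f : E n → ℂ} (hf : Integrable f (muTilde n))
    (h : ∀ s : E n, ∫ u, f u * cexp (-I * (inner ℝ u s : ℝ)) ∂(muTilde n) = 0) :
    f =ᵐ[muTilde n] 0 := by
  refine ae_muTilde_iff.2 (ae_eq_zero_of_fourier_eq_zero (integrable_muTilde_iff.1 hf) fun w => ?_)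
  have integral_eq_zero := h ((2 * Real.pi) • w)
  rw [integral_muTilde, mul_eq_zero] at integral_eq_zero
  have const_ne_zero : (((2 * Real.pi) ^ (-(n : ℝ) / 2) : ℝ) : ℂ) ≠ 0 := by
    rw [Ne, ofReal_eq_zero]
    positivity
  rw [Real.fourier_eq', ← integral_eq_zero.resolve_left const_ne_zero]
  refine integral_congr_ae (.of_forall fun s => ?_)
  simp only [smul_eq_mul, inner_smul_right]
  rw [mul_comm]
  congr 2
  push_cast
  ring

/-! ### Continuous functions of exponential growth -/

/-- Continuous functions bounded by `C exp(a ‖v‖)`. -/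
def HasExpGrowth {V : Type*} [NormedAddCommGroup V] (f : V → ℂ) : Prop :=
  Continuous f ∧ ∃ C a : ℝ, 0 ≤ C ∧ 0 ≤ a ∧ ∀ v, ‖f v‖ ≤ C * Real.exp (a * ‖v‖)

namespace HasExpGrowth

section Basic

variable {V : Type*} [NormedAddCommGroup V] {f g : V → ℂ}

lemma const (c : ℂ) : HasExpGrowth fun _ : V => c :=
  ⟨continuous_const, ‖c‖, 0, norm_nonneg c, le_rfl, fun v => by simp⟩

lemma mul (hf : HasExpGrowth f) (hg : HasExpGrowth g) : HasExpGrowth fun v => f v * g v := by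
  obtain ⟨hf, C, a, hC, ha, h⟩ := hf
  obtain ⟨hg, D, b, hD, hb, h'⟩ := hg
  refine ⟨hf.mul hg, C * D, a + b, by positivity, by positivity, fun v => ?_⟩
  rw [norm_mul, add_mul, Real.exp_add, mul_mul_mul_comm]
  exact mul_le_mul (h v) (h' v) (norm_nonneg _) (by positivity)

lemma add (hf : HasExpGrowth f) (hg : HasExpGrowth g) : HasExpGrowth fun v => f v + g v := by
  obtain ⟨hf, C, a, hC, ha, h⟩ := hf
  obtain ⟨hg, D, b, hD, hb, h'⟩ := hg
  refine ⟨hf.add hg, C + D, a + b, by positivity, by positivity, fun v => ?_⟩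
  have exp_le_left : Real.exp (a * ‖v‖) ≤ Real.exp ((a + b) * ‖v‖) :=
    Real.exp_le_exp.2 (mul_le_mul_of_nonneg_right (by linarith) (norm_nonneg v))
  have exp_le_right : Real.exp (b * ‖v‖) ≤ Real.exp ((a + b) * ‖v‖) :=
    Real.exp_le_exp.2 (mul_le_mul_of_nonneg_right (by linarith) (norm_nonneg v))
  calc ‖f v + g v‖ ≤ ‖f v‖ + ‖g v‖ := norm_add_le _ _
    _ ≤ C * Real.exp (a * ‖v‖) + D * Real.exp (b * ‖v‖) := add_le_add (h v) (h' v)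
    _ ≤ (C + D) * Real.exp ((a + b) * ‖v‖) := by
      rw [add_mul]
      gcongr

lemma prod {ι : Type*} (s : Finset ι) {f : ι → V → ℂ} (h : ∀ i, HasExpGrowth (f i)) :
    HasExpGrowth fun v => ∏ i ∈ s, f i v := by
  classical
  induction s using Finset.induction_on with
  | empty => simpa using const 1
  | insert i s hi ih => simpa only [Finset.prod_insert hi] using (h i).mul ih

lemma sum {ι : Type*} (s : Finset ι) {f : ι → V → ℂ} (h : ∀ i, HasExpGrowth (f i)) :
    HasExpGrowth fun v => ∑ i ∈ s, f i v := by
  classical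
  induction s using Finset.induction_on with
  | empty => simpa using const 0
  | insert i s hi ih => simpa only [Finset.sum_insert hi] using (h i).add ih

lemma pow (hf : HasExpGrowth f) (k : ℕ) : HasExpGrowth fun v => f v ^ k := by
  simpa using prod (Finset.range k) fun _ => hf

lemma eval {t : V → ℝ} (ht : HasExpGrowth fun v => (t v : ℂ)) (p : Polynomial ℝ) :
    HasExpGrowth fun v => ((p.eval (t v) : ℝ) : ℂ) := by
  simp only [Polynomial.eval_eq_sum_range, ofReal_sum, ofReal_mul, ofReal_pow]
  exact sum _ fun i => (const _).mul (ht.pow i)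

lemma exp_norm (a : ℝ) : HasExpGrowth fun v : V => (Real.exp (a * ‖v‖) : ℂ) := by
  refine ⟨by fun_prop, 1, |a|, zero_le_one, abs_nonneg a, fun v => ?_⟩
  rw [norm_real, Real.norm_of_nonneg (Real.exp_pos _).le, one_mul, Real.exp_le_exp]
  exact mul_le_mul_of_nonneg_right (le_abs_self a) (norm_nonneg v)

lemma exists_norm_mul_gaussian_le (hf : HasExpGrowth f) {b : ℝ} (hb : 0 < b) :
    ∃ C, 0 ≤ C ∧ ∀ v, ‖f v * (Real.exp (-b * ‖v‖ ^ 2) : ℂ)‖ ≤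
      C * Real.exp (-(b / 2) * ‖v‖ ^ 2) := by
  obtain ⟨-, C, a, hC, -, norm_f_le⟩ := hf
  refine ⟨C * Real.exp (a ^ 2 / (2 * b)), by positivity, fun v => ?_⟩
  have complete_square : a ^ 2 / (2 * b) + -(b / 2) * ‖v‖ ^ 2 =
      a * ‖v‖ + -b * ‖v‖ ^ 2 + (a - b * ‖v‖) ^ 2 / (2 * b) := by
    field_simp
    ring
  have exponent_le : a * ‖v‖ + -b * ‖v‖ ^ 2 ≤ a ^ 2 / (2 * b) + -(b / 2) * ‖v‖ ^ 2 := by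
    rw [complete_square]
    exact le_add_of_nonneg_right (by positivity)
  rw [norm_mul, norm_real, Real.norm_of_nonneg (Real.exp_pos _).le]
  calc ‖f v‖ * Real.exp (-b * ‖v‖ ^ 2)
      ≤ C * Real.exp (a * ‖v‖) * Real.exp (-b * ‖v‖ ^ 2) := by gcongr; exact norm_f_le v
    _ = C * Real.exp (a * ‖v‖ + -b * ‖v‖ ^ 2) := by rw [mul_assoc, ← Real.exp_add]
    _ ≤ C * Real.exp (a ^ 2 / (2 * b) + -(b / 2) * ‖v‖ ^ 2) := by gcongr
    _ = C * Real.exp (a ^ 2 / (2 * b)) * Real.exp (-(b / 2) * ‖v‖ ^ 2) := by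
      rw [Real.exp_add, mul_assoc]

variable [NormedSpace ℝ V]

lemma of_clm (L : V →L[ℝ] ℂ) : HasExpGrowth fun v => L v := by
  refine ⟨L.continuous, ‖L‖, 1, norm_nonneg _, zero_le_one, fun v => (L.le_opNorm v).trans ?_⟩
  refine mul_le_mul_of_nonneg_left ?_ (norm_nonneg _)
  linarith [Real.add_one_le_exp (1 * ‖v‖)]

lemma of_clm_real (L : V →L[ℝ] ℝ) : HasExpGrowth fun v => (L v : ℂ) := of_clm (ofRealCLM.comp L)

lemma cexp_clm (L : V →L[ℝ] ℂ) : HasExpGrowth fun v => cexp (L v) := by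
  refine ⟨continuous_exp.comp L.continuous, 1, ‖L‖, zero_le_one, norm_nonneg _, fun v => ?_⟩
  rw [norm_exp, one_mul, Real.exp_le_exp]
  exact (re_le_norm _).trans (L.le_opNorm v)

end Basic

variable {V : Type*} [NormedAddCommGroup V] [InnerProductSpace ℝ V] [FiniteDimensional ℝ V]
  [MeasurableSpace V] [BorelSpace V] {f : V → ℂ}

lemma integrable_gaussian (hf : HasExpGrowth f) {b : ℝ} (hb : 0 < b) :
    Integrable fun v => f v * (Real.exp (-b * ‖v‖ ^ 2) : ℂ) := by
  obtain ⟨C, -, norm_le⟩ := hf.exists_norm_mul_gaussian_le hb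
  have continuous_f := hf.1
  have integrable_majorant := (GaussianFourier.integrable_cexp_neg_mul_sq_norm_add
    (b := (b / 2 : ℝ)) (by simpa only [ofReal_re] using half_pos hb) 0 (0 : V)).norm.const_mul C
  refine integrable_majorant.mono' (by fun_prop) (.of_forall fun v => (norm_le v).trans_eq ?_)
  rw [norm_exp, zero_mul, add_zero, ← ofReal_pow, ← ofReal_neg, ← ofReal_mul, ofReal_re]

lemma memLp_gaussian (hf : HasExpGrowth f) {b : ℝ} (hb : 0 < b) :
    MemLp (fun v => f v * (Real.exp (-b * ‖v‖ ^ 2) : ℂ)) 2 := by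
  have continuous_f := hf.1
  rw [memLp_two_iff_integrable_sq_norm (by fun_prop)]
  refine ((hf.mul hf).integrable_gaussian (b := 2 * b) (by positivity)).norm.congr
    (.of_forall fun v => ?_)
  have exp_two_mul : Real.exp (-(2 * b) * ‖v‖ ^ 2) = Real.exp (-b * ‖v‖ ^ 2) ^ 2 := by
    rw [← Real.exp_nat_mul]
    congr 1
    push_cast
    ring
  simp only [norm_mul, norm_real, Real.norm_of_nonneg (Real.exp_pos _).le]
  rw [exp_two_mul]
  ring

end HasExpGrowth

/-! ### Hermite polynomials and Hermite functions -/

section Hermite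

open Polynomial

lemma hermitePoly_succ (k : ℕ) :
    hermitePoly (k + 1) = 2 * X * hermitePoly k - derivative (hermitePoly k) := rfl

lemma derivative_hermitePoly_succ (k : ℕ) :
    derivative (hermitePoly (k + 1)) = 2 * ((k : ℝ[X]) + 1) * hermitePoly k := by
  induction k with
  | zero => simp [hermitePoly]
  | succ k ih =>
    have hk : derivative ((k : ℝ[X]) + 1) = 0 := by simp
    rw [hermitePoly_succ (k + 1), derivative_sub, derivative_mul, derivative_mul, ih,
      derivative_mul, derivative_mul]
    simp only [derivative_ofNat, hk, derivative_X, hermitePoly_succ k]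
    push_cast
    ring

lemma degree_hermitePoly (k : ℕ) : (hermitePoly k).degree = k := by
  induction k with
  | zero => simp [hermitePoly]
  | succ k ih =>
    have degree_leading : (2 * X * hermitePoly k).degree = ((k + 1 : ℕ) : WithBot ℕ) := by
      rw [degree_mul, degree_mul, show (2 : ℝ[X]) = C 2 from rfl, degree_C two_ne_zero, degree_X,
        ih, zero_add, Nat.cast_add, Nat.cast_one, add_comm]
    have hlt : (derivative (hermitePoly k)).degree < (2 * X * hermitePoly k).degree := by
      rw [degree_leading]
      refine (degree_derivative_le).trans_lt ?_
      rw [ih]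
      exact_mod_cast Nat.lt_succ_self k
    rw [hermitePoly_succ, degree_sub_eq_left_of_degree_lt hlt, degree_leading]

lemma span_hermitePoly : Submodule.span ℝ (Set.range hermitePoly) = ⊤ :=
  let S : Polynomial.Sequence ℝ := ⟨hermitePoly, degree_hermitePoly⟩
  S.span fun k => (leadingCoeff_ne_zero.2 (S.ne_zero k)).isUnit

lemma integrable_eval_mul_gaussian (p : ℝ[X]) :
    Integrable fun t : ℝ => p.eval t * Real.exp (-t ^ 2) := by
  have integrable_ofReal :=
    ((HasExpGrowth.of_clm_real (.id ℝ ℝ)).eval p).integrable_gaussian one_pos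
  refine integrable_ofReal.re.congr (.of_forall fun t => ?_)
  simp only [ContinuousLinearMap.id_apply, ← ofReal_mul, Real.norm_eq_abs, sq_abs, neg_mul, one_mul]
  exact ofReal_re _

lemma integral_hermitePoly_succ_mul (k : ℕ) (p : ℝ[X]) :
    ∫ t, (hermitePoly (k + 1) * p).eval t * Real.exp (-t ^ 2) =
      ∫ t, (hermitePoly k * derivative p).eval t * Real.exp (-t ^ 2) := by
  have hd : ∀ t : ℝ, HasDerivAt (fun t => (hermitePoly k * p).eval t * Real.exp (-t ^ 2))
      ((hermitePoly k * derivative p).eval t * Real.exp (-t ^ 2) -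
        (hermitePoly (k + 1) * p).eval t * Real.exp (-t ^ 2)) t := by
    intro t
    have hasDerivAt_poly := (hermitePoly k * p).hasDerivAt t
    have hasDerivAt_gaussian : HasDerivAt (fun t : ℝ => Real.exp (-t ^ 2))
        (Real.exp (-t ^ 2) * (-(2 * t))) t := by
      simpa using ((hasDerivAt_pow 2 t).neg).exp
    refine (hasDerivAt_poly.mul hasDerivAt_gaussian).congr_deriv ?_
    simp only [hermitePoly_succ, derivative_mul, eval_add,
      eval_mul, eval_sub, eval_X, eval_ofNat]
    ring
  have integral_sub_eq_zero := integral_eq_zero_of_hasDerivAt_of_integrable hd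
    ((integrable_eval_mul_gaussian _).sub (integrable_eval_mul_gaussian _))
    (integrable_eval_mul_gaussian _)
  rw [integral_sub (integrable_eval_mul_gaussian _) (integrable_eval_mul_gaussian _)]
    at integral_sub_eq_zero
  linarith

lemma integral_hermitePoly_mul (k l : ℕ) :
    ∫ t, (hermitePoly k * hermitePoly l).eval t * Real.exp (-t ^ 2) =
      if k = l then 2 ^ k * (k.factorial : ℝ) * Real.sqrt Real.pi else 0 := by
  induction k generalizing l with
  | zero =>
    cases l with
    | zero => simpa [hermitePoly] using integral_gaussian 1
    | succ l =>
      rw [mul_comm, integral_hermitePoly_succ_mul]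
      simp [hermitePoly]
  | succ k ih =>
    rw [integral_hermitePoly_succ_mul]
    cases l with
    | zero => simp [hermitePoly]
    | succ l =>
      have eval_derivative_mul : ∀ t : ℝ,
          (hermitePoly k * derivative (hermitePoly (l + 1))).eval t * Real.exp (-t ^ 2) =
            (2 * ((l : ℝ) + 1)) * ((hermitePoly k * hermitePoly l).eval t * Real.exp (-t ^ 2)) := by
        intro t
        rw [derivative_hermitePoly_succ]
        simp only [eval_mul, eval_ofNat, eval_add, eval_natCast, eval_one]
        ring
      simp only [eval_derivative_mul, integral_const_mul, ih, add_left_inj]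
      split_ifs with hkl
      · subst hkl
        rw [Nat.factorial_succ]
        push_cast
        ring
      · simp

lemma hermiteFun_mul (k l : ℕ) (t : ℝ) : hermiteFun k t * hermiteFun l t =
    ((2 : ℝ) ^ k * (k.factorial : ℝ) * Real.sqrt Real.pi) ^ (-(1 / 2) : ℝ) *
      ((2 : ℝ) ^ l * (l.factorial : ℝ) * Real.sqrt Real.pi) ^ (-(1 / 2) : ℝ) *
      ((hermitePoly k * hermitePoly l).eval t * Real.exp (-t ^ 2)) := by
  have gaussian_eq_mul :
      Real.exp (-t ^ 2) = Real.exp (-(1 / 2) * t ^ 2) * Real.exp (-(1 / 2) * t ^ 2) := by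
    rw [← Real.exp_add]
    ring_nf
  rw [hermiteFun, hermiteFun, gaussian_eq_mul, eval_mul]
  ring

lemma integral_hermiteFun_mul (k l : ℕ) :
    ∫ t, hermiteFun k t * hermiteFun l t = if k = l then 1 else 0 := by
  simp only [hermiteFun_mul, integral_const_mul, integral_hermitePoly_mul]
  split_ifs with h
  · subst h
    have hp : 0 < (2 : ℝ) ^ k * (k.factorial : ℝ) * Real.sqrt Real.pi := by
      positivity
    rw [← Real.rpow_add hp]
    norm_num
    rw [Real.rpow_neg_one, inv_mul_cancel₀ hp.ne']
  · simp

end Hermite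

/-! ### Hermite functions of several variables -/

section MultiHermite

variable {n : ℕ}

lemma integral_prod_coord {𝕜 : Type*} [RCLike 𝕜] (f : Fin n → ℝ → 𝕜) :
    ∫ x : E n, ∏ r, f r (x r) = ∏ r, ∫ t, f r t := by
  rw [← integral_fintype_prod_volume_eq_prod]
  exact (EuclideanSpace.volume_preserving_symm_measurableEquiv_toLp (Fin n)).integral_comp
    (MeasurableEquiv.measurableEmbedding _) (fun x : Fin n → ℝ => ∏ r, f r (x r))

/-- The Hermite function `∏_r ψ_{k_r}(x_r)` of `n` variables and multi-index `k`. -/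
def multiHermite (k : Fin n → ℕ) (x : E n) : ℝ := ∏ r, hermiteFun (k r) (x r)

/-- The normalizing constant `∏_r (2^{k_r} k_r! √π)^{-1/2}` of the Hermite functions. -/
def hermiteNorm (k : Fin n → ℕ) : ℝ :=
  ∏ r, ((2 : ℝ) ^ k r * ((k r).factorial : ℝ) * Real.sqrt Real.pi) ^ (-(1 / 2) : ℝ)

lemma hermiteNorm_ne_zero (k : Fin n → ℕ) : hermiteNorm k ≠ 0 :=
  Finset.prod_ne_zero_iff.2 fun _ _ => by positivity

lemma multiHermite_eq (k : Fin n → ℕ) (x : E n) :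
    multiHermite k x = hermiteNorm k * (∏ r, (hermitePoly (k r)).eval (x r)) *
      Real.exp (-(1 / 2) * ‖x‖ ^ 2) := by
  simp only [multiHermite, hermiteFun, hermiteNorm, Finset.prod_mul_distrib, Finset.mul_sum,
    Real.exp_sum, EuclideanSpace.real_norm_sq_eq]
  ring

@[fun_prop]
lemma continuous_multiHermite (k : Fin n → ℕ) : Continuous (multiHermite k) := by
  rw [funext (multiHermite_eq k)]
  fun_prop

lemma hasExpGrowth_prod_eval (p : Fin n → Polynomial ℝ) :
    HasExpGrowth fun x : E n => ∏ r, (((p r).eval (x r) : ℝ) : ℂ) :=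
  .prod _ fun r => (HasExpGrowth.of_clm_real (EuclideanSpace.proj r : E n →L[ℝ] ℝ)).eval (p r)

lemma memLp_multiHermite (k : Fin n → ℕ) : MemLp (fun x => (multiHermite k x : ℂ)) 2 := by
  simp only [multiHermite_eq, ofReal_mul, ofReal_prod]
  exact ((HasExpGrowth.const _).mul (hasExpGrowth_prod_eval _)).memLp_gaussian one_half_pos

lemma integral_multiHermite_mul (k l : Fin n → ℕ) :
    ∫ x, multiHermite k x * multiHermite l x = if k = l then 1 else 0 := by
  simp only [multiHermite, ← Finset.prod_mul_distrib]
  rw [integral_prod_coord fun r t => hermiteFun (k r) t * hermiteFun (l r) t]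
  simp only [integral_hermiteFun_mul, Finset.prod_ite_zero, Finset.prod_const_one, funext_iff,
    Finset.mem_univ, true_imp_iff]

lemma integral_mul_prod_eval_mul_gaussian_eq_zero {φ : E n → ℂ} (hφ : MemLp φ 2)
    (h : ∀ k : Fin n → ℕ, ∫ x, φ x * (multiHermite k x : ℂ) = 0) (p : Fin n → Polynomial ℝ) :
    ∫ x, φ x * ((∏ r, (((p r).eval (x r) : ℝ) : ℂ)) *
      (Real.exp (-(1 / 2) * ‖x‖ ^ 2) : ℂ)) = 0 := by
  have hspan (r : Fin n) : ∃ c : ℕ →₀ ℝ, (c.sum fun i b => b • hermitePoly i) = p r :=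
    Finsupp.mem_span_range_iff_exists_finsupp.1 (span_hermitePoly ▸ Submodule.mem_top)
  choose c hc using hspan
  have heval (x : E n) (r : Fin n) : (((p r).eval (x r) : ℝ) : ℂ) =
      ∑ i ∈ (c r).support, (c r i : ℂ) * (((hermitePoly i).eval (x r) : ℝ) : ℂ) := by
    rw [← hc r, Finsupp.sum, Polynomial.eval_finsetSum]
    simp only [Polynomial.eval_smul, smul_eq_mul, ofReal_sum, ofReal_mul]
  have hexpand (x : E n) :
      φ x * ((∏ r, (((p r).eval (x r) : ℝ) : ℂ)) * (Real.exp (-(1 / 2) * ‖x‖ ^ 2) : ℂ)) =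
      ∑ k ∈ Fintype.piFinset fun r => (c r).support,
        ((∏ r, (c r (k r) : ℂ)) * (hermiteNorm k : ℂ)⁻¹) * (φ x * (multiHermite k x : ℂ)) := by
    simp only [heval]
    rw [Finset.prod_univ_sum, Finset.sum_mul, Finset.mul_sum]
    refine Finset.sum_congr rfl fun k _ => ?_
    have hk : (hermiteNorm k : ℂ) ≠ 0 := ofReal_ne_zero.2 (hermiteNorm_ne_zero k)
    rw [multiHermite_eq, Finset.prod_mul_distrib]
    push_cast
    field_simp
  simp only [hexpand]
  rw [integral_finsetSum]
  · simp only [integral_const_mul, h, mul_zero, Finset.sum_const_zero]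
  · intro k _
    exact (hφ.integrable_mul (memLp_multiHermite k)).const_mul _

/-- Finite linear combinations of the Hermite functions are the polynomials times the Gaussian
`exp(-|x|²/2)`, so all moments of `φ(x) exp(-|x|²/2)` vanish. -/
lemma ae_eq_zero_of_integral_multiHermite_eq_zero {φ : E n → ℂ} (hφ : MemLp φ 2)
    (h : ∀ k : Fin n → ℕ, ∫ x, φ x * (multiHermite k x : ℂ) = 0) : φ =ᵐ[volume] 0 := by
  suffices hg : (fun x : E n => φ x * (Real.exp (-(1 / 2) * ‖x‖ ^ 2) : ℂ)) =ᵐ[volume] 0 by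
    filter_upwards [hg] with x hx
    exact (mul_eq_zero.1 hx).resolve_right (ofReal_ne_zero.2 (Real.exp_pos _).ne')
  refine ae_eq_zero_of_moments_eq_zero (fun a => ?_) fun w j => ?_
  · refine (hφ.integrable_mul ((HasExpGrowth.exp_norm a).memLp_gaussian one_half_pos)).congr
      (.of_forall fun x => ?_)
    simp only [Pi.mul_apply]
    ring
  · have hmoment (x : E n) :
        (inner ℝ x w : ℂ) ^ j * (φ x * (Real.exp (-(1 / 2) * ‖x‖ ^ 2) : ℂ)) =
        ∑ a ∈ Finset.univ.piAntidiag j, ((Nat.multinomial Finset.univ a : ℂ) *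
          ∏ r, (w r : ℂ) ^ a r) * (φ x * ((∏ r, (((Polynomial.X ^ a r).eval (x r) : ℝ) : ℂ)) *
            (Real.exp (-(1 / 2) * ‖x‖ ^ 2) : ℂ))) := by
      rw [PiLp.inner_apply]
      push_cast
      simp only [RCLike.inner_apply, conj_trivial, ofReal_mul, Finset.sum_pow_eq_sum_piAntidiag,
        Finset.sum_mul, Polynomial.eval_pow, Polynomial.eval_X, ofReal_pow, mul_pow,
        Finset.prod_mul_distrib]
      exact Finset.sum_congr rfl fun a _ => by ring
    simp only [hmoment]
    rw [integral_finsetSum]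
    · simp only [integral_const_mul, integral_mul_prod_eval_mul_gaussian_eq_zero hφ h, mul_zero,
        Finset.sum_const_zero]
    · intro a _
      exact (hφ.integrable_mul
        ((hasExpGrowth_prod_eval _).memLp_gaussian one_half_pos)).const_mul _

end MultiHermite

/-! ### The functions `q_{k,ξ}` -/

section HermiteKernel

variable {n : ℕ}

lemma memLp_muTilde_iff {f : E n → ℂ} {p : ENNReal} : MemLp f p (muTilde n) ↔ MemLp f p := by
  have hpos : 0 < (2 * Real.pi) ^ (-(n : ℝ) / 2) := by positivity
  refine ⟨fun h => ?_, fun h => h.smul_measure ENNReal.ofReal_ne_top⟩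
  have hc := h.smul_measure (c := (ENNReal.ofReal ((2 * Real.pi) ^ (-(n : ℝ) / 2)))⁻¹)
    (ENNReal.inv_ne_top.2 (ENNReal.ofReal_pos.2 hpos).ne')
  rwa [muTilde, smul_smul, ENNReal.inv_mul_cancel (ENNReal.ofReal_pos.2 hpos).ne'
    ENNReal.ofReal_ne_top, one_smul] at hc

lemma map_const_add_smul (a : E n) {c : ℝ} (hc : c ≠ 0) :
    (volume : Measure (E n)).map (fun v => a + c • v) = ENNReal.ofReal |(c ^ n)⁻¹| • volume := by
  rw [← Function.comp_def (a + ·) (c • ·), ← Measure.map_map (by fun_prop) (by fun_prop),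
    Measure.map_addHaar_smul _ hc, Measure.map_smul, map_add_left_eq_self,
    finrank_euclideanSpace, Fintype.card_fin]

lemma memLp_comp_const_add_smul {f : E n → ℂ} (hf : MemLp f 2) (a : E n) {c : ℝ} (hc : c ≠ 0) :
    MemLp (fun v => f (a + c • v)) 2 := by
  refine MemLp.comp_of_map (f := fun v : E n => a + c • v) ?_ (by fun_prop)
  rw [map_const_add_smul a hc]
  exact hf.smul_measure ENNReal.ofReal_ne_top

/-- The argument `(ξ + 2 v)/√2` of the Hermite functions in `q_{k,ξ}(v)`. -/
def hermitePoint (ξ v : E n) : E n := (Real.sqrt 2)⁻¹ • ξ + Real.sqrt 2 • v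

lemma hermitePoint_apply (ξ v : E n) (r : Fin n) :
    hermitePoint ξ v r = (ξ r + 2 * v r) / Real.sqrt 2 := by
  have sqrt_two_sq : Real.sqrt 2 ^ 2 = 2 := Real.sq_sqrt zero_le_two
  simp only [hermitePoint, PiLp.add_apply, PiLp.smul_apply, smul_eq_mul]
  field_simp
  rw [sqrt_two_sq]
  ring

lemma norm_hermitePoint_sq (ξ v : E n) :
    ‖hermitePoint ξ v‖ ^ 2 = 2 * (‖v‖ ^ 2 + inner ℝ ξ v + ‖ξ‖ ^ 2 / 4) := by
  have inv_sqrt_two_mul : (Real.sqrt 2)⁻¹ * Real.sqrt 2 = 1 := inv_mul_cancel₀ (by positivity)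
  rw [hermitePoint, norm_add_sq_real, norm_smul, norm_smul, real_inner_smul_left,
    real_inner_smul_right, ← mul_assoc (Real.sqrt 2)⁻¹, inv_sqrt_two_mul, mul_pow, mul_pow,
    norm_inv, inv_pow, Real.norm_eq_abs, sq_abs, Real.sq_sqrt zero_le_two]
  ring

@[fun_prop]
lemma continuous_hermitePoint : Continuous fun p : E n × E n => hermitePoint p.1 p.2 := by
  unfold hermitePoint
  fun_prop

lemma map_hermitePoint (ξ : E n) : (muTilde n).map (hermitePoint ξ) =
    ENNReal.ofReal ((2 : ℝ) ^ (n : ℝ) * Real.pi ^ ((n : ℝ) / 2))⁻¹ • volume := by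
  have const_eq : (2 * Real.pi) ^ (-(n : ℝ) / 2) * |(Real.sqrt 2 ^ n)⁻¹| =
      ((2 : ℝ) ^ (n : ℝ) * Real.pi ^ ((n : ℝ) / 2))⁻¹ := by
    rw [abs_of_pos (by positivity), Real.sqrt_eq_rpow, ← Real.rpow_natCast,
      ← Real.rpow_mul zero_le_two, neg_div, Real.rpow_neg (by positivity), ← mul_inv,
      Real.mul_rpow zero_le_two Real.pi_pos.le, mul_right_comm, ← Real.rpow_add two_pos]
    ring_nf
  unfold hermitePoint
  rw [muTilde, Measure.map_smul, map_const_add_smul _ (by positivity), smul_smul,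
    ← ENNReal.ofReal_mul (by positivity), const_eq]

/-- The function `q_{k,ξ}(v) = 2^{n/2} π^{n/4} ∏_r ψ_{k_r}((ξ_r + 2 v_r)/√2)` for an arbitrary
multi-index `k`. -/
def qk (k : Fin n → ℕ) (ξ v : E n) : ℝ :=
  (2 : ℝ) ^ ((n : ℝ) / 2) * Real.pi ^ ((n : ℝ) / 4) * multiHermite k (hermitePoint ξ v)

lemma hermiteProd_eq_multiHermite {m : ℕ} (j : Fin (dim n m)) (ξ v : E n) :
    hermiteProd j ξ v = multiHermite (phi n m j) (hermitePoint ξ v) := by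
  simp only [hermiteProd, multiHermite, hermitePoint_apply]

lemma q_eq_qk {m : ℕ} (j : Fin (dim n m)) (ξ v : E n) : q j ξ v = qk (phi n m j) ξ v := by
  rw [q, qk, hermiteProd_eq_multiHermite]

/-- The normalizing constant of `q_{k,ξ}`, in front of the Hermite polynomials. -/
def qkNorm (k : Fin n → ℕ) : ℝ :=
  (2 : ℝ) ^ ((n : ℝ) / 2) * Real.pi ^ ((n : ℝ) / 4) * hermiteNorm k

lemma qkNorm_ne_zero (k : Fin n → ℕ) : qkNorm k ≠ 0 :=
  mul_ne_zero (by positivity) (hermiteNorm_ne_zero k)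

lemma qk_eq (k : Fin n → ℕ) (ξ v : E n) :
    qk k ξ v = qkNorm k * (∏ r, (hermitePoly (k r)).eval (hermitePoint ξ v r)) *
        Real.exp (-(‖v‖ ^ 2 + inner ℝ ξ v + ‖ξ‖ ^ 2 / 4)) := by
  rw [qk, qkNorm, multiHermite_eq, norm_hermitePoint_sq]
  ring_nf

@[fun_prop]
lemma continuous_qk (k : Fin n → ℕ) : Continuous fun p : E n × E n => qk k p.1 p.2 := by
  unfold qk
  fun_prop

lemma memLp_qk (k : Fin n → ℕ) (ξ : E n) : MemLp (fun v => (qk k ξ v : ℂ)) 2 (muTilde n) := by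
  simp only [qk, ofReal_mul]
  exact (memLp_muTilde_iff.2
    (memLp_comp_const_add_smul (memLp_multiHermite k) _ (by positivity))).const_mul _

lemma memLp_qk_left (k : Fin n → ℕ) (v : E n) :
    MemLp (fun ξ => (qk k ξ v : ℂ)) 2 (muTilde n) := by
  simp only [qk, ofReal_mul, hermitePoint, add_comm _ (Real.sqrt 2 • v)]
  exact (memLp_muTilde_iff.2
    (memLp_comp_const_add_smul (memLp_multiHermite k) _ (by positivity))).const_mul _

lemma integral_qk_mul_qk (k l : Fin n → ℕ) (ξ : E n) :
    ∫ v, qk k ξ v * qk l ξ v ∂(muTilde n) = if k = l then 1 else 0 := by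
  have hsq : ((2 : ℝ) ^ ((n : ℝ) / 2) * Real.pi ^ ((n : ℝ) / 4)) ^ 2 =
      (2 : ℝ) ^ (n : ℝ) * Real.pi ^ ((n : ℝ) / 2) := by
    rw [mul_pow, ← Real.rpow_mul_natCast zero_le_two, ← Real.rpow_mul_natCast Real.pi_pos.le]
    push_cast
    ring_nf
  have hmap := integral_map (μ := muTilde n) (φ := hermitePoint ξ)
    (by unfold hermitePoint; fun_prop) (f := fun x => multiHermite k x * multiHermite l x)
    (by fun_prop)
  rw [map_hermitePoint, integral_smul_measure, integral_multiHermite_mul,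
    ENNReal.toReal_ofReal (by positivity), smul_eq_mul] at hmap
  calc ∫ v, qk k ξ v * qk l ξ v ∂(muTilde n)
    _ = ((2 : ℝ) ^ ((n : ℝ) / 2) * Real.pi ^ ((n : ℝ) / 4)) ^ 2 * ∫ v,
        multiHermite k (hermitePoint ξ v) * multiHermite l (hermitePoint ξ v) ∂(muTilde n) := by
      rw [← integral_const_mul]
      congr with v
      rw [qk, qk]
      ring
    _ = if k = l then 1 else 0 := by
      rw [hsq, ← hmap, ← mul_assoc, mul_inv_cancel₀ (by positivity), one_mul]

lemma ae_eq_zero_of_integral_qk_eq_zero (ξ : E n) {φ : E n → ℂ} (hφ : MemLp φ 2 (muTilde n))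
    (h : ∀ k : Fin n → ℕ, ∫ v, φ v * (qk k ξ v : ℂ) ∂(muTilde n) = 0) :
    φ =ᵐ[muTilde n] 0 := by
  let ψ : E n → ℂ := fun x => φ (-(1 / 2 : ℝ) • ξ + (Real.sqrt 2)⁻¹ • x)
  have hψφ (v : E n) : ψ (hermitePoint ξ v) = φ v := by
    have inv_sqrt_two_sq : (Real.sqrt 2)⁻¹ * (Real.sqrt 2)⁻¹ = 1 / 2 := by
      rw [← mul_inv, Real.mul_self_sqrt zero_le_two, one_div]
    simp only [ψ, hermitePoint, smul_add, smul_smul, inv_sqrt_two_sq]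
    rw [inv_mul_cancel₀ (by positivity), one_smul, ← add_assoc, ← add_smul, neg_add_cancel,
      zero_smul, zero_add]
  have hcont : Continuous (hermitePoint ξ) := by fun_prop
  have hψ : ψ =ᵐ[volume] 0 := by
    have hψL : MemLp ψ 2 :=
      memLp_comp_const_add_smul (memLp_muTilde_iff.1 hφ) _ (inv_ne_zero (by positivity))
    refine ae_eq_zero_of_integral_multiHermite_eq_zero hψL fun k => ?_
    have hmap := integral_map (μ := muTilde n) hcont.aemeasurable
      (f := fun x => ψ x * (multiHermite k x : ℂ)) (by
        rw [map_hermitePoint]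
        exact (hψL.1.mul (by fun_prop)).mono_ac Measure.smul_absolutelyContinuous)
    have hconst : (2 : ℝ) ^ ((n : ℝ) / 2) * Real.pi ^ ((n : ℝ) / 4) ≠ 0 := by positivity
    have hk := h k
    simp only [qk, ofReal_mul (_ * _), mul_left_comm (φ _), integral_const_mul] at hk
    rw [map_hermitePoint, integral_smul_measure, ENNReal.toReal_ofReal (by positivity)] at hmap
    simp only [hψφ] at hmap
    rw [(mul_eq_zero.1 hk).resolve_left (ofReal_ne_zero.2 hconst)] at hmap
    exact (smul_eq_zero.1 hmap).resolve_left (by positivity)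
  have hcomp : ∀ᵐ x ∂((muTilde n).map (hermitePoint ξ)), ψ x = 0 := by
    rw [map_hermitePoint]
    exact Measure.ae_smul_measure hψ _
  filter_upwards [ae_of_ae_map hcont.aemeasurable hcomp] with v hv
  rwa [hψφ] at hv

end HermiteKernel

/-! ### Square-integrable functions of two variables and their slices -/

section Slices

variable {X X' Y : Type*} [MeasurableSpace X] [MeasurableSpace X'] [MeasurableSpace Y]
  {μ : Measure X} {μ' : Measure X'} {ν : Measure Y}

lemma integral_norm_sq_eq_norm_sq (f : Lp ℂ 2 μ) : ∫ x, ‖f x‖ ^ 2 ∂μ = ‖f‖ ^ 2 := by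
  rw [← ofReal_inj, ← integral_complex_ofReal]
  push_cast
  refine Eq.trans (integral_congr_ae (.of_forall fun x => ?_))
    ((L2.inner_def f f).symm.trans (inner_self_eq_norm_sq_to_K (𝕜 := ℂ) f))
  exact (inner_self_eq_norm_sq_to_K (𝕜 := ℂ) (f x)).symm

lemma integral_norm_sq_eq_norm_toLp_sq {f : X → ℂ} (hf : MemLp f 2 μ) :
    ∫ x, ‖f x‖ ^ 2 ∂μ = ‖hf.toLp f‖ ^ 2 := by
  rw [← integral_norm_sq_eq_norm_sq]
  refine integral_congr_ae ?_
  filter_upwards [hf.coeFn_toLp] with x hx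
  rw [hx]

variable [SFinite μ] [SFinite ν]

lemma ae_memLp_slice_left {Φ : X × Y → ℂ} (hΦ : MemLp Φ 2 (μ.prod ν)) :
    ∀ᵐ x ∂μ, MemLp (fun y => Φ (x, y)) 2 ν := by
  filter_upwards [((memLp_two_iff_integrable_sq_norm hΦ.1).1 hΦ).prod_right_ae,
    hΦ.1.prodMk_left] with x hint hmeas
  exact (memLp_two_iff_integrable_sq_norm hmeas).2 hint

lemma ae_memLp_slice_right {Φ : X × Y → ℂ} (hΦ : MemLp Φ 2 (μ.prod ν)) :
    ∀ᵐ y ∂ν, MemLp (fun x => Φ (x, y)) 2 μ :=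
  ae_memLp_slice_left (hΦ.comp_measurePreserving Measure.measurePreserving_swap)

lemma eq_zero_of_slice_eq_zero {Φ : Lp ℂ 2 (μ.prod ν)}
    (h : ∀ᵐ x ∂μ, (fun y => Φ (x, y)) =ᵐ[ν] 0) : Φ = 0 := by
  have hint := (memLp_two_iff_integrable_sq_norm (Lp.aestronglyMeasurable Φ)).1 (Lp.memLp Φ)
  rw [← norm_eq_zero, ← sq_eq_zero_iff, ← integral_norm_sq_eq_norm_sq, integral_prod _ hint]
  refine integral_eq_zero_of_ae ?_
  filter_upwards [h] with x hx
  refine integral_eq_zero_of_ae ?_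
  filter_upwards [hx] with y hy
  simp only [hy, Pi.zero_apply, norm_zero, ne_eq, OfNat.ofNat_ne_zero, not_false_eq_true, zero_pow]

lemma stronglyMeasurable_integral_kernel {κ : X → X' → ℂ}
    (hκ : StronglyMeasurable fun p : X × X' => κ p.1 p.2) {g : X × Y → ℂ}
    (hg : StronglyMeasurable g) :
    StronglyMeasurable fun p : X' × Y => ∫ x, g (x, p.2) * κ x p.1 ∂μ :=
  StronglyMeasurable.integral_prod_right'
    (f := fun q : (X' × Y) × X => g (q.2, q.1.2) * κ q.2 q.1.1)
    ((hg.comp_measurable (by fun_prop)).mul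
      (hκ.comp_measurable (g := fun q : (X' × Y) × X => (q.2, q.1.1)) (by fun_prop)))

variable {T : Lp ℂ 2 μ → Lp ℂ 2 μ'} {κ : X → X' → ℂ} {g : X × Y → ℂ}

lemma ae_exists_transform_slice_ae_eq
    (hTκ : ∀ f : X → ℂ, Integrable f μ → ∀ hf : MemLp f 2 μ,
      T (hf.toLp f) =ᵐ[μ'] fun x' => ∫ x, f x * κ x x' ∂μ)
    (hg : MemLp g 2 (μ.prod ν)) (hs : ∀ᵐ y ∂ν, Integrable (fun x => g (x, y)) μ) :
    ∀ᵐ y ∂ν, ∃ h : MemLp (fun x => g (x, y)) 2 μ,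
      T (h.toLp _) =ᵐ[μ'] fun x' => ∫ x, g (x, y) * κ x x' ∂μ := by
  filter_upwards [hs, ae_memLp_slice_right hg] with y hint hmem
  exact ⟨hmem, hTκ _ hint hmem⟩

lemma memLp_transform_slices [SFinite μ'] (hT : ∀ f, ‖T f‖ = ‖f‖)
    (hκ : StronglyMeasurable fun p : X × X' => κ p.1 p.2)
    (hTκ : ∀ f : X → ℂ, Integrable f μ → ∀ hf : MemLp f 2 μ,
      T (hf.toLp f) =ᵐ[μ'] fun x' => ∫ x, f x * κ x x' ∂μ)
    (hg : MemLp g 2 (μ.prod ν)) (hgm : StronglyMeasurable g)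
    (hs : ∀ᵐ y ∂ν, Integrable (fun x => g (x, y)) μ) :
    MemLp (fun p : X' × Y => ∫ x, g (x, p.2) * κ x p.1 ∂μ) 2 (μ'.prod ν) := by
  have hslice := ae_exists_transform_slice_ae_eq hTκ hg hs
  have hm : StronglyMeasurable fun p : X' × Y => ∫ x, g (x, p.2) * κ x p.1 ∂μ :=
    stronglyMeasurable_integral_kernel hκ hgm
  refine (memLp_two_iff_integrable_sq_norm hm.aestronglyMeasurable).2 ?_
  have hm2 : AEStronglyMeasurable (fun p : X' × Y => ‖∫ x, g (x, p.2) * κ x p.1 ∂μ‖ ^ 2)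
      (μ'.prod ν) := (hm.norm.pow 2).aestronglyMeasurable
  rw [integrable_prod_iff' hm2]
  constructor
  · filter_upwards [hslice] with y ⟨h, hTy⟩
    have hmem := (memLp_congr_ae hTy).1 (Lp.memLp _)
    exact (memLp_two_iff_integrable_sq_norm hmem.1).1 hmem
  · refine ((memLp_two_iff_integrable_sq_norm hg.1).1 hg).integral_prod_right.congr ?_
    filter_upwards [hslice] with y ⟨h, hTy⟩
    simp only [norm_pow, norm_norm]
    rw [integral_norm_sq_eq_norm_toLp_sq h, ← hT, ← integral_norm_sq_eq_norm_sq]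
    refine integral_congr_ae ?_
    filter_upwards [hTy] with x' hx'
    rw [hx']

end Slices

/-! ### Fiberwise Hilbert bases -/

section FiberwiseHilbertBasis

variable {X Y ι : Type*} [MeasurableSpace X] [MeasurableSpace Y] [DecidableEq ι]

/-- A measurable family of functions `b k x` of `y` that for every fixed `x` is a Hilbert basis of
`L²(ν)`: orthonormal, and with trivial orthogonal complement. -/
structure FiberwiseHilbertBasis (μ : Measure X) (ν : Measure Y) (b : ι → X → Y → ℂ) : Prop where
  aestronglyMeasurable (k : ι) :
    AEStronglyMeasurable (fun p : X × Y => b k p.1 p.2) (μ.prod ν)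
  memLp (k : ι) (x : X) : MemLp (b k x) 2 ν
  integral_star_mul (k l : ι) (x : X) :
    ∫ y, star (b k x y) * b l x y ∂ν = if k = l then 1 else 0
  ae_eq_zero (x : X) {φ : Y → ℂ} (hφ : MemLp φ 2 ν)
    (h : ∀ k, ∫ y, star (b k x y) * φ y ∂ν = 0) : φ =ᵐ[ν] 0

namespace FiberwiseHilbertBasis

variable {μ : Measure X} {ν : Measure Y} {b : ι → X → Y → ℂ}

lemma const_left [SFinite ν] (hb : FiberwiseHilbertBasis μ ν b) (x₀ : X) :
    FiberwiseHilbertBasis μ ν fun k (_ : X) => b k x₀ where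
  aestronglyMeasurable k := (hb.memLp k x₀).1.comp_snd
  memLp k _ := hb.memLp k x₀
  integral_star_mul k l _ := hb.integral_star_mul k l x₀
  ae_eq_zero _ _ hφ h := hb.ae_eq_zero x₀ hφ h

lemma integral_norm_sq (hb : FiberwiseHilbertBasis μ ν b) (k : ι) (x : X) :
    ∫ y, ‖b k x y‖ ^ 2 ∂ν = 1 := by
  have orthonormal := hb.integral_star_mul k k x
  simp only [RCLike.star_def, conj_mul', if_true, ← ofReal_pow, integral_complex_ofReal]
    at orthonormal
  exact_mod_cast orthonormal

variable [SFinite ν]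

lemma memLp_mul (hb : FiberwiseHilbertBasis μ ν b) (k : ι) {c : X → ℂ} (hc : MemLp c 2 μ) :
    MemLp (fun p : X × Y => c p.1 * b k p.1 p.2) 2 (μ.prod ν) := by
  have hm : AEStronglyMeasurable (fun p : X × Y => c p.1 * b k p.1 p.2) (μ.prod ν) :=
    hc.1.comp_fst.mul (hb.aestronglyMeasurable k)
  refine (memLp_two_iff_integrable_sq_norm hm).2 ?_
  have hm2 : AEStronglyMeasurable (fun p : X × Y => ‖c p.1 * b k p.1 p.2‖ ^ 2) (μ.prod ν) :=
    hm.norm.pow 2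
  rw [integrable_prod_iff hm2]
  simp only [norm_mul, mul_pow]
  refine ⟨.of_forall fun x => ?_, ?_⟩
  · exact ((memLp_two_iff_integrable_sq_norm (hb.memLp k x).1).1 (hb.memLp k x)).const_mul _
  · simp only [norm_pow, norm_norm, integral_const_mul, hb.integral_norm_sq, mul_one]
    exact (memLp_two_iff_integrable_sq_norm hc.1).1 hc

lemma integrable_star_mul (hb : FiberwiseHilbertBasis μ ν b) (k : ι) (c : Lp ℂ 2 μ)
    (Φ : Lp ℂ 2 (μ.prod ν)) :
    Integrable (fun p : X × Y => star (c p.1) * (star (b k p.1 p.2) * Φ p)) (μ.prod ν) := by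
  refine ((hb.memLp_mul k (Lp.memLp c)).star.integrable_mul (Lp.memLp Φ)).congr
    (.of_forall fun p => ?_)
  simp only [Pi.mul_apply, Pi.star_apply, star_mul', mul_assoc]

section SFinite

variable [SFinite μ]

lemma inner_toLp_mul (hb : FiberwiseHilbertBasis μ ν b) (k : ι) (c : Lp ℂ 2 μ)
    (Φ : Lp ℂ 2 (μ.prod ν)) :
    inner ℂ ((hb.memLp_mul k (Lp.memLp c)).toLp _) Φ =
      ∫ x, star (c x) * ∫ y, star (b k x y) * Φ (x, y) ∂ν ∂μ := by
  have hinner : ∀ᵐ p ∂(μ.prod ν), inner ℂ ((hb.memLp_mul k (Lp.memLp c)).toLp _ p) (Φ p) =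
      star (c p.1) * (star (b k p.1 p.2) * Φ p) := by
    filter_upwards [(hb.memLp_mul k (Lp.memLp c)).coeFn_toLp] with p hp
    rw [hp, RCLike.inner_apply, map_mul, mul_comm, mul_assoc]
    rfl
  rw [L2.inner_def, integral_congr_ae hinner, integral_prod _ (hb.integrable_star_mul k c Φ)]
  simp only [integral_const_mul]

lemma inner_toLp_mul_toLp_mul (hb : FiberwiseHilbertBasis μ ν b) (k l : ι) (c d : Lp ℂ 2 μ) :
    inner ℂ ((hb.memLp_mul k (Lp.memLp c)).toLp _) ((hb.memLp_mul l (Lp.memLp d)).toLp _) =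
      if k = l then inner ℂ c d else 0 := by
  have hslice : ∀ᵐ x ∂μ,
      star (c x) * ∫ y, star (b k x y) * (hb.memLp_mul l (Lp.memLp d)).toLp _ (x, y) ∂ν =
      inner ℂ (c x) (d x) * if k = l then 1 else 0 := by
    filter_upwards [Measure.ae_ae_of_ae_prod (hb.memLp_mul l (Lp.memLp d)).coeFn_toLp] with x hx
    have hd : ∀ᵐ y ∂ν, star (b k x y) * (hb.memLp_mul l (Lp.memLp d)).toLp _ (x, y) =
        d x * (star (b k x y) * b l x y) := by
      filter_upwards [hx] with y hy
      rw [hy, mul_left_comm]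
    rw [integral_congr_ae hd, integral_const_mul, hb.integral_star_mul, RCLike.inner_apply,
      ← mul_assoc, mul_comm (star (c x))]
    rfl
  rw [hb.inner_toLp_mul, integral_congr_ae hslice, integral_mul_const, L2.inner_def]
  split_ifs
  · exact mul_one _
  · exact mul_zero _

/-- The isometry `c ↦ c(x) b_k(x, y)` from `L²(μ)` to `L²(μ × ν)`. -/
def lift (hb : FiberwiseHilbertBasis μ ν b) (k : ι) : Lp ℂ 2 μ →ₗᵢ[ℂ] Lp ℂ 2 (μ.prod ν) where
  toFun c := (hb.memLp_mul k (Lp.memLp c)).toLp _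
  map_add' c d := by
    rw [← MemLp.toLp_add, MemLp.toLp_eq_toLp_iff]
    filter_upwards [Measure.quasiMeasurePreserving_fst.ae (Lp.coeFn_add c d)] with p hp
    simp only [hp, Pi.add_apply, add_mul]
  map_smul' a c := by
    rw [RingHom.id_apply, ← MemLp.toLp_const_smul, MemLp.toLp_eq_toLp_iff]
    filter_upwards [Measure.quasiMeasurePreserving_fst.ae (Lp.coeFn_smul a c)] with p hp
    simp only [hp, Pi.smul_apply, smul_eq_mul, mul_assoc]
  norm_map' c := by
    rw [norm_eq_sqrt_re_inner (𝕜 := ℂ), norm_eq_sqrt_re_inner (𝕜 := ℂ) c]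
    exact congrArg (fun z => √(RCLike.re z))
      ((hb.inner_toLp_mul_toLp_mul k k c c).trans (if_pos rfl))

lemma lift_toLp (hb : FiberwiseHilbertBasis μ ν b) (k : ι) {c : X → ℂ} (hc : MemLp c 2 μ) :
    hb.lift k (hc.toLp c) = (hb.memLp_mul k hc).toLp _ := by
  refine (MemLp.toLp_eq_toLp_iff (hb.memLp_mul k (Lp.memLp _)) (hb.memLp_mul k hc)).2 ?_
  filter_upwards [Measure.quasiMeasurePreserving_fst.ae hc.coeFn_toLp] with p hp
  rw [hp]

/-- The `k`-th coefficient `x ↦ ∫ conj (b_k(x, y)) Φ(x, y) dν(y)` with respect to a fiberwise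
Hilbert basis, encoded as the adjoint of the isometry `lift k`. -/
def coeff (hb : FiberwiseHilbertBasis μ ν b) (k : ι) : Lp ℂ 2 (μ.prod ν) →L[ℂ] Lp ℂ 2 μ :=
  ContinuousLinearMap.adjoint (hb.lift k).toContinuousLinearMap

lemma inner_lift_left (hb : FiberwiseHilbertBasis μ ν b) (k : ι) (c : Lp ℂ 2 μ)
    (Φ : Lp ℂ 2 (μ.prod ν)) : inner ℂ (hb.lift k c) Φ = inner ℂ c (hb.coeff k Φ) :=
  (ContinuousLinearMap.adjoint_inner_right (hb.lift k).toContinuousLinearMap c Φ).symm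

lemma coeff_lift (hb : FiberwiseHilbertBasis μ ν b) (k l : ι) (c : Lp ℂ 2 μ) :
    hb.coeff k (hb.lift l c) = if k = l then c else 0 := by
  refine ext_inner_left ℂ fun d => ?_
  rw [← inner_lift_left]
  refine (hb.inner_toLp_mul_toLp_mul k l d c).trans ?_
  split_ifs
  · rfl
  · exact inner_zero_right d |>.symm

end SFinite

section SigmaFinite

variable [SigmaFinite μ]

lemma coeff_ae_eq (hb : FiberwiseHilbertBasis μ ν b) (k : ι)
    (Φ : Lp ℂ 2 (μ.prod ν)) :
    (fun x => ∫ y, star (b k x y) * Φ (x, y) ∂ν) =ᵐ[μ] hb.coeff k Φ := by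
  have hind {s : Set X} (hs : MeasurableSet s) (hμs : μ s < ⊤) :
      (fun x => star (indicatorConstLp 2 hs hμs.ne (1 : ℂ) x) *
        ∫ y, star (b k x y) * Φ (x, y) ∂ν) =ᵐ[μ]
      s.indicator fun x => ∫ y, star (b k x y) * Φ (x, y) ∂ν := by
    filter_upwards [indicatorConstLp_coeFn (p := 2) (hs := hs) (hμs := hμs.ne) (c := (1 : ℂ))]
      with x hx
    rw [hx]
    by_cases hm : x ∈ s <;> simp [hm]
  refine ae_eq_of_forall_setIntegral_eq_of_sigmaFinite (fun s hs hμs => ?_) (fun s _ hμs => ?_)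
    (fun s hs hμs => ?_)
  · have hint := (hb.integrable_star_mul k (indicatorConstLp 2 hs hμs.ne 1) Φ).integral_prod_left
    simp only [integral_const_mul] at hint
    exact (integrable_indicator_iff hs).1 (hint.congr (hind hs hμs))
  · exact integrableOn_Lp_of_measure_ne_top _ (by norm_num) hμs.ne
  · have hpair := hb.inner_lift_left k (indicatorConstLp 2 hs hμs.ne (1 : ℂ)) Φ
    rw [L2.inner_indicatorConstLp_one] at hpair
    rw [← hpair, ← integral_indicator hs, ← integral_congr_ae (hind hs hμs)]
    exact (hb.inner_toLp_mul k _ Φ).symm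

lemma eq_zero_of_coeff_eq_zero [Countable ι]
    (hb : FiberwiseHilbertBasis μ ν b) {Φ : Lp ℂ 2 (μ.prod ν)} (h : ∀ k, hb.coeff k Φ = 0) :
    Φ = 0 := by
  have hslice (k : ι) : ∀ᵐ x ∂μ, ∫ y, star (b k x y) * Φ (x, y) ∂ν = 0 := by
    filter_upwards [hb.coeff_ae_eq k Φ, Lp.coeFn_zero ℂ 2 μ] with x hx hzero
    rw [hx, h, hzero, Pi.zero_apply]
  refine eq_zero_of_slice_eq_zero ?_
  filter_upwards [ae_all_iff.2 hslice, ae_memLp_slice_left (Lp.memLp Φ)] with x hx hmem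
  exact hb.ae_eq_zero x hmem hx

lemma eq_sum_lift_coeff [Countable ι] (hb : FiberwiseHilbertBasis μ ν b)
    {Φ : Lp ℂ 2 (μ.prod ν)} {s : Finset ι} (h : ∀ k ∉ s, hb.coeff k Φ = 0) :
    Φ = ∑ k ∈ s, hb.lift k (hb.coeff k Φ) := by
  rw [← sub_eq_zero]
  refine hb.eq_zero_of_coeff_eq_zero fun k => ?_
  simp only [map_sub, map_sum, coeff_lift, Finset.sum_ite_eq]
  split_ifs with hk
  · exact sub_self _
  · rw [h k hk, sub_zero]

lemma norm_sq_eq_sum_coeff [Countable ι] (hb : FiberwiseHilbertBasis μ ν b)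
    {Φ : Lp ℂ 2 (μ.prod ν)} {s : Finset ι} (h : ∀ k ∉ s, hb.coeff k Φ = 0) :
    ‖Φ‖ ^ 2 = ∑ k ∈ s, ‖hb.coeff k Φ‖ ^ 2 := by
  have hinner : inner ℂ Φ Φ = ∑ k ∈ s, inner ℂ (hb.coeff k Φ) (hb.coeff k Φ) := by
    conv_lhs => enter [2]; rw [hb.eq_sum_lift_coeff h]
    rw [sum_inner]
    exact Finset.sum_congr rfl fun k _ => hb.inner_lift_left k _ Φ
  simp only [inner_self_eq_norm_sq_to_K] at hinner
  exact_mod_cast hinner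

end SigmaFinite

end FiberwiseHilbertBasis

variable {n : ℕ}

lemma fiberwiseHilbertBasis_qk :
    FiberwiseHilbertBasis (muTilde n) (muTilde n) fun k ξ v => (qk k ξ v : ℂ) where
  aestronglyMeasurable k :=
    (continuous_ofReal.comp (continuous_qk k)).aestronglyMeasurable
  memLp := memLp_qk
  integral_star_mul k l ξ := by
    simp only [RCLike.star_def, conj_ofReal, ← ofReal_mul, integral_complex_ofReal,
      integral_qk_mul_qk, apply_ite ofReal, ofReal_one, ofReal_zero]
  ae_eq_zero ξ φ hφ h := by
    refine ae_eq_zero_of_integral_qk_eq_zero ξ hφ fun k => ?_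
    simpa only [RCLike.star_def, conj_ofReal, mul_comm (φ _)] using h k

end FiberwiseHilbertBasis

/-! ### The operator `F ⊗ I` -/

section FourierTensorId

variable {n : ℕ}

lemma inner_tensorIncl_tmul (f h : Lp ℂ 2 (muTilde n)) {Φ : E n × E n → ℂ}
    (hΦ : MemLp Φ 2 (muTilde2 n)) :
    inner ℂ (tensorIncl n (f ⊗ₜ h)) (hΦ.toLp Φ) =
      ∫ v, star (h v) * ∫ u, star (f u) * Φ (u, v) ∂(muTilde n) ∂(muTilde n) := by
  have hm := memLp_tensor (Lp.memLp f) (Lp.memLp h)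
  have hinner : ∀ᵐ p ∂(muTilde2 n), inner ℂ (hm.toLp _ p) (hΦ.toLp Φ p) =
      star (h p.2) * (star (f p.1) * Φ p) := by
    filter_upwards [hm.coeFn_toLp, hΦ.coeFn_toLp] with p hp hp'
    rw [hp, hp', RCLike.inner_apply]
    simp only [map_mul, RCLike.star_def]
    ring
  have hint : Integrable (fun p : E n × E n => star (h p.2) * (star (f p.1) * Φ p))
      (muTilde2 n) := by
    refine (hΦ.integrable_mul hm.star).congr (.of_forall fun p => ?_)
    simp only [Pi.mul_apply, Pi.star_apply, star_mul']
    ring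
  change inner ℂ (hm.toLp _) _ = _
  rw [L2.inner_def, integral_congr_ae hinner, integral_prod_symm _ hint]
  simp only [integral_const_mul]

lemma inner_tensorIncl (x y : Lp ℂ 2 (muTilde n) ⊗[ℂ] Lp ℂ 2 (muTilde n)) :
    inner ℂ (tensorIncl n x) (tensorIncl n y) = inner ℂ x y := by
  induction x using TensorProduct.induction_on with
  | zero => simp only [map_zero, inner_zero_left]
  | add x x' hx hx' => simp only [map_add, inner_add_left, hx, hx']
  | tmul f h =>
    induction y using TensorProduct.induction_on with
    | zero => simp only [map_zero, inner_zero_right]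
    | add y y' hy hy' => simp only [map_add, inner_add_right, hy, hy']
    | tmul f' h' =>
      refine (inner_tensorIncl_tmul f h (memLp_tensor (Lp.memLp f') (Lp.memLp h'))).trans ?_
      rw [TensorProduct.inner_tmul, L2.inner_def, L2.inner_def, mul_comm, ← integral_mul_const]
      refine integral_congr_ae (.of_forall fun v => ?_)
      simp only [← mul_assoc, integral_mul_const, RCLike.inner_apply, RCLike.star_def]
      simp only [mul_comm (f' _)]
      ring

lemma norm_tensorIncl (x : Lp ℂ 2 (muTilde n) ⊗[ℂ] Lp ℂ 2 (muTilde n)) :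
    ‖tensorIncl n x‖ = ‖x‖ := by
  rw [norm_eq_sqrt_re_inner (𝕜 := ℂ), norm_eq_sqrt_re_inner (𝕜 := ℂ) x, inner_tensorIncl]

/-- The tensors `c ⊗ q_{k,0}` are the lifts `c(ξ) q_{k,0}(v)` along a fiberwise Hilbert basis that
does not depend on `ξ`. -/
lemma eq_zero_of_inner_tensorIncl_tmul_eq_zero {Φ : Lp ℂ 2 (muTilde2 n)}
    (h : ∀ f h : Lp ℂ 2 (muTilde n), inner ℂ (tensorIncl n (f ⊗ₜ h)) Φ = 0) : Φ = 0 := by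
  let hb := (fiberwiseHilbertBasis_qk (n := n)).const_left 0
  refine hb.eq_zero_of_coeff_eq_zero fun k => ext_inner_left ℂ fun c => ?_
  have hlift : hb.lift k c = tensorIncl n (c ⊗ₜ (memLp_qk k 0).toLp _) := by
    refine (MemLp.toLp_eq_toLp_iff (hb.memLp_mul k (Lp.memLp c))
      (memLp_tensor (Lp.memLp c) (Lp.memLp _))).2 ?_
    filter_upwards [Measure.quasiMeasurePreserving_snd.ae (memLp_qk k (0 : E n)).coeFn_toLp]
      with p hp
    rw [hp]
  rw [← hb.inner_lift_left, hlift, h, inner_zero_right]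

lemma denseRange_tensorIncl (n : ℕ) : DenseRange (tensorIncl n) := by
  have closure_range : (LinearMap.range (tensorIncl n)).topologicalClosure = ⊤ := by
    rw [Submodule.topologicalClosure_eq_top_iff, Submodule.eq_bot_iff]
    intro Φ hΦ
    refine eq_zero_of_inner_tensorIncl_tmul_eq_zero fun f h => ?_
    exact (Submodule.mem_orthogonal _ _).1 hΦ _ ⟨_, rfl⟩
  exact Submodule.dense_iff_topologicalClosure_eq_top.2 closure_range

lemma norm_tensorIncl_map_fourierF (x : Lp ℂ 2 (muTilde n) ⊗[ℂ] Lp ℂ 2 (muTilde n)) :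
    ‖(tensorIncl n ∘ₗ TensorProduct.map (fourierF n) LinearMap.id) x‖ = ‖tensorIncl n x‖ := by
  rw [LinearMap.comp_apply, norm_tensorIncl, norm_tensorIncl]
  exact TensorProduct.norm_map (fourierFEquiv n).toLinearIsometry LinearIsometry.id x

lemma fourierTensorId_tensorIncl (x : Lp ℂ 2 (muTilde n) ⊗[ℂ] Lp ℂ 2 (muTilde n)) :
    fourierTensorId n (tensorIncl n x) =
      tensorIncl n (TensorProduct.map (fourierF n) LinearMap.id x) :=
  LinearMap.extendOfNorm_eq (denseRange_tensorIncl n)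
    ⟨1, fun x => by rw [norm_tensorIncl_map_fourierF, one_mul]⟩ x

/-- The operator `F ⊗ I` as a linear isometry. -/
def fourierTensorIdₗᵢ (n : ℕ) : Lp ℂ 2 (muTilde2 n) →ₗᵢ[ℂ] Lp ℂ 2 (muTilde2 n) where
  toLinearMap := (fourierTensorId n).toLinearMap
  norm_map' Φ := by
    refine (denseRange_tensorIncl n).induction_on Φ
      (isClosed_eq (fourierTensorId n).continuous.norm continuous_norm) fun x => ?_
    exact (congrArg norm (fourierTensorId_tensorIncl x)).trans (norm_tensorIncl_map_fourierF x)

lemma norm_fourierTensorId (Φ : Lp ℂ 2 (muTilde2 n)) : ‖fourierTensorId n Φ‖ = ‖Φ‖ :=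
  (fourierTensorIdₗᵢ n).norm_map Φ

lemma inner_fourierTensorId (Φ Ψ : Lp ℂ 2 (muTilde2 n)) :
    inner ℂ (fourierTensorId n Φ) (fourierTensorId n Ψ) = inner ℂ Φ Ψ :=
  (fourierTensorIdₗᵢ n).inner_map_map Φ Ψ

lemma integral_star_mul_eq_inner_toLp (φ : Lp ℂ 2 (muTilde n)) {ψ : E n → ℂ}
    (hψ : MemLp ψ 2 (muTilde n)) :
    ∫ u, star (φ u) * ψ u ∂(muTilde n) = inner ℂ φ (hψ.toLp ψ) := by
  rw [L2.inner_def]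
  refine integral_congr_ae ?_
  filter_upwards [hψ.coeFn_toLp] with u hu
  rw [hu, RCLike.inner_apply, RCLike.star_def, mul_comm]

lemma fourierTensorId_toLp_eq {g G : E n × E n → ℂ} (hg : MemLp g 2 (muTilde2 n))
    (hG : MemLp G 2 (muTilde2 n))
    (h : ∀ᵐ v ∂(muTilde n), ∀ (hgv : MemLp (fun u => g (u, v)) 2 (muTilde n))
      (hGv : MemLp (fun ξ => G (ξ, v)) 2 (muTilde n)), fourierF n (hgv.toLp _) = hGv.toLp _) :
    fourierTensorId n (hg.toLp g) = hG.toLp G := by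
  rw [← sub_eq_zero]
  refine eq_zero_of_inner_tensorIncl_tmul_eq_zero fun f' w => ?_
  obtain ⟨f, rfl⟩ := (fourierFEquiv n).surjective f'
  have hf : tensorIncl n (fourierFEquiv n f ⊗ₜ w) = fourierTensorId n (tensorIncl n (f ⊗ₜ w)) :=
    (fourierTensorId_tensorIncl (f ⊗ₜ w)).symm
  rw [inner_sub_right, inner_tensorIncl_tmul, hf, inner_fourierTensorId, inner_tensorIncl_tmul,
    sub_eq_zero]
  refine integral_congr_ae ?_
  filter_upwards [h, ae_memLp_slice_right hg, ae_memLp_slice_right hG] with v hv hgv hGv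
  simp only [integral_star_mul_eq_inner_toLp _ hgv, integral_star_mul_eq_inner_toLp _ hGv]
  rw [← hv hgv hGv, ← fourierFEquiv_apply, LinearIsometryEquiv.inner_map_map]

lemma exists_fourierTensorId_toLp_eq_integral {g : E n × E n → ℂ} (hg : MemLp g 2 (muTilde2 n))
    (hgm : StronglyMeasurable g)
    (hs : ∀ᵐ v ∂(muTilde n), Integrable (fun u => g (u, v)) (muTilde n)) :
    ∃ hG : MemLp (fun p : E n × E n =>
        ∫ u, g (u, p.2) * cexp (-I * (inner ℝ u p.1 : ℝ)) ∂(muTilde n)) 2 (muTilde2 n),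
      fourierTensorId n (hg.toLp g) = hG.toLp _ := by
  have hκ : Continuous fun p : E n × E n => cexp (-I * (inner ℝ p.1 p.2 : ℝ)) := by fun_prop
  have hF (f : E n → ℂ) (hf : Integrable f (muTilde n)) (hf2 : MemLp f 2 (muTilde n)) :=
    fourierF_toLp_ae_eq hf hf2
  have hG := memLp_transform_slices (fourierFEquiv n).norm_map hκ.stronglyMeasurable hF hg hgm hs
  refine ⟨hG, fourierTensorId_toLp_eq hg hG ?_⟩
  filter_upwards [ae_exists_transform_slice_ae_eq hF hg hs] with v ⟨_, hv⟩ _ hGv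
  exact Lp.ext (hv.trans hGv.coeFn_toLp.symm)

lemma exists_fourierTensorId_integral_eq_toLp {G : E n × E n → ℂ} (hG : MemLp G 2 (muTilde2 n))
    (hGm : StronglyMeasurable G)
    (hs : ∀ᵐ v ∂(muTilde n), Integrable (fun u => G (u, v)) (muTilde n)) :
    ∃ hg : MemLp (fun p : E n × E n =>
        ∫ u, G (u, p.2) * cexp (I * (inner ℝ u p.1 : ℝ)) ∂(muTilde n)) 2 (muTilde2 n),
      fourierTensorId n (hg.toLp _) = hG.toLp G := by
  have hκ : Continuous fun p : E n × E n => cexp (I * (inner ℝ p.1 p.2 : ℝ)) := by fun_prop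
  have hF (f : E n → ℂ) (hf : Integrable f (muTilde n)) (hf2 : MemLp f 2 (muTilde n)) :=
    fourierFEquiv_symm_toLp_ae_eq hf hf2
  have hg := memLp_transform_slices (fourierFEquiv n).symm.norm_map hκ.stronglyMeasurable hF hG
    hGm hs
  refine ⟨hg, fourierTensorId_toLp_eq hg hG ?_⟩
  filter_upwards [ae_exists_transform_slice_ae_eq hF hG hs] with v ⟨hGv, hv⟩ hgv _
  rw [← Lp.ext (hv.trans hgv.coeFn_toLp.symm), ← fourierFEquiv_apply,
    LinearIsometryEquiv.apply_symm_apply]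

end FourierTensorId

/-! ### Calculus of the Wirtinger operators -/

section Wirtinger

variable {n : ℕ}

lemma dbar_mul (r : Fin n) {f g : (Fin n → ℂ) → ℂ} {z : Fin n → ℂ}
    (hf : DifferentiableAt ℝ f z) (hg : DifferentiableAt ℝ g z) :
    dbar r (fun z => f z * g z) z = dbar r f z * g z + f z * dbar r g z := by
  simp only [dbar, fderiv_fun_mul hf hg, add_apply, smul_apply, smul_eq_mul]
  ring

lemma dbar_sum (r : Fin n) {ι : Type*} (s : Finset ι) {f : ι → (Fin n → ℂ) → ℂ} {z : Fin n → ℂ}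
    (hf : ∀ i, DifferentiableAt ℝ (f i) z) :
    dbar r (fun z => ∑ i ∈ s, f i z) z = ∑ i ∈ s, dbar r (f i) z := by
  simp only [dbar, fderiv_fun_sum fun i _ => hf i, sum_apply, Finset.mul_sum,
    ← Finset.sum_add_distrib]

lemma dbar_cexp (r : Fin n) {f : (Fin n → ℂ) → ℂ} {z : Fin n → ℂ}
    (hf : DifferentiableAt ℝ f z) :
    dbar r (fun z => cexp (f z)) z = cexp (f z) * dbar r f z := by
  simp only [dbar, hf.hasFDerivAt.cexp.fderiv, smul_apply, smul_eq_mul]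
  ring

lemma dbar_eq_zero_of_differentiableAt (r : Fin n) {f : (Fin n → ℂ) → ℂ} {z : Fin n → ℂ}
    (hf : DifferentiableAt ℂ f z) : dbar r f z = 0 := by
  have single_I : (Pi.single r I : Fin n → ℂ) = I • Pi.single r 1 := by
    rw [← Pi.single_smul, smul_eq_mul, mul_one]
  rw [dbar, hf.fderiv_restrictScalars ℝ, ContinuousLinearMap.coe_restrictScalars', single_I,
    map_smul, smul_eq_mul, ← mul_assoc, I_mul_I]
  ring

/-- The conjugate coordinate `z ↦ z̄_j` of `ℂⁿ` as a real linear map, for which `fderiv` is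
immediate. -/
def conjCoord (j : Fin n) : (Fin n → ℂ) →L[ℝ] ℂ :=
  (conjCLE : ℂ →L[ℝ] ℂ).comp (ContinuousLinearMap.proj (φ := fun _ : Fin n => ℂ) j)

lemma conjCoord_apply (j : Fin n) (z : Fin n → ℂ) : conjCoord j z = star (z j) := rfl

lemma dbar_conjCoord (r j : Fin n) (z : Fin n → ℂ) :
    dbar r (conjCoord j) z = if j = r then 1 else 0 := by
  rw [dbar, ContinuousLinearMap.fderiv, conjCoord_apply, conjCoord_apply, Pi.single_apply,
    Pi.single_apply]
  split_ifs
  · rw [star_one, star_def, conj_I, mul_neg]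
    linear_combination (-1 / 2 : ℂ) * I_mul_I
  · rw [star_zero, mul_zero, add_zero, mul_zero]

lemma dbar_comp_smul (r : Fin n) (t : ℝ) {χ : (Fin n → ℂ) → ℂ} (hχ : Differentiable ℝ χ)
    (z : Fin n → ℂ) : dbar r (fun z => χ (t • z)) z = t * dbar r χ (t • z) := by
  have deriv_comp : HasFDerivAt (fun z => χ (t • z))
      ((fderiv ℝ χ (t • z)).comp (t • ContinuousLinearMap.id ℝ (Fin n → ℂ))) z :=
    (hχ (t • z)).hasFDerivAt.comp z
      ((ContinuousLinearMap.id ℝ (Fin n → ℂ)).hasFDerivAt.const_smul t)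
  simp only [dbar, deriv_comp.fderiv, ContinuousLinearMap.comp_apply, smul_apply,
    ContinuousLinearMap.id_apply, map_smul, real_smul]
  ring

lemma hasCompactSupport_dbar (r : Fin n) {χ : (Fin n → ℂ) → ℂ} (hχ : HasCompactSupport χ) :
    HasCompactSupport (dbar r χ) :=
  ((hχ.fderiv_apply ℝ _).add ((hχ.fderiv_apply ℝ _).mul_left)).mul_left

lemma integral_dbar_mul (r : Fin n) {u v : (Fin n → ℂ) → ℂ} (hu : ContDiff ℝ ∞ u)
    (hv : ContDiff ℝ ∞ v) (hvc : HasCompactSupport v) :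
    ∫ z, dbar r u z * v z = -∫ z, u z * dbar r v z := by
  have hu' : Continuous (fderiv ℝ u) := hu.continuous_fderiv (by simp)
  have hv' : Continuous (fderiv ℝ v) := hv.continuous_fderiv (by simp)
  have hu₀ := hu.continuous
  have hv₀ := hv.continuous
  have integrable_left (e) : Integrable fun z => fderiv ℝ u z e * v z :=
    Continuous.integrable_of_hasCompactSupport (by fun_prop) hvc.mul_left
  have integrable_right (e) : Integrable fun z => u z * fderiv ℝ v z e :=
    Continuous.integrable_of_hasCompactSupport (by fun_prop) (hvc.fderiv_apply ℝ e).mul_left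
  have by_parts (e) : ∫ z, fderiv ℝ u z e * v z = -∫ z, u z * fderiv ℝ v z e := by
    rw [integral_mul_fderiv_eq_neg_fderiv_mul_of_integrable (integrable_left e)
      (integrable_right e) ((hu₀.mul hv₀).integrable_of_hasCompactSupport hvc.mul_left)
      (fun z _ => hu.differentiable (by simp) z) (fun z _ => hv.differentiable (by simp) z),
      neg_neg]
  simp only [dbar, add_mul, mul_add, mul_assoc, mul_left_comm (u _)]
  rw [integral_add ((integrable_left _).const_mul _)
      (((integrable_left _).const_mul _).const_mul _),
    integral_add ((integrable_right _).const_mul _)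
      (((integrable_right _).const_mul _).const_mul _)]
  simp only [integral_const_mul, by_parts]
  ring

/-- The successive application of `∂/∂z̄_r` for `r` in the list `L`, from the head on. This is,
up to sign, the formal adjoint of `L.foldr dbar`. -/
def dbarList (L : List (Fin n)) (v : (Fin n → ℂ) → ℂ) : (Fin n → ℂ) → ℂ :=
  L.foldl (fun v r => dbar r v) v

lemma dbarList_nil (v : (Fin n → ℂ) → ℂ) : dbarList [] v = v := rfl

lemma dbarList_cons (r : Fin n) (L : List (Fin n)) (v : (Fin n → ℂ) → ℂ) :
    dbarList (r :: L) v = dbarList L (dbar r v) := rfl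

lemma dbarList_add (L : List (Fin n)) {u v : (Fin n → ℂ) → ℂ} (hu : ContDiff ℝ ∞ u)
    (hv : ContDiff ℝ ∞ v) : dbarList L (u + v) = dbarList L u + dbarList L v := by
  induction L generalizing u v with
  | nil => rfl
  | cons r L ih =>
    simp only [dbarList_cons, dbar_add r hu hv]
    exact ih (contDiff_dbar r hu) (contDiff_dbar r hv)

lemma dbarList_smul (L : List (Fin n)) (c : ℂ) {u : (Fin n → ℂ) → ℂ} (hu : ContDiff ℝ ∞ u) :
    dbarList L (c • u) = c • dbarList L u := by
  induction L generalizing u with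
  | nil => rfl
  | cons r L ih =>
    simp only [dbarList_cons, dbar_smul r c hu]
    exact ih (contDiff_dbar r hu)

lemma contDiff_dbarList (L : List (Fin n)) {v : (Fin n → ℂ) → ℂ} (hv : ContDiff ℝ ∞ v) :
    ContDiff ℝ ∞ (dbarList L v) := by
  induction L generalizing v with
  | nil => exact hv
  | cons r _ ih => exact ih (contDiff_dbar r hv)

lemma hasCompactSupport_dbarList (L : List (Fin n)) {v : (Fin n → ℂ) → ℂ}
    (hv : HasCompactSupport v) : HasCompactSupport (dbarList L v) := by
  induction L generalizing v with
  | nil => exact hv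
  | cons r _ ih => exact ih (hasCompactSupport_dbar r hv)

lemma integrable_mul_dbarList {f v : (Fin n → ℂ) → ℂ} (hf : Continuous f) (hv : ContDiff ℝ ∞ v)
    (hvc : HasCompactSupport v) (L : List (Fin n)) : Integrable fun z => f z * dbarList L v z :=
  Continuous.integrable_of_hasCompactSupport (hf.mul (contDiff_dbarList L hv).continuous)
    (hasCompactSupport_dbarList L hvc).mul_left

lemma contDiff_foldr_dbar (L : List (Fin n)) {f : (Fin n → ℂ) → ℂ} (hf : ContDiff ℝ ∞ f) :
    ContDiff ℝ ∞ (L.foldr dbar f) := by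
  induction L with
  | nil => exact hf
  | cons r L ih => exact contDiff_dbar r ih

lemma integral_foldr_dbar_mul (L : List (Fin n)) {f v : (Fin n → ℂ) → ℂ} (hf : ContDiff ℝ ∞ f)
    (hv : ContDiff ℝ ∞ v) (hvc : HasCompactSupport v) :
    ∫ z, L.foldr dbar f z * v z = (-1) ^ L.length * ∫ z, f z * dbarList L v z := by
  induction L generalizing v with
  | nil => rw [List.foldr_nil, dbarList_nil, List.length_nil, pow_zero, one_mul]
  | cons r L ih =>
    rw [List.foldr_cons, integral_dbar_mul r (contDiff_foldr_dbar L hf) hv hvc,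
      ih (contDiff_dbar r hv) (hasCompactSupport_dbar r hvc), dbarList_cons, List.length_cons]
    ring

/-- The list in which every index `r` occurs `k r` times, through which the iterated derivatives
`dbarPow k` are handled one derivative at a time. -/
def indexList (k : Fin n → ℕ) : List (Fin n) :=
  (List.finRange n).flatMap fun r => List.replicate (k r) r

lemma foldr_dbar_indexList (k : Fin n → ℕ) (f : (Fin n → ℂ) → ℂ) :
    (indexList k).foldr dbar f = dbarPow k f := by
  rw [indexList, List.foldr_flatMap, dbarPow]
  congr 1
  funext r g
  induction k r with
  | zero => rfl
  | succ p ih => rw [List.replicate_succ, List.foldr_cons, ih, Function.iterate_succ_apply']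

lemma sum_map_single_indexList (k : Fin n → ℕ) :
    ((indexList k).map fun r => (Pi.single r 1 : Fin n → ℕ)).sum = k := by
  have sum_flatMap (l : List (Fin n)) : ((l.flatMap fun r => List.replicate (k r) r).map
      fun r => (Pi.single r 1 : Fin n → ℕ)).sum = (l.map fun r => Pi.single r (k r)).sum := by
    induction l with
    | nil => rfl
    | cons r l ih =>
      rw [List.flatMap_cons, List.map_append, List.sum_append, ih, List.map_cons, List.sum_cons,
        List.map_replicate, List.sum_replicate, ← Pi.single_smul, smul_eq_mul, mul_one]
  rw [indexList, sum_flatMap, ← Fin.sum_univ_def, Finset.univ_sum_single]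

end Wirtinger

/-! ### Integration by parts without boundary terms -/

section Cutoff

variable {n : ℕ}

/-- The product of `g` with the rescaled cutoff `χ (z / (N + 1))`, which tends to `χ 0 • g`. -/
def cutoffMul (χ g : (Fin n → ℂ) → ℂ) (N : ℕ) : (Fin n → ℂ) → ℂ :=
  fun z => χ (((N : ℝ) + 1)⁻¹ • z) * g z

lemma contDiff_cutoffMul {χ g : (Fin n → ℂ) → ℂ} (hχ : ContDiff ℝ ∞ χ) (hg : ContDiff ℝ ∞ g)
    (N : ℕ) : ContDiff ℝ ∞ (cutoffMul χ g N) :=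
  (hχ.comp (contDiff_const_smul _)).mul hg

lemma hasCompactSupport_cutoffMul {χ : (Fin n → ℂ) → ℂ} (hχ : HasCompactSupport χ)
    (g : (Fin n → ℂ) → ℂ) (N : ℕ) : HasCompactSupport (cutoffMul χ g N) :=
  (hχ.comp_smul (by positivity : ((N : ℝ) + 1)⁻¹ ≠ 0)).mul_right

lemma dbar_cutoffMul (r : Fin n) {χ g : (Fin n → ℂ) → ℂ} (hχ : ContDiff ℝ ∞ χ)
    (hg : ContDiff ℝ ∞ g) (N : ℕ) :
    dbar r (cutoffMul χ g N) = cutoffMul χ (dbar r g) N +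
      ((((N : ℝ) + 1)⁻¹ : ℝ) : ℂ) • cutoffMul (dbar r χ) g N := by
  funext z
  have hχ' := hχ.differentiable (by simp)
  unfold cutoffMul
  rw [dbar_mul r (by fun_prop) (hg.differentiable (by simp) z), dbar_comp_smul r _ hχ']
  simp only [Pi.add_apply, Pi.smul_apply, smul_eq_mul]
  ring

lemma tendsto_inv_natCast_add_one :
    Filter.Tendsto (fun N : ℕ => ((N : ℝ) + 1)⁻¹) Filter.atTop (nhds 0) := by
  simpa only [one_div] using tendsto_one_div_add_atTop_nhds_zero_nat (𝕜 := ℝ)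

lemma tendsto_integral_mul_cutoffMul {f g χ : (Fin n → ℂ) → ℂ} (hf : Continuous f)
    (hg : Continuous g) (hfg : Integrable fun z => f z * g z) (hχ : Continuous χ)
    (hχc : HasCompactSupport χ) :
    Filter.Tendsto (fun N => ∫ z, f z * cutoffMul χ g N z) Filter.atTop
      (nhds (χ 0 * ∫ z, f z * g z)) := by
  obtain ⟨C, hC⟩ := hχc.exists_bound_of_continuous hχ
  simp only [cutoffMul, mul_left_comm (f _), ← integral_const_mul]
  refine tendsto_integral_of_dominated_convergence (fun z => C * ‖f z * g z‖)
    (fun N => Continuous.aestronglyMeasurable (by fun_prop)) (hfg.norm.const_mul C)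
    (fun N => .of_forall fun z => ?_) (.of_forall fun z => ?_)
  · rw [norm_mul]
    exact mul_le_mul_of_nonneg_right (hC _) (norm_nonneg _)
  · have tendsto_cutoff := (hχ.tendsto _).comp (tendsto_inv_natCast_add_one.smul_const z)
    rw [zero_smul] at tendsto_cutoff
    exact tendsto_cutoff.mul_const _

lemma tendsto_integral_mul_dbarList_cutoffMul {f g χ : (Fin n → ℂ) → ℂ} (hf : Continuous f)
    (hg : ContDiff ℝ ∞ g) (L : List (Fin n))
    (hfg : ∀ L, Integrable fun z => f z * dbarList L g z) (hχ : ContDiff ℝ ∞ χ)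
    (hχc : HasCompactSupport χ) :
    Filter.Tendsto (fun N => ∫ z, f z * dbarList L (cutoffMul χ g N) z) Filter.atTop
      (nhds (χ 0 * ∫ z, f z * dbarList L g z)) := by
  induction L generalizing χ g with
  | nil => exact tendsto_integral_mul_cutoffMul hf hg.continuous (hfg []) hχ.continuous hχc
  | cons r L ih =>
    have hg' := contDiff_dbar r hg
    have hχ' := contDiff_dbar r hχ
    have hχc' := hasCompactSupport_dbar r hχc
    have leibniz (N : ℕ) : ∫ z, f z * dbarList (r :: L) (cutoffMul χ g N) z =
        (∫ z, f z * dbarList L (cutoffMul χ (dbar r g) N) z) + ((((N : ℝ) + 1)⁻¹ : ℝ) : ℂ) *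
          ∫ z, f z * dbarList L (cutoffMul (dbar r χ) g N) z := by
      have smooth := contDiff_cutoffMul hχ hg' N
      have smooth' := contDiff_cutoffMul hχ' hg N
      have smooth_smul : ContDiff ℝ ∞ (((((N : ℝ) + 1)⁻¹ : ℝ) : ℂ) • cutoffMul (dbar r χ) g N) :=
        contDiff_const.smul smooth'
      rw [dbarList_cons, dbar_cutoffMul r hχ hg, dbarList_add L smooth smooth_smul,
        dbarList_smul L _ smooth']
      simp only [Pi.add_apply, Pi.smul_apply, smul_eq_mul, mul_add, mul_left_comm (f _)]
      rw [integral_add, integral_const_mul]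
      · exact integrable_mul_dbarList hf smooth (hasCompactSupport_cutoffMul hχc _ N) L
      · exact (integrable_mul_dbarList hf smooth'
          (hasCompactSupport_cutoffMul hχc' _ N) L).const_mul _
    simp only [leibniz]
    have scale_tendsto := (continuous_ofReal.tendsto 0).comp tendsto_inv_natCast_add_one
    simpa only [Function.comp_apply, ofReal_zero, zero_mul, add_zero, dbarList_cons] using
      (ih hg' (fun L => hfg (r :: L)) hχ hχc).add (scale_tendsto.mul (ih hg hfg hχ' hχc'))

lemma integral_mul_dbarList_indexList_eq_zero {f g : (Fin n → ℂ) → ℂ} {k : Fin n → ℕ}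
    (hf : ContDiff ℝ ∞ f) (hfk : dbarPow k f = 0) (hg : ContDiff ℝ ∞ g)
    (hfg : ∀ L, Integrable fun z => f z * dbarList L g z) :
    ∫ z, f z * dbarList (indexList k) g z = 0 := by
  obtain ⟨χ, -, hχc, hχ, -, hχ_zero⟩ := exists_contDiff_tsupport_subset (n := ⊤)
    (Filter.univ_mem : (Set.univ : Set (Fin n → ℂ)) ∈ nhds 0)
  have hχ' : ContDiff ℝ ∞ fun z => (χ z : ℂ) := ofRealCLM.contDiff.comp hχ
  have hχc' : HasCompactSupport fun z => (χ z : ℂ) :=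
    hχc.comp_left (g := ((↑) : ℝ → ℂ)) ofReal_zero
  have cutoff_eq_zero (N : ℕ) :
      ∫ z, f z * dbarList (indexList k) (cutoffMul (fun z => (χ z : ℂ)) g N) z = 0 := by
    have by_parts := integral_foldr_dbar_mul (indexList k) hf (contDiff_cutoffMul hχ' hg N)
      (hasCompactSupport_cutoffMul hχc' g N)
    simp only [foldr_dbar_indexList, hfk, Pi.zero_apply, zero_mul, integral_zero] at by_parts
    exact (mul_eq_zero.1 by_parts.symm).resolve_left (pow_ne_zero _ (by norm_num))
  have limit := tendsto_integral_mul_dbarList_cutoffMul hf.continuous hg (indexList k) hfg hχ' hχc'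
  simp only [cutoff_eq_zero, hχ_zero, ofReal_one, one_mul] at limit
  exact tendsto_nhds_unique limit tendsto_const_nhds

end Cutoff

/-! ### Orthogonality of polyanalytic functions to kernels of high degree -/

section FockKernel

variable {n : ℕ}

/-- The kernel `(a z + s)^k exp(-a² |z|² - a s·z̄)`. Each `∂/∂z̄_r` raises `k_r` by one, up to a
constant factor. -/
def fockKernel (a : ℝ) (s : E n) (k : Fin n → ℕ) (z : Fin n → ℂ) : ℂ :=
  (∏ j, ((a : ℂ) * z j + s j) ^ k j) * cexp (∑ j, -(a * ((a : ℂ) * z j + s j)) * conjCoord j z)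

lemma contDiff_fockKernel (a : ℝ) (s : E n) (k : Fin n → ℕ) : ContDiff ℝ ∞ (fockKernel a s k) := by
  unfold fockKernel
  fun_prop

lemma dbar_fockKernel_exponent (a : ℝ) (s : E n) (r : Fin n) (z : Fin n → ℂ) :
    dbar r (fun z => ∑ j, -(a * ((a : ℂ) * z j + s j)) * conjCoord j z) z =
      -(a * ((a : ℂ) * z r + s r)) := by
  have holomorphic (j : Fin n) :
      DifferentiableAt ℂ (fun z : Fin n → ℂ => -(a * ((a : ℂ) * z j + s j))) z := by fun_prop
  have dbar_term (j : Fin n) : dbar r (fun z => -(a * ((a : ℂ) * z j + s j)) * conjCoord j z) z =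
      if j = r then -(a * ((a : ℂ) * z j + s j)) else 0 := by
    rw [dbar_mul r ((holomorphic j).restrictScalars ℝ) (conjCoord j).differentiableAt,
      dbar_eq_zero_of_differentiableAt r (holomorphic j), dbar_conjCoord, zero_mul, zero_add,
      mul_ite, mul_one, mul_zero]
  rw [dbar_sum r _ fun j => by fun_prop]
  simp only [dbar_term, Finset.sum_ite_eq', Finset.mem_univ, if_true]

lemma prod_pow_add_single {R : Type*} [CommMonoid R] (x : Fin n → R) (k : Fin n → ℕ) (r : Fin n) :
    ∏ j, x j ^ (k + Pi.single r 1 : Fin n → ℕ) j = (∏ j, x j ^ k j) * x r := by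
  simp only [Pi.add_apply, pow_add, Finset.prod_mul_distrib, Pi.single_apply, pow_ite, pow_one,
    pow_zero, Finset.prod_ite_eq', Finset.mem_univ, if_true]

lemma dbar_fockKernel (a : ℝ) (s : E n) (k : Fin n → ℕ) (r : Fin n) :
    dbar r (fockKernel a s k) = (-a : ℂ) • fockKernel a s (k + Pi.single r 1) := by
  funext z
  have holomorphic :
      DifferentiableAt ℂ (fun z : Fin n → ℂ => ∏ j, ((a : ℂ) * z j + s j) ^ k j) z := by fun_prop
  unfold fockKernel
  rw [dbar_mul r (holomorphic.restrictScalars ℝ) (by fun_prop),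
    dbar_eq_zero_of_differentiableAt r holomorphic, dbar_cexp r (by fun_prop),
    dbar_fockKernel_exponent, Pi.smul_apply, prod_pow_add_single, smul_eq_mul]
  ring

lemma dbarList_fockKernel (a : ℝ) (s : E n) (k : Fin n → ℕ) (L : List (Fin n)) :
    dbarList L (fockKernel a s k) = (-a : ℂ) ^ L.length •
      fockKernel a s (k + (L.map fun r => (Pi.single r 1 : Fin n → ℕ)).sum) := by
  induction L generalizing k with
  | nil => simp only [dbarList_nil, List.length_nil, pow_zero, List.map_nil, List.sum_nil, add_zero,
      one_smul]
  | cons r L ih =>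
    rw [dbarList_cons, dbar_fockKernel, dbarList_smul L _ (contDiff_fockKernel a s _), ih,
      List.map_cons, List.sum_cons, List.length_cons, smul_smul, pow_succ', add_assoc]

lemma exists_le_sum_eq {k : Fin n → ℕ} {m : ℕ} (hk : m ≤ ∑ r, k r) :
    ∃ k' ≤ k, ∑ r, k' r = m := by
  obtain ⟨l, hlk, hlm⟩ := Finsupp.exists_le_degree_eq (Finsupp.equivFunOnFinite.symm k) m
    (by simpa [Finsupp.degree_eq_sum] using hk)
  exact ⟨l, hlk, by simpa [Finsupp.degree_eq_sum] using hlm⟩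

lemma integral_mul_fockKernel_eq_zero {m : ℕ} {a : ℝ} {s : E n} {f : (Fin n → ℂ) → ℂ} (ha : a ≠ 0)
    (hf : IsPolyanalytic m f) (hint : ∀ k, Integrable fun z => f z * fockKernel a s k z)
    {k : Fin n → ℕ} (hk : m ≤ ∑ r, k r) : ∫ z, f z * fockKernel a s k z = 0 := by
  obtain ⟨l, hlk, hlm⟩ := exists_le_sum_eq hk
  have h_int (L : List (Fin n)) :
      Integrable fun z => f z * dbarList L (fockKernel a s (k - l)) z := by
    simp only [dbarList_fockKernel, Pi.smul_apply, smul_eq_mul, mul_left_comm (f _)]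
    exact (hint _).const_mul _
  have h_zero := integral_mul_dbarList_indexList_eq_zero hf.1 (hf.2 l hlm)
    (contDiff_fockKernel a s (k - l)) h_int
  simp only [dbarList_fockKernel, sum_map_single_indexList, tsub_add_cancel_of_le hlk,
    Pi.smul_apply, smul_eq_mul, mul_left_comm (f _), integral_const_mul] at h_zero
  exact (mul_eq_zero.1 h_zero).resolve_left (pow_ne_zero _ (by simpa using ha))

end FockKernel

/-! ### The change of variables `z = (x + i y)/√α` -/

section ChangeOfVariables

variable {n : ℕ}

lemma integral_exp_neg_mul_sum_norm_sq {α : ℝ} (hα : 0 < α) :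
    ∫ z : Fin n → ℂ, Real.exp (-α * ∑ r, ‖z r‖ ^ 2) = (Real.pi / α) ^ n := by
  simp only [Finset.mul_sum, Real.exp_sum]
  rw [integral_fintype_prod_volume_eq_prod (fun (_ : Fin n) (z : ℂ) => Real.exp (-α * ‖z‖ ^ 2)),
    GaussianFourier.integral_rexp_neg_mul_sq_norm hα]
  simp [div_pow]

lemma integral_exp_neg_norm_sq_muTilde (n : ℕ) :
    ∫ x : E n, Real.exp (-‖x‖ ^ 2) ∂(muTilde n) = (1 / 2 : ℝ) ^ ((n : ℝ) / 2) := by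
  have gaussian_integral := GaussianFourier.integral_rexp_neg_mul_sq_norm (V := E n) one_pos
  simp only [neg_mul, one_mul, div_one, finrank_euclideanSpace, Fintype.card_fin]
    at gaussian_integral
  rw [muTilde, integral_smul_measure, ENNReal.toReal_ofReal (by positivity), gaussian_integral,
    smul_eq_mul, neg_div, Real.rpow_neg (by positivity), ← Real.inv_rpow (by positivity),
    ← Real.mul_rpow (by positivity) (by positivity)]
  congr 1
  field_simp

lemma integral_exp_neg_norm_sq_muTilde2 (n : ℕ) :
    ∫ p : E n × E n, Real.exp (-(‖p.1‖ ^ 2 + ‖p.2‖ ^ 2)) ∂(muTilde2 n) = (1 / 2) ^ n := by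
  simp only [neg_add, Real.exp_add]
  rw [integral_prod_mul (fun x : E n => Real.exp (-‖x‖ ^ 2)) (fun x : E n => Real.exp (-‖x‖ ^ 2)),
    integral_exp_neg_norm_sq_muTilde, ← Real.rpow_add (by norm_num), add_halves,
    Real.rpow_natCast]

lemma flatten_apply (α : ℝ) (f : (Fin n → ℂ) → ℂ) (p : E n × E n) :
    flatten α n f p = (((2 : ℝ) ^ ((n : ℝ) / 2) : ℝ) : ℂ) *
      cexp (-(‖p.1‖ ^ 2 : ℝ) / 2 - (‖p.2‖ ^ 2 : ℝ) / 2 - I * (inner ℝ p.1 p.2 : ℝ)) *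
        f (cpoint α p) := rfl

variable (α : ℝ) [hα : Fact (0 < α)]

-- Both sides are Haar measures, so it suffices to compare the integrals of `exp(-α |z|²)`.
lemma map_cpoint (n : ℕ) :
    (muTilde2 n).map (cpoint α) =
      ENNReal.ofReal ((α / (2 * Real.pi)) ^ n) • (volume : Measure (Fin n → ℂ)) := by
  have hα' := hα.out
  have : ((muTilde2 n).map (cpoint α)).IsAddHaarMeasure :=
    (cpointEquiv α n).isAddHaarMeasure_map (muTilde2 n)
  have proportional := Measure.isAddLeftInvariant_eq_smul ((muTilde2 n).map (cpoint α)) volume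
  set κ := Measure.addHaarScalarFactor ((muTilde2 n).map (cpoint α)) volume
  have gaussian_integral :
      ∫ z, Real.exp (-α * ∑ r, ‖z r‖ ^ 2) ∂((muTilde2 n).map (cpoint α)) = (1 / 2) ^ n := by
    rw [integral_map (continuous_cpoint α n).aemeasurable
      (Continuous.aestronglyMeasurable (by fun_prop)), ← integral_exp_neg_norm_sq_muTilde2]
    simp only [neg_mul, norm_cpoint]
  rw [proportional, integral_smul_nnreal_measure, integral_exp_neg_mul_sum_norm_sq hα',
    NNReal.smul_def, smul_eq_mul] at gaussian_integral
  have factor_eq : (κ : ℝ) = (α / (2 * Real.pi)) ^ n := by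
    have pos : (Real.pi / α) ^ n ≠ 0 := by positivity
    rw [← mul_left_inj' pos, gaussian_integral, ← mul_pow]
    congr 1
    field_simp
  rw [proportional, ← factor_eq, ENNReal.ofReal_coe_nnreal]
  rfl

lemma measurableEmbedding_cpoint (n : ℕ) :
    MeasurableEmbedding (cpoint α : E n × E n → Fin n → ℂ) :=
  (cpointEquiv α n).toHomeomorph.measurableEmbedding

lemma integral_comp_cpoint {F : Type*} [NormedAddCommGroup F] [NormedSpace ℝ F]
    (g : (Fin n → ℂ) → F) :
    ∫ p, g (cpoint α p) ∂(muTilde2 n) = ((α / (2 * Real.pi)) ^ n) • ∫ z, g z := by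
  have hα' := hα.out
  rw [← (measurableEmbedding_cpoint α n).integral_map g, map_cpoint, integral_smul_measure,
    ENNReal.toReal_ofReal (by positivity)]

lemma integrable_comp_cpoint {F : Type*} [NormedAddCommGroup F] {g : (Fin n → ℂ) → F} :
    Integrable (fun p => g (cpoint α p)) (muTilde2 n) ↔ Integrable g := by
  have hα' := hα.out
  have factor_ne_zero : ENNReal.ofReal ((α / (2 * Real.pi)) ^ n) ≠ 0 := by
    rw [Ne, ENNReal.ofReal_eq_zero, not_le]
    positivity
  rw [← integrable_smul_measure (f := g) (μ := volume) factor_ne_zero ENNReal.ofReal_ne_top,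
    ← map_cpoint, (measurableEmbedding_cpoint α n).integrable_map_iff]
  rfl

lemma two_rpow_half_sq (n : ℕ) : ((2 : ℝ) ^ ((n : ℝ) / 2)) ^ 2 = 2 ^ n := by
  rw [← Real.rpow_natCast, ← Real.rpow_mul zero_le_two, ← Real.rpow_natCast, Nat.cast_two,
    div_mul_cancel₀ _ two_ne_zero]

lemma norm_flatten (f : (Fin n → ℂ) → ℂ) (p : E n × E n) :
    ‖flatten α n f p‖ = (2 : ℝ) ^ ((n : ℝ) / 2) *
      (‖f (cpoint α p)‖ * Real.exp (-(α / 2) * ∑ r, ‖cpoint α p r‖ ^ 2)) := by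
  have re_exponent : (-(‖p.1‖ ^ 2 : ℝ) / 2 - (‖p.2‖ ^ 2 : ℝ) / 2 -
      I * (inner ℝ p.1 p.2 : ℝ) : ℂ).re = -(α / 2) * ∑ r, ‖cpoint α p r‖ ^ 2 := by
    simp only [sub_re, mul_re, I_re, I_im, ofReal_re, ofReal_im, neg_re, div_ofNat_re]
    linear_combination (1 / 2) * norm_cpoint α p
  rw [flatten_apply, norm_mul, norm_mul, norm_exp, re_exponent, norm_real,
    Real.norm_of_nonneg (by positivity)]
  ring

lemma norm_sq_flatten (f : (Fin n → ℂ) → ℂ) (p : E n × E n) :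
    ‖flatten α n f p‖ ^ 2 = 2 ^ n *
      (Real.exp (-α * ∑ r, ‖cpoint α p r‖ ^ 2) * ‖f (cpoint α p)‖ ^ 2) := by
  rw [norm_flatten, mul_pow, mul_pow, two_rpow_half_sq, ← Real.exp_nat_mul,
    mul_comm (‖f _‖ ^ 2)]
  ring_nf

lemma memLp_gaussian_of_memLp_flatten {f : (Fin n → ℂ) → ℂ} (hf : Continuous f)
    (h : MemLp (flatten α n f) 2 (muTilde2 n)) : MemLp f 2 (gaussian α n) := by
  have hα' := hα.out
  rw [memLp_two_iff_integrable_sq_norm h.1] at h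
  simp only [norm_sq_flatten] at h
  rw [integrable_comp_cpoint α
    (g := fun z => 2 ^ n * (Real.exp (-α * ∑ r, ‖z r‖ ^ 2) * ‖f z‖ ^ 2))] at h
  rw [memLp_two_iff_integrable_sq_norm hf.aestronglyMeasurable, gaussian,
    integrable_withDensity_iff_integrable_smul' (by fun_prop)
      (.of_forall fun _ => ENNReal.ofReal_lt_top)]
  refine (h.const_mul ((α ^ n / Real.pi ^ n) / 2 ^ n)).congr (.of_forall fun z => ?_)
  dsimp only
  rw [ENNReal.toReal_ofReal (by positivity), smul_eq_mul]
  field_simp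

lemma integral_norm_sq_flatten (f : (Fin n → ℂ) → ℂ) :
    ∫ p, ‖flatten α n f p‖ ^ 2 ∂(muTilde2 n) = ∫ z, ‖f z‖ ^ 2 ∂(gaussian α n) := by
  have hα' := hα.out
  simp only [norm_sq_flatten]
  rw [integral_comp_cpoint α
    (fun z => 2 ^ n * (Real.exp (-α * ∑ r, ‖z r‖ ^ 2) * ‖f z‖ ^ 2)), gaussian,
    integral_withDensity_eq_integral_toReal_smul₀ (Measurable.aemeasurable (by fun_prop))
      (.of_forall fun _ => ENNReal.ofReal_lt_top), ← integral_smul]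
  refine integral_congr_ae (.of_forall fun z => ?_)
  dsimp only
  rw [ENNReal.toReal_ofReal (by positivity), smul_eq_mul, smul_eq_mul, div_pow, mul_pow]
  field_simp

end ChangeOfVariables

section HermiteWave

variable (b : ℝ) (w : ℂ)

/-- The function `p((ξ + b)/√2) exp(i w ξ) exp(-ξ²/2)`, with complex frequency `w`: the one-variable
factor of the integrand in the inverse partial transform of a Gaussian multiple of `q_{k,ξ}`. -/
def hermiteWave (p : Polynomial ℝ) (ξ : ℝ) : ℂ :=
  ((p.eval ((ξ + b) / Real.sqrt 2) : ℝ) : ℂ) * cexp (I * w * ξ) *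
    (Real.exp (-(1 / 2) * ‖ξ‖ ^ 2) : ℂ)

lemma integrable_mul_hermiteWave (p : Polynomial ℝ) {f : ℝ → ℂ} (hf : HasExpGrowth f) :
    Integrable fun ξ => f ξ * hermiteWave b w p ξ := by
  have growth_affine : HasExpGrowth fun ξ : ℝ => (((ξ + b) / Real.sqrt 2 : ℝ) : ℂ) := by
    simp only [div_eq_inv_mul, mul_add, ofReal_mul, ofReal_add]
    exact ((HasExpGrowth.const _).mul (.of_clm ofRealCLM)).add (.const _)
  have growth_exp : HasExpGrowth fun ξ : ℝ => cexp (I * w * ξ) :=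
    .cexp_clm ((I * w) • ofRealCLM)
  refine ((hf.mul ((growth_affine.eval p).mul growth_exp)).integrable_gaussian
    one_half_pos).congr (.of_forall fun ξ => ?_)
  simp only [hermiteWave, mul_assoc]

lemma integrable_hermiteWave (p : Polynomial ℝ) : Integrable (hermiteWave b w p) := by
  simpa only [one_mul] using integrable_mul_hermiteWave b w p (.const 1)

/-- The derivative of `hermiteWave b w p`. -/
def hermiteWaveDeriv (p : Polynomial ℝ) (ξ : ℝ) : ℂ :=
  (Real.sqrt 2 : ℂ)⁻¹ * hermiteWave b w (Polynomial.derivative p) ξ +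
    (I * w - ξ) * hermiteWave b w p ξ

lemma integrable_hermiteWaveDeriv (p : Polynomial ℝ) : Integrable (hermiteWaveDeriv b w p) := by
  have growth : HasExpGrowth fun ξ : ℝ => I * w - ξ := by
    simp only [sub_eq_add_neg]
    exact (HasExpGrowth.const _).add (.of_clm (-ofRealCLM))
  exact ((integrable_hermiteWave b w _).const_mul _).add (integrable_mul_hermiteWave b w p growth)

lemma hasDerivAt_hermiteWave (p : Polynomial ℝ) (ξ : ℝ) :
    HasDerivAt (hermiteWave b w p) (hermiteWaveDeriv b w p ξ) ξ := by
  have deriv_eval : HasDerivAt (fun ξ : ℝ => ((p.eval ((ξ + b) / Real.sqrt 2) : ℝ) : ℂ))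
      (((Polynomial.derivative p).eval ((ξ + b) / Real.sqrt 2) * (1 / Real.sqrt 2) : ℝ) : ℂ) ξ :=
    ((p.hasDerivAt _).comp ξ (((hasDerivAt_id ξ).add_const b).div_const _)).ofReal_comp
  have deriv_exp : HasDerivAt (fun ξ : ℝ => cexp (I * w * ξ))
      (cexp (I * w * ξ) * (I * w * 1)) ξ :=
    ((hasDerivAt_id ξ).ofReal_comp.const_mul _).cexp
  have deriv_gaussian : HasDerivAt (fun ξ : ℝ => (Real.exp (-(1 / 2) * ‖ξ‖ ^ 2) : ℂ))
      ((Real.exp (-(1 / 2) * ‖ξ‖ ^ 2) * (-(1 / 2) * (2 * ξ)) : ℝ) : ℂ) ξ := by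
    simp only [Real.norm_eq_abs, sq_abs]
    simpa using (((hasDerivAt_pow 2 ξ).const_mul (-(1 / 2) : ℝ)).exp).ofReal_comp
  refine ((deriv_eval.mul deriv_exp).mul deriv_gaussian).congr_deriv ?_
  simp only [hermiteWaveDeriv, hermiteWave, Pi.mul_apply]
  push_cast
  ring

lemma ofReal_sqrt_two_mul_self : (Real.sqrt 2 : ℂ) * Real.sqrt 2 = 2 := by
  rw [← ofReal_mul, Real.mul_self_sqrt zero_le_two, ofReal_ofNat]

lemma ofReal_sqrt_two_ne_zero : (Real.sqrt 2 : ℂ) ≠ 0 :=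
  ofReal_ne_zero.2 (Real.sqrt_pos.2 zero_lt_two).ne'

lemma hermiteWave_hermitePoly_succ (k : ℕ) (ξ : ℝ) :
    hermiteWave b w (hermitePoly (k + 1)) ξ =
      (Real.sqrt 2 * I * (w - I * b)) * hermiteWave b w (hermitePoly k) ξ -
        Real.sqrt 2 * hermiteWaveDeriv b w (hermitePoly k) ξ := by
  have two_mul_div : (2 : ℂ) * ((ξ + b) / (Real.sqrt 2 : ℂ)) = Real.sqrt 2 * (ξ + b) := by
    rw [← ofReal_sqrt_two_mul_self]
    field_simp [ofReal_sqrt_two_ne_zero]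
  simp only [hermiteWaveDeriv, hermiteWave, hermitePoly_succ, Polynomial.eval_sub,
    Polynomial.eval_mul, Polynomial.eval_X, Polynomial.eval_ofNat]
  push_cast
  rw [two_mul_div]
  field_simp [ofReal_sqrt_two_ne_zero]
  linear_combination ((Real.sqrt 2 : ℂ) * b *
    (((hermitePoly k).eval ((ξ + b) / Real.sqrt 2) : ℝ) : ℂ)) * I_sq

lemma integral_hermiteWave_succ (k : ℕ) :
    ∫ ξ, hermiteWave b w (hermitePoly (k + 1)) ξ =
      (Real.sqrt 2 * I * (w - I * b)) * ∫ ξ, hermiteWave b w (hermitePoly k) ξ := by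
  have integral_deriv := integral_eq_zero_of_hasDerivAt_of_integrable
    (hasDerivAt_hermiteWave b w (hermitePoly k)) (integrable_hermiteWaveDeriv b w _)
    (integrable_hermiteWave b w _)
  simp only [hermiteWave_hermitePoly_succ]
  rw [integral_sub ((integrable_hermiteWave b w _).const_mul _)
    ((integrable_hermiteWaveDeriv b w _).const_mul _), integral_const_mul, integral_const_mul,
    integral_deriv, mul_zero, sub_zero]

lemma integral_hermiteWave_one :
    ∫ ξ, hermiteWave b w 1 ξ = (Real.sqrt (2 * Real.pi) : ℂ) * cexp (-w ^ 2 / 2) := by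
  have const_eq : (Real.sqrt (2 * Real.pi) : ℂ) = ((Real.pi : ℂ) / (1 / 2)) ^ (1 / 2 : ℂ) := by
    rw [Real.sqrt_eq_rpow, ofReal_cpow (by positivity)]
    push_cast
    congr 1
    ring
  have exponent_eq : -w ^ 2 / 2 = -w ^ 2 / (4 * (1 / 2)) := by ring
  rw [const_eq, exponent_eq, ← fourierIntegral_gaussian (b := 1 / 2) (by norm_num) w]
  refine integral_congr_ae (.of_forall fun ξ => ?_)
  simp only [hermiteWave, Polynomial.eval_one, ofReal_one, one_mul, Real.norm_eq_abs, sq_abs,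
    ofReal_exp]
  push_cast
  rfl

lemma integral_hermiteWave (k : ℕ) :
    ∫ ξ, hermiteWave b w (hermitePoly k) ξ = (Real.sqrt (2 * Real.pi) : ℂ) *
      ((Real.sqrt 2 * I * (w - I * b)) ^ k * cexp (-w ^ 2 / 2)) := by
  induction k with
  | zero => rw [pow_zero, one_mul, hermitePoly, integral_hermiteWave_one]
  | succ k ih =>
    rw [integral_hermiteWave_succ, ih]
    ring

end HermiteWave

/-! ### The Hermite coefficients of the transform of a polyanalytic function -/

section WaveKernel

variable {n : ℕ}

lemma ofReal_inner_eq_sum (x y : E n) : ((inner ℝ x y : ℝ) : ℂ) = ∑ r, (x r : ℂ) * y r := by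
  rw [real_inner_comm, PiLp.inner_apply, ofReal_sum]
  simp only [RCLike.inner_apply, conj_trivial, ofReal_mul]

lemma ofReal_norm_sq_eq_sum (x : E n) : ((‖x‖ : ℝ) : ℂ) ^ 2 = ∑ r, (x r : ℂ) ^ 2 := by
  rw [← ofReal_pow, EuclideanSpace.real_norm_sq_eq, ofReal_sum]
  simp only [ofReal_pow]

/-- The functions `exp(-|ξ|²/4 + i⟨s,ξ⟩)`, which span a dense subspace of `L²`. -/
def gaussWave (s ξ : E n) : ℂ :=
  cexp (I * (inner ℝ s ξ : ℝ)) * (Real.exp (-(1 / 4) * ‖ξ‖ ^ 2) : ℂ)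

@[fun_prop]
lemma continuous_gaussWave (s : E n) : Continuous (gaussWave s) := by
  unfold gaussWave
  fun_prop

lemma memLp_gaussWave (s : E n) : MemLp (gaussWave s) 2 (muTilde n) :=
  memLp_muTilde_iff.2
    ((HasExpGrowth.cexp_clm (I • ofRealCLM.comp (innerSL ℝ s))).memLp_gaussian (by norm_num))

lemma eq_zero_of_inner_gaussWave_eq_zero {u : Lp ℂ 2 (muTilde n)}
    (h : ∀ s : E n, inner ℂ ((memLp_gaussWave s).toLp _) u = 0) : u = 0 := by
  have memLp_exp : MemLp (fun ξ : E n => (Real.exp (-(1 / 4) * ‖ξ‖ ^ 2) : ℂ)) 2 (muTilde n) := by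
    simpa only [one_mul] using memLp_muTilde_iff.2
      ((HasExpGrowth.const (V := E n) 1).memLp_gaussian (b := 1 / 4) (by norm_num))
  have ae_zero := ae_eq_zero_of_integral_exp_eq_zero ((Lp.memLp u).integrable_mul memLp_exp)
    fun s => by
      rw [← h s, L2.inner_def]
      refine integral_congr_ae ?_
      filter_upwards [(memLp_gaussWave s).coeFn_toLp] with ξ hξ
      rw [hξ, RCLike.inner_apply, gaussWave, map_mul, conj_ofReal, ← Complex.exp_conj, map_mul,
        conj_I, conj_ofReal, Pi.mul_apply, real_inner_comm]
      ring
  refine (Lp.eq_zero_iff_ae_eq_zero).2 ?_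
  filter_upwards [ae_zero] with ξ hξ
  exact (mul_eq_zero.1 hξ).resolve_right (ofReal_ne_zero.2 (Real.exp_pos _).ne')

/-- The inverse partial transform of `exp(-|ξ|²/4 + i⟨s,ξ⟩) q_{k,ξ}(v)`. -/
def waveKernel (s : E n) (k : Fin n → ℕ) (p : E n × E n) : ℂ :=
  qkNorm k * cexp (-(‖p.2‖ ^ 2 : ℝ)) *
    ∏ r, ((Real.sqrt 2 * I * (p.1 r + s r - I * p.2 r)) ^ k r *
      cexp (-(p.1 r + s r + I * p.2 r) ^ 2 / 2))

lemma gaussWave_mul_qk_mul_cexp (s x y ξ : E n) (k : Fin n → ℕ) :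
    gaussWave s ξ * (qk k ξ y : ℂ) * cexp (I * (inner ℝ ξ x : ℝ)) =
      qkNorm k * cexp (-(‖y‖ ^ 2 : ℝ)) *
        ∏ r, hermiteWave (2 * y r) (x r + s r + I * y r) (hermitePoly (k r)) (ξ r) := by
  have exponents : I * ((inner ℝ s ξ : ℝ) : ℂ) + ((-(1 / 4) * ‖ξ‖ ^ 2 : ℝ) : ℂ) +
      ((-(‖y‖ ^ 2 + inner ℝ ξ y + ‖ξ‖ ^ 2 / 4) : ℝ) : ℂ) + I * ((inner ℝ ξ x : ℝ) : ℂ) =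
      -((‖y‖ ^ 2 : ℝ) : ℂ) + (∑ r, I * (x r + s r + I * y r) * ξ r +
        ∑ r, ((-(1 / 2) : ℝ) : ℂ) * ((‖ξ r‖ ^ 2 : ℝ) : ℂ)) := by
    simp only [Real.norm_eq_abs, sq_abs]
    push_cast
    simp only [ofReal_inner_eq_sum, ofReal_norm_sq_eq_sum, mul_add, add_mul, neg_mul,
      Finset.sum_add_distrib, Finset.sum_neg_distrib, ← Finset.mul_sum, mul_assoc,
      mul_comm (ξ _ : ℂ)]
    linear_combination (-∑ r, (y r : ℂ) * ξ r) * I_sq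
  simp only [hermiteWave, Finset.prod_mul_distrib, qk_eq, gaussWave, hermitePoint_apply,
    ofReal_mul, ofReal_prod, ofReal_exp, ← Complex.exp_sum]
  calc _ = qkNorm k * (∏ r, (((hermitePoly (k r)).eval ((ξ r + 2 * y r) / Real.sqrt 2) : ℝ) : ℂ)) *
        cexp (I * ((inner ℝ s ξ : ℝ) : ℂ) + ((-(1 / 4) * ‖ξ‖ ^ 2 : ℝ) : ℂ) +
          ((-(‖y‖ ^ 2 + inner ℝ ξ y + ‖ξ‖ ^ 2 / 4) : ℝ) : ℂ) + I * ((inner ℝ ξ x : ℝ) : ℂ)) := by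
        simp only [Complex.exp_add, ofReal_mul]
        ring
    _ = _ := by
        simp only [exponents, Complex.exp_add]
        ring

lemma two_pi_rpow_mul_sqrt_two_pi_pow (n : ℕ) :
    (2 * Real.pi) ^ (-(n : ℝ) / 2) * Real.sqrt (2 * Real.pi) ^ n = 1 := by
  rw [Real.sqrt_eq_rpow, ← Real.rpow_natCast, ← Real.rpow_mul (by positivity),
    ← Real.rpow_add (by positivity), one_div_mul_eq_div, neg_div, neg_add_cancel, Real.rpow_zero]

lemma integral_gaussWave_mul_qk (s : E n) (k : Fin n → ℕ) (p : E n × E n) :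
    ∫ ξ, gaussWave s ξ * (qk k ξ p.2 : ℂ) * cexp (I * (inner ℝ ξ p.1 : ℝ)) ∂(muTilde n) =
      waveKernel s k p := by
  have two_mul_I (w z : ℂ) : w + I * z - I * (2 * z) = w - I * z := by ring
  have normalization : (((2 * Real.pi) ^ (-(n : ℝ) / 2) : ℝ) : ℂ) *
      (Real.sqrt (2 * Real.pi) : ℂ) ^ n = 1 := by
    exact_mod_cast two_pi_rpow_mul_sqrt_two_pi_pow n
  simp only [gaussWave_mul_qk_mul_cexp]
  rw [integral_muTilde, integral_const_mul, integral_prod_coord fun r =>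
    hermiteWave (2 * p.2 r) (p.1 r + s r + I * p.2 r) (hermitePoly (k r))]
  simp only [integral_hermiteWave, ofReal_mul _ (p.2 _), ofReal_ofNat, two_mul_I]
  rw [Finset.prod_mul_distrib, Finset.prod_const, Finset.card_univ, Fintype.card_fin,
    mul_left_comm, ← mul_assoc ((_ : ℝ) : ℂ), normalization, one_mul, waveKernel]

lemma exists_fourierTensorId_waveKernel_eq_lift (s : E n) (k : Fin n → ℕ) :
    ∃ h : MemLp (waveKernel s k) 2 (muTilde2 n), fourierTensorId n (h.toLp _) =
      fiberwiseHilbertBasis_qk.lift k ((memLp_gaussWave s).toLp _) := by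
  have measurable : StronglyMeasurable fun p : E n × E n => gaussWave s p.1 * (qk k p.1 p.2 : ℂ) :=
    Continuous.stronglyMeasurable (by fun_prop)
  have inverse_transform := exists_fourierTensorId_integral_eq_toLp
    (fiberwiseHilbertBasis_qk.memLp_mul k (memLp_gaussWave s)) measurable
    (.of_forall fun v => (memLp_gaussWave s).integrable_mul (memLp_qk_left k v))
  simpa only [integral_gaussWave_mul_qk, fiberwiseHilbertBasis_qk.lift_toLp] using inverse_transform

/-- The constant relating `waveKernel` and `fockKernel`. -/
def waveConst (s : E n) (k : Fin n → ℕ) : ℂ :=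
  qkNorm k * (((2 : ℝ) ^ ((n : ℝ) / 2) : ℝ) : ℂ) * (∏ r, (-(Real.sqrt 2 * I)) ^ k r) *
    cexp (∑ r, -((s r : ℂ) ^ 2 / 2))

lemma waveConst_ne_zero (s : E n) (k : Fin n → ℕ) : waveConst s k ≠ 0 :=
  mul_ne_zero (mul_ne_zero (mul_ne_zero (ofReal_ne_zero.2 (qkNorm_ne_zero k))
    (ofReal_ne_zero.2 (by positivity))) (Finset.prod_ne_zero_iff.2 fun _ _ => pow_ne_zero _
      (neg_ne_zero.2 (mul_ne_zero ofReal_sqrt_two_ne_zero I_ne_zero)))) (Complex.exp_ne_zero _)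

lemma star_waveKernel (s : E n) (k : Fin n → ℕ) (p : E n × E n) :
    star (waveKernel s k p) = qkNorm k * (∏ r, (-(Real.sqrt 2 * I)) ^ k r) *
      (∏ r, (p.1 r + s r + I * p.2 r) ^ k r) *
        cexp (∑ r, (-(p.2 r : ℂ) ^ 2 - (p.1 r + s r - I * p.2 r) ^ 2 / 2)) := by
  have conj_factor (r : Fin n) : star ((Real.sqrt 2 * I * (p.1 r + s r - I * p.2 r)) ^ k r *
      cexp (-(p.1 r + s r + I * p.2 r) ^ 2 / 2)) = (-(Real.sqrt 2 * I)) ^ k r *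
        (p.1 r + s r + I * p.2 r) ^ k r * cexp (-((p.1 r + s r - I * p.2 r) ^ 2 / 2)) := by
    simp only [RCLike.star_def, map_mul, map_pow, conj_ofReal, ← Complex.exp_conj, map_neg,
      map_div₀, map_sub, map_add, conj_I, map_ofNat, mul_pow, neg_div]
    ring_nf
  have conj_exp : star (cexp (-(‖p.2‖ ^ 2 : ℝ))) = cexp (∑ r, -(p.2 r : ℂ) ^ 2) := by
    rw [RCLike.star_def, ← Complex.exp_conj, map_neg, conj_ofReal, ofReal_pow,
      ofReal_norm_sq_eq_sum, Finset.sum_neg_distrib]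
  have conj_qkNorm : star (qkNorm k : ℂ) = qkNorm k := conj_ofReal _
  rw [waveKernel, star_mul', star_mul', conj_qkNorm, conj_exp, star_prod]
  simp only [conj_factor, Finset.prod_mul_distrib, sub_eq_add_neg (-(_ : ℂ) ^ 2),
    Finset.sum_add_distrib, Complex.exp_add, ← Complex.exp_sum]
  ring

lemma flatten_eq_exp_sum (α : ℝ) (f : (Fin n → ℂ) → ℂ) (p : E n × E n) :
    flatten α n f p = (((2 : ℝ) ^ ((n : ℝ) / 2) : ℝ) : ℂ) *
      cexp (∑ r, (-(p.1 r : ℂ) ^ 2 / 2 - (p.2 r : ℂ) ^ 2 / 2 - I * (p.1 r * p.2 r))) *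
        f (cpoint α p) := by
  simp only [flatten_apply, ofReal_pow, ofReal_norm_sq_eq_sum, ofReal_inner_eq_sum,
    Finset.sum_sub_distrib, ← Finset.sum_div, Finset.sum_neg_distrib, ← Finset.mul_sum]

lemma sqrt_mul_cpoint {α : ℝ} (hα : 0 < α) (p : E n × E n) (r : Fin n) :
    (Real.sqrt α : ℂ) * cpoint α p r = p.1 r + I * p.2 r := by
  rw [cpoint, mul_div_cancel₀ _ (ofReal_ne_zero.2 (Real.sqrt_pos.2 hα).ne')]

lemma fockKernel_cpoint {α : ℝ} (hα : 0 < α) (s : E n) (k : Fin n → ℕ) (p : E n × E n) :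
    fockKernel (Real.sqrt α) s k (cpoint α p) = (∏ r, (p.1 r + s r + I * p.2 r) ^ k r) *
      cexp (∑ r, -(p.1 r + s r + I * p.2 r) * (p.1 r - I * p.2 r)) := by
  have sqrt_mul_conjCoord (r : Fin n) :
      (Real.sqrt α : ℂ) * conjCoord r (cpoint α p) = p.1 r - I * p.2 r := by
    have conj_eq := congrArg star (sqrt_mul_cpoint hα p r)
    simp only [star_mul', star_add, RCLike.star_def, conj_ofReal, conj_I] at conj_eq
    rw [conjCoord_apply, RCLike.star_def, conj_eq]
    ring
  simp only [fockKernel, sqrt_mul_cpoint hα, ← sqrt_mul_conjCoord, add_right_comm _ (I * _),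
    neg_mul, mul_assoc, mul_left_comm (Real.sqrt α : ℂ)]

lemma star_waveKernel_mul_flatten {α : ℝ} (hα : 0 < α) (s : E n) (k : Fin n → ℕ)
    (f : (Fin n → ℂ) → ℂ) (p : E n × E n) :
    star (waveKernel s k p) * flatten α n f p =
      waveConst s k * (f (cpoint α p) * fockKernel (Real.sqrt α) s k (cpoint α p)) := by
  have exponents : cexp (∑ r, (-(p.2 r : ℂ) ^ 2 - (p.1 r + s r - I * p.2 r) ^ 2 / 2)) *
      cexp (∑ r, (-(p.1 r : ℂ) ^ 2 / 2 - (p.2 r : ℂ) ^ 2 / 2 - I * (p.1 r * p.2 r))) =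
      cexp (∑ r, -((s r : ℂ) ^ 2 / 2)) *
        cexp (∑ r, -(p.1 r + s r + I * p.2 r) * (p.1 r - I * p.2 r)) := by
    simp only [← Complex.exp_add, ← Finset.sum_add_distrib]
    refine congrArg cexp (Finset.sum_congr rfl fun r _ => ?_)
    linear_combination (-(3 / 2) * (p.2 r : ℂ) ^ 2) * I_sq
  rw [star_waveKernel, flatten_eq_exp_sum, fockKernel_cpoint hα, waveConst]
  linear_combination (qkNorm k * (((2 : ℝ) ^ ((n : ℝ) / 2) : ℝ) : ℂ) *
    (∏ r, (-(Real.sqrt 2 * I)) ^ k r) * (∏ r, (p.1 r + s r + I * p.2 r) ^ k r) *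
      f (cpoint α p)) * exponents

variable (α : ℝ) [hα : Fact (0 < α)] {m : ℕ}

lemma integrable_mul_fockKernel (f : Fock α n m) (s : E n) (k : Fin n → ℕ) :
    Integrable fun z => f.1 z * fockKernel (Real.sqrt α) s k z := by
  obtain ⟨h, -⟩ := exists_fourierTensorId_waveKernel_eq_lift s k
  rw [← integrable_comp_cpoint α]
  refine ((h.star.integrable_mul (memLp_flatten α f.2)).const_mul (waveConst s k)⁻¹).congr
    (.of_forall fun p => ?_)
  simp only [Pi.mul_apply, Pi.star_apply]
  rw [star_waveKernel_mul_flatten hα.out, inv_mul_cancel_left₀ (waveConst_ne_zero s k)]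

lemma inner_waveKernel_flatten_eq_zero (f : Fock α n m) (s : E n) {k : Fin n → ℕ}
    (hk : m ≤ ∑ r, k r) (h : MemLp (waveKernel s k) 2 (muTilde2 n)) :
    inner ℂ (h.toLp _) ((memLp_flatten α f.2).toLp _) = 0 := by
  have inner_eq : ∀ᵐ p ∂(muTilde2 n),
      inner ℂ (h.toLp _ p) ((memLp_flatten α f.2).toLp _ p) =
        waveConst s k * (f.1 (cpoint α p) * fockKernel (Real.sqrt α) s k (cpoint α p)) := by
    filter_upwards [h.coeFn_toLp, (memLp_flatten α f.2).coeFn_toLp] with p hp hp'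
    rw [hp, hp', ← star_waveKernel_mul_flatten hα.out, RCLike.inner_apply, mul_comm,
      RCLike.star_def]
  rw [L2.inner_def, integral_congr_ae inner_eq, integral_const_mul, integral_comp_cpoint α
    (fun z => f.1 z * fockKernel (Real.sqrt α) s k z),
    integral_mul_fockKernel_eq_zero (Real.sqrt_pos.2 hα.out).ne' f.2.1
      (integrable_mul_fockKernel α f s) hk, smul_zero, mul_zero]

lemma coeff_fourierTensorId_eq_zero (g : FlatFock α n m) {k : Fin n → ℕ} (hk : m ≤ ∑ r, k r) :
    fiberwiseHilbertBasis_qk.coeff k (fourierTensorId n (FlatFock.toLp α n m g)) = 0 := by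
  obtain ⟨_, f, hf, rfl⟩ := g
  refine eq_zero_of_inner_gaussWave_eq_zero fun s => ?_
  obtain ⟨h, transform_eq⟩ := exists_fourierTensorId_waveKernel_eq_lift s k
  rw [← fiberwiseHilbertBasis_qk.inner_lift_left, ← transform_eq, inner_fourierTensorId]
  exact inner_waveKernel_flatten_eq_zero α ⟨f, hf⟩ s hk h

end WaveKernel

/-! ### Polyanalytic functions built from entire functions -/

section DbarNilpotent

variable {n : ℕ}

/-- Smooth functions annihilated by every composition of `s` Wirtinger operators. In contrast to
`IsPolyanalytic`, this notion is recursive in `s` and does not fix the order of the operators. -/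
def DbarNilpotent : ℕ → ((Fin n → ℂ) → ℂ) → Prop
  | 0, f => f = 0
  | s + 1, f => ContDiff ℝ ∞ f ∧ ∀ r, DbarNilpotent s (dbar r f)

namespace DbarNilpotent

variable {s : ℕ} {f g : (Fin n → ℂ) → ℂ}

lemma contDiff (hf : DbarNilpotent s f) : ContDiff ℝ ∞ f := by
  cases s with
  | zero => exact (show f = 0 from hf) ▸ contDiff_const
  | succ s => exact hf.1

lemma add (hf : DbarNilpotent s f) (hg : DbarNilpotent s g) : DbarNilpotent s (f + g) := by
  induction s generalizing f g with
  | zero => rw [show f = 0 from hf, show g = 0 from hg]; exact add_zero 0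
  | succ s ih =>
    refine ⟨hf.1.add hg.1, fun r => ?_⟩
    rw [dbar_add r hf.1 hg.1]
    exact ih (hf.2 r) (hg.2 r)

lemma smul (c : ℂ) (hf : DbarNilpotent s f) : DbarNilpotent s (c • f) := by
  induction s generalizing f with
  | zero => rw [show f = 0 from hf]; exact smul_zero c
  | succ s ih =>
    refine ⟨contDiff_const.smul hf.1, fun r => ?_⟩
    rw [dbar_smul r c hf.1]
    exact ih (hf.2 r)

lemma zero (s : ℕ) : DbarNilpotent s (0 : (Fin n → ℂ) → ℂ) := by
  induction s with
  | zero => rfl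
  | succ s ih =>
    refine ⟨contDiff_const, fun r => ?_⟩
    rwa [show dbar r (0 : (Fin n → ℂ) → ℂ) = 0 by
      simpa using dbar_smul r 0 (contDiff_const (c := (0 : ℂ)))]

lemma sum {ι : Type*} (t : Finset ι) {f : ι → (Fin n → ℂ) → ℂ}
    (hf : ∀ i ∈ t, DbarNilpotent s (f i)) : DbarNilpotent s (∑ i ∈ t, f i) :=
  Finset.sum_induction f (DbarNilpotent s) (fun _ _ => add) (zero s) hf

lemma mono {t : ℕ} (hf : DbarNilpotent s f) (h : s ≤ t) : DbarNilpotent t f := by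
  induction s generalizing f t with
  | zero => rw [show f = 0 from hf]; exact zero t
  | succ s ih =>
    obtain ⟨t, rfl⟩ := Nat.exists_eq_add_of_lt h
    exact ⟨hf.1, fun r => ih (hf.2 r) (Nat.le_add_right s t)⟩

lemma of_holomorphic (hf : ContDiff ℂ ∞ f) : DbarNilpotent 1 f :=
  ⟨hf.restrict_scalars ℝ, fun r => funext fun z =>
    dbar_eq_zero_of_differentiableAt r (hf.differentiable (by simp) z)⟩

lemma holomorphic_mul (hf : DbarNilpotent s f) (hg : ContDiff ℂ ∞ g) :
    DbarNilpotent s (g * f) := by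
  induction s generalizing f with
  | zero => rw [show f = 0 from hf]; exact mul_zero g
  | succ s ih =>
    have hg' : ContDiff ℝ ∞ g := hg.restrict_scalars ℝ
    have dbar_mul_eq (r) : dbar r (g * f) = g * dbar r f := by
      funext z
      refine (dbar_mul r (hg'.differentiable (by simp) z)
        (hf.1.differentiable (by simp) z)).trans ?_
      rw [dbar_eq_zero_of_differentiableAt r (hg.differentiable (by simp) z), zero_mul, zero_add,
        Pi.mul_apply]
    refine ⟨hg'.mul hf.1, fun r => ?_⟩
    rw [dbar_mul_eq]
    exact ih (hf.2 r)

lemma clm_mul (hf : DbarNilpotent s f) (ℓ : (Fin n → ℂ) →L[ℝ] ℂ) :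
    DbarNilpotent (s + 1) (⇑ℓ * f) := by
  induction s generalizing f with
  | zero =>
    rw [show f = 0 from hf, mul_zero]
    exact zero 1
  | succ s ih =>
    have dbar_mul_eq (r) : dbar r (⇑ℓ * f) = dbar r ℓ 0 • f + ⇑ℓ * dbar r f := by
      funext z
      refine (dbar_mul r ℓ.differentiableAt (hf.1.differentiable (by simp) z)).trans ?_
      rw [show dbar r ℓ z = dbar r ℓ 0 by simp only [dbar, ContinuousLinearMap.fderiv]]
      rfl
    refine ⟨ℓ.contDiff.mul hf.1, fun r => ?_⟩
    rw [dbar_mul_eq]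
    exact (hf.smul _).add (ih (hf.2 r))

lemma clm_pow_mul (hf : DbarNilpotent s f) (ℓ : (Fin n → ℂ) →L[ℝ] ℂ) (p : ℕ) :
    DbarNilpotent (s + p) (⇑ℓ ^ p * f) := by
  induction p with
  | zero => rwa [pow_zero, one_mul]
  | succ p ih =>
    rw [pow_succ', mul_assoc]
    exact ih.clm_mul ℓ

lemma prod_clm_pow_mul (hf : DbarNilpotent s f) {ι : Type*} (t : Finset ι)
    (ℓ : ι → (Fin n → ℂ) →L[ℝ] ℂ) (b : ι → ℕ) :
    DbarNilpotent (s + ∑ i ∈ t, b i) ((∏ i ∈ t, ⇑(ℓ i) ^ b i) * f) := by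
  classical
  induction t using Finset.induction_on with
  | empty => rwa [Finset.sum_empty, Finset.prod_empty, one_mul]
  | insert i t hi ih =>
    rw [Finset.prod_insert hi, Finset.sum_insert hi, mul_assoc, add_comm (b i), ← add_assoc]
    exact ih.clm_pow_mul (ℓ i) (b i)

lemma foldr_dbar (L : List (Fin n)) (hf : DbarNilpotent (s + L.length) f) :
    DbarNilpotent s (L.foldr dbar f) := by
  induction L generalizing s with
  | nil => exact hf
  | cons r L ih =>
    refine (ih (s := s + 1) ?_).2 r
    rwa [add_assoc, add_comm 1]

lemma isPolyanalytic (hf : DbarNilpotent s f) : IsPolyanalytic s f := by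
  refine ⟨hf.contDiff, fun k hk => ?_⟩
  have length_indexList : (indexList k).length = s := by
    rw [← hk, indexList, List.length_flatMap, Fin.sum_univ_def]
    simp only [List.length_replicate]
  rw [← foldr_dbar_indexList]
  refine foldr_dbar (s := 0) _ ?_
  rwa [length_indexList, zero_add]

end DbarNilpotent

end DbarNilpotent

section LaplaceIntegral

variable {E' V : Type*} [NormedAddCommGroup E'] [NormedAddCommGroup V] [NormedSpace ℂ V]

lemma norm_cexp_form_le [NormedSpace ℝ E'] (L : E' →L[ℝ] V →L[ℂ] ℂ) (ξ : E') {z : V} {R : ℝ}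
    (hz : ‖z‖ ≤ R) : ‖cexp (L ξ z)‖ ≤ Real.exp (‖L‖ * R * ‖ξ‖) := by
  rw [norm_exp, Real.exp_le_exp]
  calc (L ξ z).re ≤ ‖L ξ z‖ := re_le_norm _
    _ ≤ ‖L ξ‖ * ‖z‖ := (L ξ).le_opNorm z
    _ ≤ ‖L‖ * ‖ξ‖ * R := by
      gcongr
      exact L.le_opNorm ξ
    _ = ‖L‖ * R * ‖ξ‖ := by ring

lemma norm_mul_cexp_smul_form_le [NormedSpace ℝ E'] (L : E' →L[ℝ] V →L[ℂ] ℂ) (w : ℂ) (ξ : E')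
    {z : V} {R : ℝ} (hz : ‖z‖ ≤ R) :
    ‖(w * cexp (L ξ z)) • L ξ‖ ≤ ‖L‖ * (‖w‖ * ‖ξ‖ * Real.exp (‖L‖ * R * ‖ξ‖)) := by
  rw [norm_smul, norm_mul]
  calc ‖w‖ * ‖cexp (L ξ z)‖ * ‖L ξ‖
      ≤ ‖w‖ * Real.exp (‖L‖ * R * ‖ξ‖) * (‖L‖ * ‖ξ‖) := by
        gcongr
        exacts [norm_cexp_form_le L ξ hz, L.le_opNorm ξ]
    _ = _ := by ring

variable [MeasurableSpace E'] {μ : Measure E'} {W g : E' → ℂ}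

/-- Weights with finite exponential moments of all orders: those whose Fourier–Laplace integrals
converge everywhere. -/
def HasExpMoments (μ : Measure E') (W : E' → ℂ) : Prop :=
  ∀ M : ℝ, Integrable (fun ξ => W ξ * (Real.exp (M * ‖ξ‖) : ℂ)) μ

namespace HasExpMoments

lemma integrable (hW : HasExpMoments μ W) : Integrable W μ := by
  simpa only [zero_mul, Real.exp_zero, ofReal_one, mul_one] using hW 0

lemma mul [OpensMeasurableSpace E'] [SecondCountableTopology E'] (hW : HasExpMoments μ W)
    (hg : HasExpGrowth g) : HasExpMoments μ (W * g) := by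
  obtain ⟨continuous_g, C, a, -, -, norm_g_le⟩ := hg
  intro M
  refine ((hW (a + M)).norm.const_mul C).mono' ((hW.integrable.aestronglyMeasurable.mul
    continuous_g.aestronglyMeasurable).mul (by fun_prop)) (.of_forall fun ξ => ?_)
  simp only [Pi.mul_apply, norm_mul, norm_real, Real.norm_of_nonneg (Real.exp_pos _).le, add_mul,
    Real.exp_add]
  calc ‖W ξ‖ * ‖g ξ‖ * Real.exp (M * ‖ξ‖)
      ≤ ‖W ξ‖ * (C * Real.exp (a * ‖ξ‖)) * Real.exp (M * ‖ξ‖) := by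
        gcongr
        exact norm_g_le ξ
    _ = C * (‖W ξ‖ * (Real.exp (a * ‖ξ‖) * Real.exp (M * ‖ξ‖))) := by ring

lemma integrable_norm_mul_exp [OpensMeasurableSpace E'] (hW : HasExpMoments μ W) (M : ℝ) :
    Integrable (fun ξ => ‖W ξ‖ * ‖ξ‖ * Real.exp (M * ‖ξ‖)) μ := by
  refine (hW (1 + M)).norm.mono' (hW.integrable.aestronglyMeasurable.norm.mul (by fun_prop)
    |>.mul (by fun_prop)) (.of_forall fun ξ => ?_)
  simp only [norm_mul, norm_norm, norm_real, Real.norm_of_nonneg (Real.exp_pos _).le, add_mul,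
    one_mul, Real.exp_add, mul_assoc]
  gcongr
  linarith [Real.add_one_le_exp ‖ξ‖]

end HasExpMoments

variable [NormedSpace ℝ E']

/-- The Fourier–Laplace integral `z ↦ ∫ W(ξ) exp(L(ξ, z)) dμ(ξ)` of a weight `W`. -/
def laplaceIntegral (μ : Measure E') (L : E' →L[ℝ] V →L[ℂ] ℂ) (W : E' → ℂ) (z : V) : ℂ :=
  ∫ ξ, W ξ * cexp (L ξ z) ∂μ

/-- The form `L` with its second argument fixed. -/
def evalAt (L : E' →L[ℝ] V →L[ℂ] ℂ) (z : V) : E' →L[ℝ] ℂ :=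
  (ContinuousLinearMap.apply ℂ ℂ z).restrictScalars ℝ ∘L L

variable [OpensMeasurableSpace E'] [SecondCountableTopology E']

lemma HasExpMoments.integrable_mul_cexp (hW : HasExpMoments μ W) (L : E' →L[ℝ] V →L[ℂ] ℂ)
    (z : V) : Integrable (fun ξ => W ξ * cexp (L ξ z)) μ :=
  (hW.mul (.cexp_clm (evalAt L z))).integrable

lemma hasFDerivAt_laplaceIntegral (hW : HasExpMoments μ W) (L : E' →L[ℝ] V →L[ℂ] ℂ) (z₀ : V) :
    HasFDerivAt (laplaceIntegral μ L W) (∫ ξ, (W ξ * cexp (L ξ z₀)) • L ξ ∂μ) z₀ := by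
  refine hasFDerivAt_integral_of_dominated_of_fderiv_le (Metric.ball_mem_nhds z₀ one_pos)
    (F' := fun z ξ => (W ξ * cexp (L ξ z)) • L ξ)
    (.of_forall fun z => (hW.integrable_mul_cexp L z).1) (hW.integrable_mul_cexp L z₀)
    ((hW.integrable_mul_cexp L z₀).1.smul L.continuous.aestronglyMeasurable)
    (.of_forall fun ξ z hz => ?_)
    ((hW.integrable_norm_mul_exp (‖L‖ * (1 + ‖z₀‖))).const_mul ‖L‖)
    (.of_forall fun ξ z _ => ?_)
  · have norm_z_le : ‖z‖ ≤ 1 + ‖z₀‖ :=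
      (norm_lt_of_mem_ball hz).le.trans_eq (add_comm _ _)
    exact norm_mul_cexp_smul_form_le L (W ξ) ξ norm_z_le
  · simpa only [smul_smul] using ((L ξ).hasFDerivAt (x := z)).cexp.const_mul (W ξ)

lemma fderiv_laplaceIntegral_apply (hW : HasExpMoments μ W) (L : E' →L[ℝ] V →L[ℂ] ℂ) (z w : V) :
    fderiv ℂ (laplaceIntegral μ L W) z w = laplaceIntegral μ L (W * evalAt L w) z := by
  have integrable_deriv : Integrable (fun ξ => (W ξ * cexp (L ξ z)) • L ξ) μ :=
    ((hW.integrable_norm_mul_exp (‖L‖ * ‖z‖)).const_mul ‖L‖).mono'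
      ((hW.integrable_mul_cexp L z).1.smul L.continuous.aestronglyMeasurable)
      (.of_forall fun ξ => norm_mul_cexp_smul_form_le L (W ξ) ξ le_rfl)
  rw [(hasFDerivAt_laplaceIntegral hW L z).fderiv,
    ContinuousLinearMap.integral_apply integrable_deriv, laplaceIntegral]
  exact integral_congr_ae (.of_forall fun ξ => mul_right_comm _ _ _)

lemma contDiff_laplaceIntegral [FiniteDimensional ℂ V] (hW : HasExpMoments μ W)
    (L : E' →L[ℝ] V →L[ℂ] ℂ) : ContDiff ℂ ∞ (laplaceIntegral μ L W) := by
  rw [contDiff_infty]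
  intro N
  induction N generalizing W with
  | zero =>
    exact contDiff_zero.2 (continuous_iff_continuousAt.2 fun z =>
      (hasFDerivAt_laplaceIntegral hW L z).continuousAt)
  | succ N ih =>
    rw [Nat.cast_succ, contDiff_succ_iff_fderiv_apply]
    refine ⟨fun z => (hasFDerivAt_laplaceIntegral hW L z).differentiableAt, by simp, fun w => ?_⟩
    simp only [fderiv_laplaceIntegral_apply hW L]
    exact ih (hW.mul (.of_clm (evalAt L w)))

end LaplaceIntegral

/-! ### The preimages of the Hermite lifts -/

section FockLift

variable {n : ℕ}

lemma prod_eval_add_eq_sum {ι R : Type*} [Fintype ι] [DecidableEq ι] [CommSemiring R]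
    {p : ι → Polynomial R} {k : ι → ℕ} (hp : ∀ i, (p i).natDegree ≤ k i) (x y : ι → R) :
    ∏ i, (p i).eval (y i + x i) = ∑ b ∈ Fintype.piFinset fun i => Finset.range (k i + 1),
      (∏ i, y i ^ b i) * ∏ i, (Polynomial.hasseDeriv (b i) (p i)).eval (x i) := by
  have eval_add (i) : (p i).eval (y i + x i) = ∑ j ∈ Finset.range (k i + 1),
      y i ^ j * (Polynomial.hasseDeriv j (p i)).eval (x i) := by
    rw [← Polynomial.taylor_eval, Polynomial.eval_eq_sum_range' (n := k i + 1)
      (by rw [Polynomial.natDegree_taylor]; exact Nat.lt_succ_of_le (hp i))]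
    exact Finset.sum_congr rfl fun j _ => by rw [Polynomial.taylor_coeff, mul_comm]
  simp only [eval_add, Finset.prod_univ_sum, Finset.prod_mul_distrib]

/-- The coefficients of the expansion of `∏_r H_{k_r}((ξ_r + 2 y_r) / √2)` in powers of `√2 y`. -/
def hermiteTaylor (k b : Fin n → ℕ) (ξ : E n) : ℝ :=
  ∏ r, (Polynomial.hasseDeriv (b r) (hermitePoly (k r))).eval (hermitePoint ξ 0 r)

lemma prod_hermitePoly_hermitePoint (k : Fin n → ℕ) (ξ y : E n) :
    ∏ r, (hermitePoly (k r)).eval (hermitePoint ξ y r) =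
      ∑ b ∈ Fintype.piFinset fun r => Finset.range (k r + 1),
        (∏ r, (Real.sqrt 2 * y r) ^ b r) * hermiteTaylor k b ξ := by
  have hermitePoint_eq (r) : hermitePoint ξ y r = Real.sqrt 2 * y r + hermitePoint ξ 0 r := by
    simp only [hermitePoint, smul_zero, add_zero, PiLp.add_apply, PiLp.smul_apply, smul_eq_mul,
      add_comm]
  simp only [hermitePoint_eq, hermiteTaylor]
  exact prod_eval_add_eq_sum (fun r => Polynomial.natDegree_le_of_degree_le
    (degree_hermitePoly (k r)).le) _ _

lemma hasExpGrowth_hermiteTaylor (k b : Fin n → ℕ) :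
    HasExpGrowth fun ξ => (hermiteTaylor k b ξ : ℂ) := by
  simp only [hermiteTaylor, ofReal_prod]
  refine .prod _ fun r => HasExpGrowth.eval ?_ _
  simp only [hermitePoint, smul_zero, add_zero]
  exact .of_clm_real ((Real.sqrt 2)⁻¹ • EuclideanSpace.proj r : E n →L[ℝ] ℝ)

lemma hasExpMoments_mul_gaussian {c : E n → ℂ} (hc : MemLp c 2 (muTilde n)) {b : ℝ} (hb : 0 < b) :
    HasExpMoments (muTilde n) fun ξ => c ξ * (Real.exp (-b * ‖ξ‖ ^ 2) : ℂ) := fun M => by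
  refine (hc.integrable_mul (memLp_muTilde_iff.2
    ((HasExpGrowth.exp_norm M).memLp_gaussian hb))).congr (.of_forall fun ξ => ?_)
  simp only [Pi.mul_apply]
  ring

/-- The form `(ξ, z) ↦ i a ∑ ξ_r z_r`. -/
def waveForm (n : ℕ) (a : ℝ) : E n →L[ℝ] (Fin n → ℂ) →L[ℂ] ℂ :=
  ∑ r, (ofRealCLM.comp (EuclideanSpace.proj r : E n →L[ℝ] ℝ)).smulRight
    ((I * a : ℂ) • (ContinuousLinearMap.proj r : (Fin n → ℂ) →L[ℂ] ℂ))

lemma waveForm_apply (a : ℝ) (ξ : E n) (z : Fin n → ℂ) :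
    waveForm n a ξ z = I * ∑ r, (ξ r : ℂ) * (a * z r) := by
  simp only [waveForm, sum_apply, ContinuousLinearMap.smulRight_apply,
    smul_apply, ContinuousLinearMap.comp_apply, Finset.mul_sum, smul_eq_mul,
    ContinuousLinearMap.proj_apply, ofRealCLM_apply, PiLp.proj_apply]
  exact Finset.sum_congr rfl fun r _ => by ring

lemma waveForm_cpoint {α : ℝ} (hα : 0 < α) (ξ : E n) (p : E n × E n) :
    waveForm n (Real.sqrt α) ξ (cpoint α p) =
      I * (inner ℝ ξ p.1 : ℝ) - (inner ℝ ξ p.2 : ℝ) := by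
  simp only [waveForm_apply, sqrt_mul_cpoint hα, ofReal_inner_eq_sum, Finset.mul_sum,
    ← Finset.sum_sub_distrib]
  refine Finset.sum_congr rfl fun r _ => ?_
  linear_combination ((ξ r : ℂ) * (p.2 r : ℂ)) * I_sq

/-- The Fock function `f` for which `(F ⊗ I)(U f)` is `c(ξ) q_{k,ξ}(v)`: a polynomial in `Im z`
with entire coefficients, obtained by inverting the partial Fourier transform. -/
def fockLift (α : ℝ) (k : Fin n → ℕ) (c : E n → ℂ) (z : Fin n → ℂ) : ℂ :=
  ((((2 : ℝ) ^ ((n : ℝ) / 2))⁻¹ * qkNorm k : ℝ) : ℂ) *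
    cexp (∑ r, ((Real.sqrt α : ℂ) * z r) ^ 2 / 2) *
    ∑ b ∈ Fintype.piFinset fun r => Finset.range (k r + 1),
      (∏ r, ((Real.sqrt 2 * (Real.sqrt α * (z r).im) : ℝ) : ℂ) ^ b r) *
        laplaceIntegral (muTilde n) (waveForm n (Real.sqrt α))
          (fun ξ => c ξ * (Real.exp (-(1 / 4) * ‖ξ‖ ^ 2) : ℂ) * hermiteTaylor k b ξ) z

lemma isPolyanalytic_fockLift (α : ℝ) {m : ℕ} {k : Fin n → ℕ} (hk : ∑ r, k r < m) {c : E n → ℂ}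
    (hc : MemLp c 2 (muTilde n)) : IsPolyanalytic m (fockLift α k c) := by
  let scaledIm (r : Fin n) : (Fin n → ℂ) →L[ℝ] ℂ := ofRealCLM ∘L (Real.sqrt 2 • Real.sqrt α •
    imCLM ∘L (ContinuousLinearMap.proj (φ := fun _ : Fin n => ℂ) r))
  have summand_nilpotent : ∀ b ∈ Fintype.piFinset fun r => Finset.range (k r + 1),
      DbarNilpotent m ((∏ r, ⇑(scaledIm r) ^ b r) *
        laplaceIntegral (muTilde n) (waveForm n (Real.sqrt α))
          (fun ξ => c ξ * (Real.exp (-(1 / 4) * ‖ξ‖ ^ 2) : ℂ) * hermiteTaylor k b ξ)) := by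
    intro b hb
    have sum_b_le : ∑ r, b r ≤ ∑ r, k r := Finset.sum_le_sum fun r _ =>
      Nat.lt_succ_iff.1 (Finset.mem_range.1 (Fintype.mem_piFinset.1 hb r))
    exact ((DbarNilpotent.of_holomorphic (contDiff_laplaceIntegral
      ((hasExpMoments_mul_gaussian hc (by norm_num)).mul (hasExpGrowth_hermiteTaylor k b))
      _)).prod_clm_pow_mul _ scaledIm b).mono (by omega)
  have contDiff_prefactor : ContDiff ℂ ∞ fun z : Fin n → ℂ =>
      ((((2 : ℝ) ^ ((n : ℝ) / 2))⁻¹ * qkNorm k : ℝ) : ℂ) *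
        cexp (∑ r, ((Real.sqrt α : ℂ) * z r) ^ 2 / 2) := by
    fun_prop
  convert ((DbarNilpotent.sum _ summand_nilpotent).holomorphic_mul
    contDiff_prefactor).isPolyanalytic using 1
  funext z
  simp only [fockLift, Pi.mul_apply, Finset.sum_apply, Finset.prod_apply, Pi.pow_apply]
  rfl

variable {α : ℝ} {c : E n → ℂ}

lemma flatten_gaussian_mul (hα : 0 < α) (p : E n × E n) (C A : ℂ) (f : (Fin n → ℂ) → ℂ)
    (hf : f (cpoint α p) = C * cexp (∑ r, ((Real.sqrt α : ℂ) * cpoint α p r) ^ 2 / 2) * A) :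
    flatten α n f p =
      (((2 : ℝ) ^ ((n : ℝ) / 2) : ℝ) : ℂ) * C * cexp (-(‖p.2‖ : ℂ) ^ 2) * A := by
  have exponent : ∑ r, (-(p.1 r : ℂ) ^ 2 / 2 - (p.2 r : ℂ) ^ 2 / 2 - I * (p.1 r * p.2 r)) +
      ∑ r, ((Real.sqrt α : ℂ) * cpoint α p r) ^ 2 / 2 = -(‖p.2‖ : ℂ) ^ 2 := by
    simp only [sqrt_mul_cpoint hα, ofReal_norm_sq_eq_sum, ← Finset.sum_add_distrib,
      ← Finset.sum_neg_distrib]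
    refine Finset.sum_congr rfl fun r _ => ?_
    linear_combination ((p.2 r : ℂ) ^ 2 / 2) * I_sq
  rw [flatten_eq_exp_sum, hf, ← exponent, Complex.exp_add]
  ring

lemma sum_mul_laplaceIntegral_hermiteTaylor (hα : 0 < α) (k : Fin n → ℕ)
    (hc : MemLp c 2 (muTilde n)) (p : E n × E n) :
    ∑ b ∈ Fintype.piFinset fun r => Finset.range (k r + 1),
      (∏ r, ((Real.sqrt 2 * (Real.sqrt α * (cpoint α p r).im) : ℝ) : ℂ) ^ b r) *
        laplaceIntegral (muTilde n) (waveForm n (Real.sqrt α))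
          (fun ξ => c ξ * (Real.exp (-(1 / 4) * ‖ξ‖ ^ 2) : ℂ) * hermiteTaylor k b ξ)
          (cpoint α p) =
      ∫ ξ, c ξ * (Real.exp (-(1 / 4) * ‖ξ‖ ^ 2) : ℂ) *
        ((∏ r, (hermitePoly (k r)).eval (hermitePoint ξ p.2 r) : ℝ) : ℂ) *
          cexp (I * (inner ℝ ξ p.1 : ℝ) - (inner ℝ ξ p.2 : ℝ)) ∂(muTilde n) := by
  have sqrt_mul_im (r) : Real.sqrt α * (cpoint α p r).im = p.2 r := by
    simpa using congrArg Complex.im (sqrt_mul_cpoint hα p r)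
  have integrable_summand (b : Fin n → ℕ) : Integrable (fun ξ => c ξ *
      (Real.exp (-(1 / 4) * ‖ξ‖ ^ 2) : ℂ) * hermiteTaylor k b ξ *
      cexp (waveForm n (Real.sqrt α) ξ (cpoint α p))) (muTilde n) :=
    ((hasExpMoments_mul_gaussian hc (by norm_num : (0 : ℝ) < 1 / 4)).mul
      (hasExpGrowth_hermiteTaylor k b)).integrable_mul_cexp (waveForm n (Real.sqrt α)) (cpoint α p)
  simp only [sqrt_mul_im, laplaceIntegral, ← integral_const_mul]
  rw [← integral_finsetSum _ fun b _ => (integrable_summand b).const_mul _]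
  congr with ξ
  simp only [prod_hermitePoly_hermitePoint, waveForm_cpoint hα, ofReal_sum, Finset.mul_sum,
    Finset.sum_mul, ofReal_mul, ofReal_prod, ofReal_pow]
  exact Finset.sum_congr rfl fun b _ => by ring

lemma flatten_fockLift (hα : 0 < α) (k : Fin n → ℕ) (hc : MemLp c 2 (muTilde n))
    (p : E n × E n) :
    flatten α n (fockLift α k c) p =
      ∫ ξ, c ξ * (qk k ξ p.2 : ℂ) * cexp (I * (inner ℝ ξ p.1 : ℝ)) ∂(muTilde n) := by
  have two_rpow_ne_zero : (((2 : ℝ) ^ ((n : ℝ) / 2) : ℝ) : ℂ) ≠ 0 :=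
    ofReal_ne_zero.2 (by positivity)
  rw [flatten_gaussian_mul hα p _ _ _ rfl, sum_mul_laplaceIntegral_hermiteTaylor hα k hc,
    ofReal_mul, ofReal_inv, mul_inv_cancel_left₀ two_rpow_ne_zero, ← integral_const_mul]
  congr with ξ
  have exponent : cexp (-(‖p.2‖ : ℂ) ^ 2) * cexp ((-(1 / 4) * ‖ξ‖ ^ 2 : ℝ)) *
      cexp (I * (inner ℝ ξ p.1 : ℝ) - (inner ℝ ξ p.2 : ℝ)) =
      cexp ((-(‖p.2‖ ^ 2 + inner ℝ ξ p.2 + ‖ξ‖ ^ 2 / 4) : ℝ)) *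
        cexp (I * (inner ℝ ξ p.1 : ℝ)) := by
    simp only [← Complex.exp_add]
    congr 1
    push_cast
    ring
  rw [qk_eq, ofReal_mul, ofReal_mul, ofReal_exp, ofReal_exp]
  linear_combination (c ξ * qkNorm k *
    ((∏ r, (hermitePoly (k r)).eval (hermitePoint ξ p.2 r) : ℝ) : ℂ)) * exponent

lemma exists_fourierTensorId_eq_lift (α : ℝ) [hα : Fact (0 < α)] {m : ℕ} {k : Fin n → ℕ}
    (hk : ∑ r, k r < m) (c : Lp ℂ 2 (muTilde n)) :
    ∃ g : FlatFock α n m,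
      fourierTensorId n (FlatFock.toLp α n m g) = fiberwiseHilbertBasis_qk.lift k c := by
  have hc := Lp.memLp c
  have stronglyMeasurable_lift :
      StronglyMeasurable fun p : E n × E n => c p.1 * (qk k p.1 p.2 : ℂ) :=
    ((Lp.stronglyMeasurable c).comp_measurable measurable_fst).mul
      (continuous_ofReal.comp (continuous_qk k)).stronglyMeasurable
  obtain ⟨memLp_inverse, fourierTensorId_inverse⟩ := exists_fourierTensorId_integral_eq_toLp
    (fiberwiseHilbertBasis_qk.memLp_mul k hc) stronglyMeasurable_lift
    (.of_forall fun v => hc.integrable_mul (memLp_qk_left k v))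
  simp only [← flatten_fockLift hα.out k hc] at memLp_inverse fourierTensorId_inverse
  have polyanalytic := isPolyanalytic_fockLift α hk hc
  exact ⟨⟨_, fockLift α k c, ⟨polyanalytic,
    memLp_gaussian_of_memLp_flatten α polyanalytic.1.continuous memLp_inverse⟩, rfl⟩,
    fourierTensorId_inverse⟩

end FockLift

section Enumeration

variable {n : ℕ}

lemma phi_injective (n m : ℕ) : Function.Injective (phi n m) := fun _ _ h =>
  ((J n m).orderEmbOfFin rfl).injective (ofLex.injective h)

lemma toLex_mem_J {m : ℕ} {k : Fin n → ℕ} : toLex k ∈ J n m ↔ ∑ r, k r < m := by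
  simp only [J, Finset.mem_map_equiv, Finset.mem_filter, Fintype.mem_piFinset, Finset.mem_range]
  refine ⟨fun h => h.2, fun h => ⟨fun r => ?_, h⟩⟩
  exact (Finset.single_le_sum (f := k) (fun _ _ => Nat.zero_le _) (Finset.mem_univ r)).trans_lt h

lemma sum_phi_lt {m : ℕ} (j : Fin (dim n m)) : ∑ r, phi n m j r < m :=
  toLex_mem_J.1 ((J n m).orderEmbOfFin_mem rfl j)

lemma exists_phi_eq {m : ℕ} {k : Fin n → ℕ} (hk : ∑ r, k r < m) : ∃ j, phi n m j = k := by
  have mem_range : toLex k ∈ Set.range ((J n m).orderEmbOfFin rfl) := by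
    rw [Finset.range_orderEmbOfFin]
    exact toLex_mem_J.2 hk
  exact mem_range.imp fun j hj => congrArg ofLex hj

end Enumeration

/-! ### The isometric isomorphisms -/

section Isometry

variable (α : ℝ) [Fact (0 < α)] {n m : ℕ}

/-- The operator `R_{H_m} = N (F ⊗ I)` as a linear map to `L²(ℝⁿ)^d`. -/
def flatLinear (n m : ℕ) : FlatFock α n m →ₗ[ℂ] Target n m :=
  (WithLp.linearEquiv 2 ℂ _).symm.toLinearMap ∘ₗ LinearMap.pi fun j =>
    (fiberwiseHilbertBasis_qk.coeff (phi n m j)).toLinearMap ∘ₗ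
      (fourierTensorId n).toLinearMap ∘ₗ FlatFock.toLp α n m

lemma flatLinear_apply (g : FlatFock α n m) (j : Fin (dim n m)) :
    flatLinear α n m g j = fiberwiseHilbertBasis_qk.coeff (phi n m j)
      (fourierTensorId n (FlatFock.toLp α n m g)) := rfl

lemma norm_flatLinear (g : FlatFock α n m) : ‖flatLinear α n m g‖ = ‖g‖ := by
  have norm_eq : ‖g‖ = ‖fourierTensorId n (FlatFock.toLp α n m g)‖ :=
    (norm_fourierTensorId _).symm
  rw [norm_eq, ← sq_eq_sq₀ (norm_nonneg _) (norm_nonneg _), PiLp.norm_sq_eq_of_L2,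
    fiberwiseHilbertBasis_qk.norm_sq_eq_sum_coeff
      (s := Finset.univ.map ⟨phi n m, phi_injective n m⟩), Finset.sum_map]
  · rfl
  · intro k hk
    refine coeff_fourierTensorId_eq_zero α g (not_lt.1 fun h => hk ?_)
    obtain ⟨j, rfl⟩ := exists_phi_eq h
    exact Finset.mem_map_of_mem _ (Finset.mem_univ j)

lemma flatLinear_surjective (n m : ℕ) : Function.Surjective (flatLinear α n m) := fun t => by
  choose g hg using fun j => exists_fourierTensorId_eq_lift α (sum_phi_lt j) (t j)
  refine ⟨∑ j, g j, PiLp.ext fun i => ?_⟩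
  rw [flatLinear_apply]
  simp only [map_sum, hg, FiberwiseHilbertBasis.coeff_lift, (phi_injective n m).eq_iff,
    Finset.sum_ite_eq, Finset.mem_univ, if_true]

/-- The operator `R_{H_m}` as an isometric isomorphism. -/
def flatIsometry (n m : ℕ) : FlatFock α n m ≃ₗᵢ[ℂ] Target n m :=
  LinearIsometryEquiv.ofSurjective ⟨flatLinear α n m, norm_flatLinear α⟩
    (flatLinear_surjective α n m)

lemma flatIsometry_ae_eq (g : FlatFock α n m) (j : Fin (dim n m)) :
    flatIsometry α n m g j =ᵐ[muTilde n] fun ξ => RFlat α g ξ j := by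
  filter_upwards [fiberwiseHilbertBasis_qk.coeff_ae_eq (phi n m j)
    (fourierTensorId n (FlatFock.toLp α n m g))] with ξ hξ
  refine hξ.symm.trans (integral_congr_ae (.of_forall fun v => ?_))
  simp only [q_eq_qk, star_def, conj_ofReal, mul_comm]

lemma norm_U (f : Fock α n m) : ‖U α n m f‖ = ‖f‖ := by
  rw [← sq_eq_sq₀ (norm_nonneg _) (norm_nonneg _)]
  exact (integral_norm_sq_eq_norm_toLp_sq (memLp_flatten α f.2)).symm.trans
    ((integral_norm_sq_flatten α f.1).trans (integral_norm_sq_eq_norm_toLp_sq f.2.2))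

/-- The operator `U : F_{α,m} → H_m` as an isometric isomorphism. -/
def flattenIsometry (n m : ℕ) : Fock α n m ≃ₗᵢ[ℂ] FlatFock α n m :=
  LinearIsometryEquiv.ofSurjective ⟨U α n m, norm_U α⟩
    ((flatten α n).submoduleMap_surjective (Fock α n m))

end Isometry

/-! ### The integral formulas -/

section IntegralFormulas

variable {n m : ℕ}

lemma exists_norm_qk_le (k : Fin n → ℕ) : ∃ C, ∀ ξ v, ‖(qk k ξ v : ℂ)‖ ≤ C := by
  obtain ⟨C, hC, norm_le⟩ := ((HasExpGrowth.const (hermiteNorm k)).mul (hasExpGrowth_prod_eval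
    fun r => hermitePoly (k r))).exists_norm_mul_gaussian_le one_half_pos
  refine ⟨(2 : ℝ) ^ ((n : ℝ) / 2) * Real.pi ^ ((n : ℝ) / 4) * C, fun ξ v => ?_⟩
  rw [qk, ofReal_mul, norm_mul, norm_real, Real.norm_of_nonneg (by positivity), multiHermite_eq,
    ofReal_mul, ofReal_mul, ofReal_prod]
  gcongr
  refine (norm_le (hermitePoint ξ v)).trans (mul_le_of_le_one_right hC (Real.exp_le_one_iff.2 ?_))
  exact mul_nonpos_of_nonpos_of_nonneg (by norm_num) (sq_nonneg _)

lemma integrable_mul_exp_mul_qk {ν : Measure (E n × E n)} {g : E n × E n → ℂ}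
    (hg : Integrable g ν) (ξ : E n) (k : Fin n → ℕ) :
    Integrable (fun p => g p * cexp (-I * (inner ℝ p.1 ξ : ℝ)) * (qk k ξ p.2 : ℂ)) ν := by
  obtain ⟨C, norm_qk_le⟩ := exists_norm_qk_le k
  have continuous_character : Continuous fun p : E n × E n =>
      cexp (-I * (inner ℝ p.1 ξ : ℝ)) := by fun_prop
  have continuous_qk_snd : Continuous fun p : E n × E n => (qk k ξ p.2 : ℂ) := by
    fun_prop
  have norm_character (p : E n × E n) : ‖cexp (-I * (inner ℝ p.1 ξ : ℝ))‖ ≤ 1 := by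
    rw [norm_exp]
    simp
  exact (hg.mul_bdd continuous_character.aestronglyMeasurable (.of_forall norm_character)).mul_bdd
    continuous_qk_snd.aestronglyMeasurable (.of_forall fun p => norm_qk_le ξ p.2)

lemma two_pi_rpow_mul_two_pi_rpow_mul (n : ℕ) :
    (2 * Real.pi) ^ (-(n : ℝ) / 2) * (2 * Real.pi) ^ (-(n : ℝ) / 2) *
      ((2 : ℝ) ^ ((n : ℝ) / 2) * Real.pi ^ ((n : ℝ) / 4)) =
      1 / ((2 : ℝ) ^ ((n : ℝ) / 2) * Real.pi ^ (3 * (n : ℝ) / 4)) := by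
  have hπ := Real.pi_pos
  rw [Real.mul_rpow (by norm_num) hπ.le, one_div, mul_inv, ← Real.rpow_neg (by norm_num),
    ← Real.rpow_neg hπ.le,
    show (-((n : ℝ) / 2)) = -(n : ℝ) / 2 + -(n : ℝ) / 2 + (n : ℝ) / 2 by ring,
    show -(3 * (n : ℝ) / 4) = -(n : ℝ) / 2 + -(n : ℝ) / 2 + (n : ℝ) / 4 by ring]
  simp only [Real.rpow_add hπ, Real.rpow_add (by norm_num : (0 : ℝ) < 2)]
  ring

lemma integral_fourier_slice_mul_q {g : E n × E n → ℂ} (hg : Integrable g)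
    (j : Fin (dim n m)) (ξ : E n) :
    ∫ v, (∫ u, g (u, v) * cexp (-I * (inner ℝ u ξ : ℝ)) ∂(muTilde n)) *
        (q j ξ v : ℂ) ∂(muTilde n) =
      ((1 / ((2 : ℝ) ^ ((n : ℝ) / 2) * Real.pi ^ (3 * (n : ℝ) / 4)) : ℝ) : ℂ) *
        ∫ p : E n × E n, g p * cexp (-I * (inner ℝ p.1 ξ : ℝ)) * (hermiteProd j ξ p.2 : ℂ) := by
  have fubini : ∫ v, ∫ u, g (u, v) * cexp (-I * (inner ℝ u ξ : ℝ)) * (q j ξ v : ℂ) =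
      ∫ p : E n × E n, g p * cexp (-I * (inner ℝ p.1 ξ : ℝ)) * (q j ξ p.2 : ℂ) := by
    refine (integral_prod_symm (fun p : E n × E n =>
      g p * cexp (-I * (inner ℝ p.1 ξ : ℝ)) * (q j ξ p.2 : ℂ)) ?_).symm
    simp only [q_eq_qk]
    exact integrable_mul_exp_mul_qk hg ξ (phi n m j)
  have factor_q (p : E n × E n) : g p * cexp (-I * (inner ℝ p.1 ξ : ℝ)) * (q j ξ p.2 : ℂ) =
      (((2 : ℝ) ^ ((n : ℝ) / 2) * Real.pi ^ ((n : ℝ) / 4) : ℝ) : ℂ) *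
        (g p * cexp (-I * (inner ℝ p.1 ξ : ℝ)) * (hermiteProd j ξ p.2 : ℂ)) := by
    rw [q, ofReal_mul]
    ring
  simp only [integral_muTilde, mul_assoc _ (∫ _, _ : ℂ), ← integral_mul_const]
  rw [integral_const_mul, fubini, ← two_pi_rpow_mul_two_pi_rpow_mul]
  simp only [factor_q, integral_const_mul]
  push_cast
  ring

lemma N_fourierTensorId_ae_eq_integral {g : E n × E n → ℂ} (hg₂ : MemLp g 2 (muTilde2 n))
    (hgm : StronglyMeasurable g) (hg : Integrable g) (j : Fin (dim n m)) :
    ∀ᵐ ξ : E n, N (fourierTensorId n (hg₂.toLp g)) ξ j =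
      ((1 / ((2 : ℝ) ^ ((n : ℝ) / 2) * Real.pi ^ (3 * (n : ℝ) / 4)) : ℝ) : ℂ) *
        ∫ p : E n × E n, g p * cexp (-I * (inner ℝ p.1 ξ : ℝ)) * (hermiteProd j ξ p.2 : ℂ) := by
  obtain ⟨hG, fourierTensorId_eq⟩ := exists_fourierTensorId_toLp_eq_integral hg₂ hgm
    (ae_muTilde_iff.2 (hg.prod_left_ae.mono fun v hv => integrable_muTilde_iff.2 hv))
  refine ae_muTilde_iff.1 ?_
  filter_upwards [Measure.ae_ae_of_ae_prod hG.coeFn_toLp] with ξ hξ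
  rw [N, fourierTensorId_eq, ← integral_fourier_slice_mul_q hg]
  refine integral_congr_ae ?_
  filter_upwards [hξ] with v hv
  rw [hv]

lemma flatten_mul_exp (α : ℝ) (f : (Fin n → ℂ) → ℂ) (ξ : E n) (p : E n × E n) :
    flatten α n f p * cexp (-I * (inner ℝ p.1 ξ : ℝ)) = (((2 : ℝ) ^ ((n : ℝ) / 2) : ℝ) : ℂ) *
      (f (cpoint α p) * cexp (-(‖p.1‖ ^ 2 : ℝ) / 2 - (‖p.2‖ ^ 2 : ℝ) / 2 -
        I * (inner ℝ p.1 (p.2 + ξ) : ℝ))) := by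
  have exponent : -(‖p.1‖ ^ 2 : ℝ) / 2 - (‖p.2‖ ^ 2 : ℝ) / 2 -
      I * (inner ℝ p.1 (p.2 + ξ) : ℝ) =
      (-(‖p.1‖ ^ 2 : ℝ) / 2 - (‖p.2‖ ^ 2 : ℝ) / 2 - I * (inner ℝ p.1 p.2 : ℝ)) +
        -I * (inner ℝ p.1 ξ : ℝ) := by
    rw [inner_add_right, ofReal_add]
    ring
  rw [flatten_apply, exponent, Complex.exp_add]
  ring

lemma integrable_volume_of_integrable_muTilde2 {g : E n × E n → ℂ}
    (hg : Integrable g (muTilde2 n)) : Integrable g volume := by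
  rw [Measure.volume_eq_prod, Measure.isAddLeftInvariant_eq_smul
    ((volume : Measure (E n)).prod (volume : Measure (E n))) (muTilde2 n)]
  exact hg.smul_measure_nnreal

variable (α : ℝ) [Fact (0 < α)]

lemma RFlat_ae_eq_integral (g : FlatFock α n m) (hg : Integrable g.1 volume)
    (j : Fin (dim n m)) :
    ∀ᵐ ξ : E n, RFlat α g ξ j =
      ((1 / ((2 : ℝ) ^ ((n : ℝ) / 2) * Real.pi ^ (3 * (n : ℝ) / 4)) : ℝ) : ℂ) *
        ∫ p : E n × E n, g.1 p * cexp (-I * (inner ℝ p.1 ξ : ℝ)) * (hermiteProd j ξ p.2 : ℂ) :=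
  N_fourierTensorId_ae_eq_integral (FlatFock.memLp α g)
    (FlatFock.continuous α g).stronglyMeasurable hg j

lemma integrable_flatten {f : (Fin n → ℂ) → ℂ} (hf : Continuous f)
    (hint : Integrable fun z : Fin n → ℂ => ‖f z‖ * Real.exp (-(α / 2) * ∑ r, ‖z r‖ ^ 2)) :
    Integrable (flatten α n f) (muTilde2 n) := by
  rw [← integrable_norm_iff (continuous_flatten α hf).aestronglyMeasurable]
  exact (((integrable_comp_cpoint α).2 hint).const_mul ((2 : ℝ) ^ ((n : ℝ) / 2))).congr
    (.of_forall fun p => (norm_flatten α f p).symm)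

lemma RFock_ae_eq_integral (f : Fock α n m)
    (hf : Integrable fun z : Fin n → ℂ => ‖f.1 z‖ * Real.exp (-(α / 2) * ∑ r, ‖z r‖ ^ 2))
    (j : Fin (dim n m)) :
    ∀ᵐ ξ : E n, RFock α f ξ j = ((1 / Real.pi ^ (3 * (n : ℝ) / 4) : ℝ) : ℂ) *
      ∫ p : E n × E n, f.1 (cpoint α p) *
        cexp (-(‖p.1‖ ^ 2 : ℝ) / 2 - (‖p.2‖ ^ 2 : ℝ) / 2 - I * (inner ℝ p.1 (p.2 + ξ) : ℝ)) *
          (hermiteProd j ξ p.2 : ℂ) := by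
  have integrable_U : Integrable (U α n m f).1 volume :=
    integrable_volume_of_integrable_muTilde2 (integrable_flatten α f.2.1.1.continuous hf)
  have two_rpow_ne_zero : (((2 : ℝ) ^ ((n : ℝ) / 2) : ℝ) : ℂ) ≠ 0 :=
    ofReal_ne_zero.2 (by positivity)
  filter_upwards [RFlat_ae_eq_integral α (U α n m f) integrable_U j] with ξ hξ
  have U_apply (p : E n × E n) : (U α n m f).1 p = flatten α n f.1 p := rfl
  rw [RFock, hξ]
  simp only [U_apply, flatten_mul_exp, mul_assoc, integral_const_mul]
  rw [one_div, one_div, mul_inv_rev, ofReal_mul, mul_assoc, ofReal_inv ((2 : ℝ) ^ ((n : ℝ) / 2)),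
    inv_mul_cancel_left₀ two_rpow_ne_zero]

end IntegralFormulas

end PolyFock

end

theorem mainTheorem3 (n m : ℕ) (hn : 1 ≤ n) (hm : 1 ≤ m) (α : ℝ) [Fact (0 < α)] :
    (∃ R : PolyFock.FlatFock α n m ≃ₗᵢ[ℂ] PolyFock.Target n m,
      ∀ g j, R g j =ᵐ[PolyFock.muTilde n] fun ξ => PolyFock.RFlat α g ξ j) ∧
    (∀ g : PolyFock.FlatFock α n m, MeasureTheory.Integrable g.1 MeasureTheory.volume →
      ∀ j, ∀ᵐ ξ : PolyFock.E n,
        PolyFock.RFlat α g ξ j =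
          ((1 / ((2 : ℝ) ^ ((n : ℝ) / 2) * Real.pi ^ (3 * (n : ℝ) / 4)) : ℝ) : ℂ) *
            ∫ p : PolyFock.E n × PolyFock.E n,
              g.1 p * Complex.exp (-Complex.I * (inner ℝ p.1 ξ : ℝ)) *
                (PolyFock.hermiteProd j ξ p.2 : ℂ)) ∧
    (∃ R : PolyFock.Fock α n m ≃ₗᵢ[ℂ] PolyFock.Target n m,
      ∀ f j, R f j =ᵐ[PolyFock.muTilde n] fun ξ => PolyFock.RFock α f ξ j) ∧
    (∀ f : PolyFock.Fock α n m,
      MeasureTheory.Integrable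
        (fun z : Fin n → ℂ => ‖f.1 z‖ * Real.exp (-(α / 2) * ∑ r, ‖z r‖ ^ 2))
        MeasureTheory.volume →
      ∀ j, ∀ᵐ ξ : PolyFock.E n,
        PolyFock.RFock α f ξ j =
          ((1 / Real.pi ^ (3 * (n : ℝ) / 4) : ℝ) : ℂ) *
            ∫ p : PolyFock.E n × PolyFock.E n,
              f.1 (fun r => ((p.1 r : ℂ) + Complex.I * (p.2 r : ℂ)) / (Real.sqrt α : ℂ)) *
                Complex.exp (-(‖p.1‖ ^ 2 : ℝ) / 2 - (‖p.2‖ ^ 2 : ℝ) / 2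
                  - Complex.I * (inner ℝ p.1 (p.2 + ξ) : ℝ)) *
                (PolyFock.hermiteProd j ξ p.2 : ℂ)) := by
  exact ⟨⟨PolyFock.flatIsometry α n m, PolyFock.flatIsometry_ae_eq α⟩,
    PolyFock.RFlat_ae_eq_integral α,
    ⟨(PolyFock.flattenIsometry α n m).trans (PolyFock.flatIsometry α n m),
      fun f => PolyFock.flatIsometry_ae_eq α (PolyFock.U α n m f)⟩,
    PolyFock.RFock_ae_eq_integral α⟩
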